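/- An instance of the Risk-aware Recharging Rendezvous Problem (RRRP) is a finite bipartite graph $G=(V_a\cup V_g,E)$ whose UAV vertices are partitioned as $V_a=\mathcal V_1\sqcup\dots\sqcup\mathcal V_{N_a}$ ($\mathcal V_r$ belongs to UAV $r$), with edge costs $c_{ij}\ge 0$, edge success probabilities $p_{ij}\in(0,1]$ and a risk tolerance $\rho\in(0,1)$. The RRRP integer program is $$\min\ c(x)=\sum_{(i,j)\in E}c_{ij}x_{ij}$$ subject to $$\text{(1) }\sum_{(i,j)\in E}\log\tfrac1{p_{ij}}\,x_{ij}\le\log\tfrac1\rho,\qquad \text{(2) }\sum_{i\in\mathcal V_r}\sum_j x_{ij}=1\ \ (1\le r\le N_a),$$ $$\text{(3) }\sum_i x_{ij}\le 1\ \ (j\in V_g),\qquad \text{(4) }x_{ij}\in\{0,1\}.$$ If the program is feasible, let $\mathrm{opt}$ denote its optimal value. Theorem. There is a $(1+\epsilon,2)$-bicriteria approximation algorithm for the RRRP integer program: there are constants $C,k$ and a single program for a real random access machine (unit-cost field operations and comparisons on real numbers; unit-cost addition, truncated subtraction and comparison on natural numbers used for indexing; no rounding) that, given any $\epsilon\in(0,1]$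 and the data of any instance ($G$ as a list of edges, the partition, the costs $c_{ij}$, the weights $a_{ij}=\log(1/p_{ij})$ and the bound $B=\log(1/\rho)$), halts after at most $$C\,(|E|+1)^{\lceil 1/\epsilon\rceil}\,\bigl(N_a+|V_a|+|V_g|+|E|+1\bigr)^{k}$$ steps, hence in polynomial time for every fixed $\epsilon$; and, whenever the instance is feasible, it returns an $x$ that satisfies (1), (2) and (4) and $$c(x)\le(1+\epsilon)\,\mathrm{opt},\qquad \sum_i x_{ij}\le 2\ \text{ for all } j\in V_g,$$ where moreover $\sum_i x_{ij}=2$ for at most one $j\in V_g$. (So if every rendezvous location of a UGV is represented by $d\ge1$ vertices of $V_g$, at most one location has to serve more than $d$ UAVs at a time, and it serves $d+1$.) -/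

import Mathlib

/-! ### A real random access machine

A structured imperative language over a memory of arrays of natural numbers and arrays of real
numbers, in which every executed assignment and every evaluated test counts as one step.
Naturals (addresses, counters) admit only addition, truncated subtraction and comparison; reals
admit the four field operations with rational constants and exact comparison. There is no rounding
and no other conversion of a real number into a natural number. -/

namespace RealRAM

/-- Memory: `nat a i` is cell `i` of the natural-number array `a`, `real a i` is cell `i` of the
real array `a`. -/
structure State where
  nat : ℕ → ℕ → ℕ
  real : ℕ → ℕ → ℝ

/-- Natural-number expressions (`get a i` reads a cell, with an indirect address `i`). -/
inductive NExp where
  | const (n : ℕ)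
  | get (a : ℕ) (i : NExp)
  | add (e₁ e₂ : NExp)
  | sub (e₁ e₂ : NExp)

/-- Real expressions. -/
inductive RExp where
  | const (q : ℚ)
  | get (a : ℕ) (i : NExp)
  | add (e₁ e₂ : RExp)
  | sub (e₁ e₂ : RExp)
  | mul (e₁ e₂ : RExp)
  | div (e₁ e₂ : RExp)

/-- Tests. -/
inductive BExp where
  | natLE (e₁ e₂ : NExp)
  | realLE (e₁ e₂ : RExp)
  | not (b : BExp)
  | and (b₁ b₂ : BExp)

/-- Programs. A program is one fixed finite text, independent of the input; `loop b c` is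
`while b do c`. -/
inductive Prog where
  | skip
  | setNat (a : ℕ) (i e : NExp)
  | setReal (a : ℕ) (i : NExp) (e : RExp)
  | seq (c₁ c₂ : Prog)
  | cond (b : BExp) (c₁ c₂ : Prog)
  | loop (b : BExp) (c : Prog)

def NExp.eval (s : State) : NExp → ℕ
  | .const n => n
  | .get a i => s.nat a (i.eval s)
  | .add e₁ e₂ => e₁.eval s + e₂.eval s
  | .sub e₁ e₂ => e₁.eval s - e₂.eval s

/-- Division by zero returns zero. -/
noncomputable def RExp.eval (s : State) : RExp → ℝ
  | .const q => (q : ℝ)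
  | .get a i => s.real a (i.eval s)
  | .add e₁ e₂ => e₁.eval s + e₂.eval s
  | .sub e₁ e₂ => e₁.eval s - e₂.eval s
  | .mul e₁ e₂ => e₁.eval s * e₂.eval s
  | .div e₁ e₂ => e₁.eval s / e₂.eval s

def BExp.Holds (s : State) : BExp → Prop
  | .natLE e₁ e₂ => e₁.eval s ≤ e₂.eval s
  | .realLE e₁ e₂ => e₁.eval s ≤ e₂.eval s
  | .not b => ¬ b.Holds s
  | .and b₁ b₂ => b₁.Holds s ∧ b₂.Holds s

/-- Overwrite cell `i` of the natural-number array `a`. -/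
def State.updNat (s : State) (a i v : ℕ) : State :=
  { s with nat := Function.update s.nat a (Function.update (s.nat a) i v) }

/-- Overwrite cell `i` of the real array `a`. -/
noncomputable def State.updReal (s : State) (a i : ℕ) (v : ℝ) : State :=
  { s with real := Function.update s.real a (Function.update (s.real a) i v) }

/-- `Runs c s t s'`: program `c`, started in memory `s`, halts in memory `s'` after exactly `t`
steps. Expressions are part of the program text, so the number of elementary operations is at most
`t` times a constant that depends on the program only. -/
inductive Runs : Prog → State → ℕ → State → Prop where
  | skip (s : State) : Runs .skip s 1 s
  | setNat (s : State) (a : ℕ) (i e : NExp) :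
      Runs (.setNat a i e) s 1 (s.updNat a (i.eval s) (e.eval s))
  | setReal (s : State) (a : ℕ) (i : NExp) (e : RExp) :
      Runs (.setReal a i e) s 1 (s.updReal a (i.eval s) (e.eval s))
  | seq {c₁ c₂ : Prog} {s s' s'' : State} {t t' : ℕ} :
      Runs c₁ s t s' → Runs c₂ s' t' s'' → Runs (.seq c₁ c₂) s (t + t') s''
  | condTrue {b : BExp} {c₁ c₂ : Prog} {s s' : State} {t : ℕ} :
      b.Holds s → Runs c₁ s t s' → Runs (.cond b c₁ c₂) s (t + 1) s'
  | condFalse {b : BExp} {c₁ c₂ : Prog} {s s' : State} {t : ℕ} :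
      ¬ b.Holds s → Runs c₂ s t s' → Runs (.cond b c₁ c₂) s (t + 1) s'
  | loopDone {b : BExp} {c : Prog} {s : State} :
      ¬ b.Holds s → Runs (.loop b c) s 1 s
  | loopStep {b : BExp} {c : Prog} {s s' s'' : State} {t t' : ℕ} :
      b.Holds s → Runs c s t s' → Runs (.loop b c) s' t' s'' →
        Runs (.loop b c) s (t + t' + 1) s''

/-- Execution is deterministic: the final memory and the step count are functions of the start. -/
theorem Runs.deterministic {c : Prog} {s s₁ : State} {t₁ : ℕ} (h₁ : Runs c s t₁ s₁) :
    ∀ {t₂ : ℕ} {s₂ : State}, Runs c s t₂ s₂ → t₁ = t₂ ∧ s₁ = s₂ := by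
  induction h₁ with
  | skip s => intro _ _ h; cases h; exact ⟨rfl, rfl⟩
  | setNat s a i e => intro _ _ h; cases h; exact ⟨rfl, rfl⟩
  | setReal s a i e => intro _ _ h; cases h; exact ⟨rfl, rfl⟩
  | seq _ _ ih₁ ih₂ =>
    intro _ _ h
    cases h with
    | seq k₁ k₂ =>
      obtain ⟨rfl, rfl⟩ := ih₁ k₁
      obtain ⟨rfl, rfl⟩ := ih₂ k₂
      exact ⟨rfl, rfl⟩
  | condTrue hb _ ih =>
    intro _ _ h
    cases h with
    | condTrue _ k => obtain ⟨rfl, rfl⟩ := ih k; exact ⟨rfl, rfl⟩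
    | condFalse hn _ => exact absurd hb hn
  | condFalse hb _ ih =>
    intro _ _ h
    cases h with
    | condTrue hn _ => exact absurd hn hb
    | condFalse _ k => obtain ⟨rfl, rfl⟩ := ih k; exact ⟨rfl, rfl⟩
  | loopDone hb =>
    intro _ _ h
    cases h with
    | loopDone _ => exact ⟨rfl, rfl⟩
    | loopStep hn _ _ => exact absurd hn hb
  | loopStep hb _ _ ih₁ ih₂ =>
    intro _ _ h
    cases h with
    | loopDone hn => exact absurd hb hn
    | loopStep _ k₁ k₂ =>
      obtain ⟨rfl, rfl⟩ := ih₁ k₁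
      obtain ⟨rfl, rfl⟩ := ih₂ k₂
      exact ⟨rfl, rfl⟩

end RealRAM

/-! ### The risk-aware recharging rendezvous problem -/

/-- An instance: a finite bipartite graph with UAV vertices `Fin numA`, UGV vertices `Fin numG` and
enumerated edges `Fin numE` (edge `e` joins `src e` and `dst e`). The UAV vertices are partitioned
among `numUAV` UAVs; vertex `i` belongs to UAV `owner i`. Edges carry a cost (a time) and a success
probability, and `rho` is the risk tolerance. -/
structure RRRP where
  numUAV : ℕ
  numA : ℕ
  numG : ℕ
  numE : ℕ
  owner : Fin numA → Fin numUAV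
  src : Fin numE → Fin numA
  dst : Fin numE → Fin numG
  edge_injective : Function.Injective (fun e => (src e, dst e))
  cost : Fin numE → ℝ
  cost_nonneg : ∀ e, 0 ≤ cost e
  prob : Fin numE → ℝ
  prob_pos : ∀ e, 0 < prob e
  prob_le_one : ∀ e, prob e ≤ 1
  rho : ℝ
  rho_pos : 0 < rho
  rho_lt_one : rho < 1

namespace RRRP

/-- The weight `log (1 / p)` of an edge. -/
noncomputable def weight (I : RRRP) (e : Fin I.numE) : ℝ := Real.log (1 / I.prob e)

/-- The knapsack bound `log (1 / ρ)`. -/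
noncomputable def bound (I : RRRP) : ℝ := Real.log (1 / I.rho)

/-- The objective `∑ c x`. -/
noncomputable def totalCost (I : RRRP) (x : Fin I.numE → ℕ) : ℝ := ∑ e, I.cost e * (x e : ℝ)

/-- The number of selected edges at the vertices of UAV `r`. -/
def usage (I : RRRP) (x : Fin I.numE → ℕ) (r : Fin I.numUAV) : ℕ :=
  ∑ e, if I.owner (I.src e) = r then x e else 0

/-- The number of selected edges at UGV vertex `j`. -/
def load (I : RRRP) (x : Fin I.numE → ℕ) (j : Fin I.numG) : ℕ :=
  ∑ e, if I.dst e = j then x e else 0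

/-- The constraints of the integer program, where each UGV vertex may be used up to `β` times. -/
structure Satisfies (I : RRRP) (β : ℕ) (x : Fin I.numE → ℕ) : Prop where
  integral : ∀ e, x e = 0 ∨ x e = 1
  knapsack : ∑ e, I.weight e * (x e : ℝ) ≤ I.bound
  assigned : ∀ r, I.usage x r = 1
  capacity : ∀ j, I.load x j ≤ β

/-- Feasibility for the integer program: each UGV vertex is used at most once. -/
def Feasible (I : RRRP) (x : Fin I.numE → ℕ) : Prop := I.Satisfies 1 x

/-- The optimal value of the integer program (meaningful when it is feasible). -/
noncomputable def opt (I : RRRP) : ℝ := sInf (I.totalCost '' {x | I.Feasible x})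

/-- In a feasible instance, `opt` is the attained minimum. -/
theorem isLeast_opt (I : RRRP) (h : ∃ x, I.Feasible x) :
    IsLeast (I.totalCost '' {x | I.Feasible x}) I.opt := by
  have hfin : {x : Fin I.numE → ℕ | I.Feasible x}.Finite := by
    refine (Set.finite_Iic (fun _ : Fin I.numE => 1)).subset fun x hx e => ?_
    rcases hx.integral e with h0 | h1
    · simp [h0]
    · simp [h1]
  obtain ⟨x, hx⟩ := h
  exact (hfin.image I.totalCost).isCompact.isLeast_sInf ⟨_, x, hx, rfl⟩

/-- Extend a finite sequence by zero. -/
def pad {α : Type} [Zero α] {n : ℕ} (f : Fin n → α) (i : ℕ) : α :=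
  if h : i < n then f ⟨i, h⟩ else 0

/-- Initial memory. Natural-number arrays: `0` holds the four sizes, `1` the owners, `2` and `3` the
ends of the edges. Real arrays: `0` holds `ε` and the knapsack bound, `1` the costs and `2` the
weights of the edges. All other cells are zero. -/
noncomputable def input (I : RRRP) (ε : ℝ) : RealRAM.State where
  nat a := match a with
    | 0 => pad ![I.numUAV, I.numA, I.numG, I.numE]
    | 1 => pad fun v => (I.owner v : ℕ)
    | 2 => pad fun e => (I.src e : ℕ)
    | 3 => pad fun e => (I.dst e : ℕ)
    | _ => fun _ => 0
  real a := match a with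
    | 0 => pad ![ε, I.bound]
    | 1 => pad I.cost
    | 2 => pad I.weight
    | _ => fun _ => 0

/-- The output is read from the first `numE` cells of natural-number array `4`. -/
def output (I : RRRP) (s : RealRAM.State) : Fin I.numE → ℕ := fun e => s.nat 4 e

/-- The size of an instance: number of UAVs, vertices and edges (plus one). -/
def size (I : RRRP) : ℕ := I.numUAV + I.numA + I.numG + I.numE + 1

end RRRP

/-! A feasible point picks one edge per UAV with distinct endpoints in the UGV vertices, so the
problem is a minimum cost bipartite matching with one knapsack constraint. The vertices of a UAV are
merged into one row. Further rows, columns and edges complete the graph, so that every assignment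
extends to a perfect matching (`IsAssignment.exists_extension`); edges that must not be used get
weight `B + 1`.

Guessing and rounding. Let `n` be the number of UAVs. The `g` most expensive edges of an optimal
assignment are guessed, where `g = n` or `1 + 1/n ≤ ε g`; `⌈1/ε⌉ + 1` edges suffice, and all guesses
are tried. If `cm` is the least cost of a guessed edge, the other edges of the assignment cost at
most `cm` each, and `g cm ≤ opt`. Their costs are divided by `δ = cm / n²` and rounded down to
integers of size at most `n²`. A solution of the rounded problem with additive error `n²` costs at
most `n² δ + n δ = cm (1 + 1/n) ≤ ε opt` more than the optimum (`cost_le_of_isTop`).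

Lagrangian relaxation. The Hungarian method minimizes `c + l w` over perfect matchings and returns
an optimal dual solution `(u, v)`. If the lightest matching violates the bound, the guess is
refuted; if the cheapest one respects it, nothing remains to be done. Otherwise a discrete Newton
iteration keeps a matching `M₁` within the bound and a matching `M₂` beyond it. The multiplier that
gives both the same combined cost is tried; a strictly better matching replaces one of the two, and
if there is none, both are optimal for the same `l`. Integrality of the costs bounds the number of
rounds (`between_of_below`, `newton_spec`).

Mixing. All edges of both matchings are then tight for one dual solution. Edges of `M₁` are
exchanged for edges of `M₂`, row by row along the alternating cycles. In the middle of a cycle one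
column `d` is covered twice and one column `h` not at all, so the combined cost is the dual value
plus `v d - v h`. Each cycle is entered at an unprocessed row whose `M₁`-column has the largest
potential, hence `v d ≤ v h` throughout. The walk stops just before the weight would exceed the
bound. One exchange further, the mixture is heavier than any matching within the bound and has no
larger combined cost, hence no larger cost; omitting that exchange loses at most the cost of one
edge, which is at most `n²` in rounded units (`Mixture.isSolution`). The column `d` is the only one
that can be overloaded.

The program is verified with `Ensures`, a calculus of total correctness with step bounds, in which
arrays that are not written are tracked syntactically. -/

namespace RealRAM

/-! ### Reasoning about programs -/

/-! ### Memory updates, frames and the rules of total correctness with step bounds -/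

section State
variable (s : State) (a i v : ℕ) (x : ℝ)

@[simp] theorem State.updNat_nat (b : ℕ) :
    (s.updNat a i v).nat b = if b = a then Function.update (s.nat a) i v else s.nat b := by
  simp only [State.updNat, Function.update_apply]

@[simp] theorem State.updNat_real : (s.updNat a i v).real = s.real := rfl

@[simp] theorem State.updReal_real (b : ℕ) :
    (s.updReal a i x).real b = if b = a then Function.update (s.real a) i x else s.real b := by
  simp only [State.updReal, Function.update_apply]

@[simp] theorem State.updReal_nat : (s.updReal a i x).nat = s.nat := rfl

end State

/-- May the program write to the natural-number array `a`? -/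
def Prog.writesNat (a : ℕ) : Prog → Bool
  | .skip => false
  | .setNat b _ _ => a == b
  | .setReal _ _ _ => false
  | .seq c₁ c₂ => c₁.writesNat a || c₂.writesNat a
  | .cond _ c₁ c₂ => c₁.writesNat a || c₂.writesNat a
  | .loop _ c => c.writesNat a

/-- May the program write to the real array `a`? -/
def Prog.writesReal (a : ℕ) : Prog → Bool
  | .skip => false
  | .setNat _ _ _ => false
  | .setReal b _ _ => a == b
  | .seq c₁ c₂ => c₁.writesReal a || c₂.writesReal a
  | .cond _ c₁ c₂ => c₁.writesReal a || c₂.writesReal a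
  | .loop _ c => c.writesReal a

/-- `s'` agrees with `s` on all arrays that `c` does not write. -/
structure Frame (c : Prog) (s s' : State) : Prop where
  nat : ∀ a, c.writesNat a = false → s'.nat a = s.nat a
  real : ∀ a, c.writesReal a = false → s'.real a = s.real a

theorem Frame.refl (c : Prog) (s : State) : Frame c s s := ⟨fun _ _ => rfl, fun _ _ => rfl⟩

theorem Frame.trans {c : Prog} {s s' s'' : State} (h : Frame c s s') (h' : Frame c s' s'') :
    Frame c s s'' :=
  ⟨fun a ha => (h'.nat a ha).trans (h.nat a ha), fun a ha => (h'.real a ha).trans (h.real a ha)⟩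

/-- The set of written arrays is computed from the program text. For a concrete program, the claim
that an array kept its contents therefore has `rfl` as its side condition. -/
theorem Runs.frame {c : Prog} {s s' : State} {t : ℕ} (h : Runs c s t s') : Frame c s s' := by
  induction h with
  | skip s => exact Frame.refl _ _
  | setNat s a i e =>
    refine ⟨fun b hb => ?_, fun b _ => rfl⟩
    simp [Prog.writesNat] at hb
    simp [hb]
  | setReal s a i e =>
    refine ⟨fun b _ => rfl, fun b hb => ?_⟩
    simp [Prog.writesReal] at hb
    simp [hb]
  | seq _ _ ih₁ ih₂ =>
    refine ⟨fun b hb => ?_, fun b hb => ?_⟩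
    · simp only [Prog.writesNat, Bool.or_eq_false_iff] at hb
      rw [ih₂.nat b hb.2, ih₁.nat b hb.1]
    · simp only [Prog.writesReal, Bool.or_eq_false_iff] at hb
      rw [ih₂.real b hb.2, ih₁.real b hb.1]
  | condTrue _ _ ih =>
    refine ⟨fun b hb => ?_, fun b hb => ?_⟩
    · simp only [Prog.writesNat, Bool.or_eq_false_iff] at hb
      exact ih.nat b hb.1
    · simp only [Prog.writesReal, Bool.or_eq_false_iff] at hb
      exact ih.real b hb.1
  | condFalse _ _ ih =>
    refine ⟨fun b hb => ?_, fun b hb => ?_⟩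
    · simp only [Prog.writesNat, Bool.or_eq_false_iff] at hb
      exact ih.nat b hb.2
    · simp only [Prog.writesReal, Bool.or_eq_false_iff] at hb
      exact ih.real b hb.2
  | loopDone _ => exact Frame.refl _ _
  | loopStep _ _ _ ih₁ ih₂ =>
    exact ⟨fun b hb => (ih₂.nat b hb).trans (ih₁.nat b hb),
      fun b hb => (ih₂.real b hb).trans (ih₁.real b hb)⟩

/-- Started in `s`, the program halts within `T` steps in a state that satisfies `Q`. -/
def Ensures (c : Prog) (s : State) (T : ℕ) (Q : State → Prop) : Prop :=
  ∃ t s', Runs c s t s' ∧ t ≤ T ∧ Q s'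

namespace Ensures
variable {c c₁ c₂ : Prog} {s : State} {T T' T₁ T₂ : ℕ} {Q Q' : State → Prop}

theorem mono (h : Ensures c s T Q) (hT : T ≤ T') (hQ : ∀ s', Frame c s s' → Q s' → Q' s') :
    Ensures c s T' Q' := by
  obtain ⟨t, s', hr, ht, hq⟩ := h
  exact ⟨t, s', hr, ht.trans hT, hQ s' hr.frame hq⟩

theorem post (h : Ensures c s T Q) (hQ : ∀ s', Frame c s s' → Q s' → Q' s') :
    Ensures c s T Q' := h.mono le_rfl hQ

/-- The frame of `c₁` is handed to the second premise, so that intermediate assertions need not list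
what stays unchanged. -/
theorem seq (h₁ : Ensures c₁ s T₁ Q')
    (h₂ : ∀ s', Frame c₁ s s' → Q' s' → Ensures c₂ s' T₂ Q) :
    Ensures (.seq c₁ c₂) s (T₁ + T₂) Q := by
  obtain ⟨t, s', hr, ht, hq⟩ := h₁
  obtain ⟨t', s'', hr', ht', hq'⟩ := h₂ s' hr.frame hq
  exact ⟨_, _, .seq hr hr', by omega, hq'⟩

theorem cond {b : BExp} (h₁ : b.Holds s → Ensures c₁ s T Q) (h₂ : ¬ b.Holds s → Ensures c₂ s T Q) :
    Ensures (.cond b c₁ c₂) s (T + 1) Q := by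
  by_cases hb : b.Holds s
  · obtain ⟨t, s', hr, ht, hq⟩ := h₁ hb
    exact ⟨_, _, .condTrue hb hr, by omega, hq⟩
  · obtain ⟨t, s', hr, ht, hq⟩ := h₂ hb
    exact ⟨_, _, .condFalse hb hr, by omega, hq⟩

/-- Rule for loops: `k` in `Inv k` bounds the number of remaining rounds. -/
theorem loop {b : BExp} (Inv : ℕ → State → Prop) (K : ℕ) (h0 : Inv K s)
    (step : ∀ k s', Frame c s s' → Inv k s' → b.Holds s' →
      Ensures c s' T (fun s'' => ∃ k' < k, Inv k' s'')) :
    Ensures (.loop b c) s (K * (T + 1) + 1) (fun s' => (∃ k, Inv k s') ∧ ¬ b.Holds s') := by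
  -- The induction restarts the loop after each round, so the start must vary; the frame is kept
  -- relative to the original `s`.
  suffices H : ∀ K s', Frame c s s' → Inv K s' →
      Ensures (.loop b c) s' (K * (T + 1) + 1) (fun s' => (∃ k, Inv k s') ∧ ¬ b.Holds s') from
    H K s (Frame.refl _ _) h0
  intro K
  induction K using Nat.strong_induction_on with
  | _ K ih =>
    intro s' hf hI
    by_cases hb : b.Holds s'
    · obtain ⟨t, s'', hr, ht, k', hk', hI'⟩ := step K s' hf hI hb
      obtain ⟨t', s₃, hr', ht', hq⟩ := ih k' hk' s'' (hf.trans hr.frame) hI'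
      refine ⟨_, _, .loopStep hb hr hr', ?_, hq⟩
      have : (k' + 1) * (T + 1) ≤ K * (T + 1) := Nat.mul_le_mul_right _ hk'
      have : (k' + 1) * (T + 1) = k' * (T + 1) + (T + 1) := by ring
      omega
    · exact ⟨_, _, .loopDone hb, by omega, ⟨K, hI⟩, hb⟩

end Ensures

/-! ### Loop-free programs -/

def Prog.straight : Prog → Bool
  | .seq c₁ c₂ => c₁.straight && c₂.straight
  | .cond _ c₁ c₂ => c₁.straight && c₂.straight
  | .loop _ _ => false
  | _ => true

/-- Only an upper bound: a conditional is charged for both branches. The value at a loop is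
irrelevant, since only loop-free programs are measured. -/
def Prog.steps : Prog → ℕ
  | .seq c₁ c₂ => c₁.steps + c₂.steps
  | .cond _ c₁ c₂ => c₁.steps + c₂.steps + 1
  | _ => 1

open Classical in
/-- The effect of a loop-free program. -/
noncomputable def Prog.exec : Prog → State → State
  | .skip, s => s
  | .setNat a i e, s => s.updNat a (i.eval s) (e.eval s)
  | .setReal a i e, s => s.updReal a (i.eval s) (e.eval s)
  | .seq c₁ c₂, s => c₂.exec (c₁.exec s)
  | .cond b c₁ c₂, s => if b.Holds s then c₁.exec s else c₂.exec s
  | .loop _ _, s => s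

/-- Reduces a loop-free block to a symbolic evaluation by `simp`. -/
theorem Ensures.straight {c : Prog} {s : State} {Q : State → Prop} (hc : c.straight = true)
    (hQ : Q (c.exec s)) : Ensures c s c.steps Q := by
  suffices H : ∀ c : Prog, c.straight = true → ∀ s, Ensures c s c.steps (fun s' => s' = c.exec s) by
    exact (H c hc s).post (by rintro _ _ rfl; exact hQ)
  clear hc hQ Q s c
  intro c
  induction c with
  | skip => exact fun _ s => ⟨_, _, .skip s, le_rfl, rfl⟩
  | setNat a i e => exact fun _ s => ⟨_, _, .setNat s a i e, le_rfl, rfl⟩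
  | setReal a i e => exact fun _ s => ⟨_, _, .setReal s a i e, le_rfl, rfl⟩
  | seq c₁ c₂ ih₁ ih₂ =>
    intro hc s
    simp only [Prog.straight, Bool.and_eq_true] at hc
    exact (ih₁ hc.1 s).seq (by rintro _ _ rfl; exact ih₂ hc.2 _)
  | cond b c₁ c₂ ih₁ ih₂ =>
    intro hc s
    simp only [Prog.straight, Bool.and_eq_true] at hc
    refine (Ensures.cond (T := c₁.steps + c₂.steps) (fun hb => ?_) (fun hb => ?_)).mono le_rfl
      (fun _ _ h => h)
    · exact (ih₁ hc.1 s).mono (by omega) (fun _ _ h => by simp [Prog.exec, hb, h])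
    · exact (ih₂ hc.2 s).mono (by omega) (fun _ _ h => by simp [Prog.exec, hb, h])
  | loop b c _ => intro hc; simp [Prog.straight] at hc

attribute [simp] NExp.eval RExp.eval BExp.Holds Prog.exec

/-! ### Counting loops -/

/-- A natural-number variable: cell `0` of its own array. -/
abbrev nv (a : ℕ) : NExp := .get a (.const 0)

/-- A real variable. -/
abbrev rv (a : ℕ) : RExp := .get a (.const 0)

abbrev Prog.letN (a : ℕ) (e : NExp) : Prog := .setNat a (.const 0) e

abbrev Prog.letR (a : ℕ) (e : RExp) : Prog := .setReal a (.const 0) e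

abbrev BExp.natLT (e₁ e₂ : NExp) : BExp := .not (.natLE e₂ e₁)

abbrev BExp.realLT (e₁ e₂ : RExp) : BExp := .not (.realLE e₂ e₁)

abbrev BExp.or (b₁ b₂ : BExp) : BExp := .not (.and (.not b₁) (.not b₂))

/-- `for i < n do c`, with the counter in cell `0` of the array `i`. -/
def Prog.forTo (i : ℕ) (n : NExp) (c : Prog) : Prog :=
  .seq (.letN i (.const 0)) (.loop (.natLT (nv i) n) (.seq c (.letN i (.add (nv i) (.const 1)))))

/-- Rule for counting loops. -/
theorem Ensures.forTo {i n Z T : ℕ} {ne : NExp} {c : Prog} {s : State} (Inv : ℕ → State → Prop)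
    (hi : c.writesNat i = false)
    (hn : ∀ s', Frame (Prog.forTo i ne c) s s' → ne.eval s' = n) (hZ : n ≤ Z)
    (h0 : Inv 0 (s.updNat i 0 0))
    (step : ∀ k < n, ∀ s', Frame (Prog.forTo i ne c) s s' → s'.nat i 0 = k → Inv k s' →
      Ensures c s' T (fun s'' => Inv (k + 1) (s''.updNat i 0 (k + 1)))) :
    Ensures (Prog.forTo i ne c) s (Z * (T + 2) + 2) (Inv n) := by
  have hF : ∀ s', Frame (.loop (.natLT (nv i) ne) (.seq c (.letN i (.add (nv i) (.const 1)))))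
      (s.updNat i 0 0) s' → Frame (Prog.forTo i ne c) s s' := by
    intro s' h
    refine ⟨fun a ha => ?_, fun a ha => ?_⟩
    · have h2 := ha
      simp only [Prog.forTo, Prog.writesNat, Bool.or_eq_false_iff] at ha
      rw [h.nat a (by simp only [Prog.writesNat, Bool.or_eq_false_iff]; exact ha.2)]
      have : a ≠ i := by simpa using ha.1
      simp [this]
    · simp only [Prog.forTo, Prog.writesReal, Bool.or_eq_false_iff] at ha
      rw [h.real a (by simp only [Prog.writesReal, Bool.or_eq_false_iff]; exact ha.2)]
      simp
  have hl : Ensures (.loop (.natLT (nv i) ne) (.seq c (.letN i (.add (nv i) (.const 1)))))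
      (s.updNat i 0 0) (n * (T + 1 + 1) + 1) (Inv n) := by
    refine (Ensures.loop (T := T + 1)
      -- The loop rule counts the remaining rounds downwards, whereas `Inv` counts the completed
      -- rounds upwards.
      (fun k s' => k ≤ n ∧ s'.nat i 0 = n - k ∧ Inv (n - k) s') n ⟨le_rfl, by simp, by simpa using h0⟩
      ?_).post ?_
    · rintro k s' hf ⟨hk, hik, hI⟩ hb
      have hf' := hF s' ⟨hf.nat, hf.real⟩
      have hlt : n - k < n := by
        have := hn s' hf'
        simp at hb
        omega
      refine (step (n - k) hlt s' hf' hik hI).seq (T₂ := 1) ?_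
      intro s₁ hf₁ hI₁
      have h1 : s₁.nat i 0 = n - k := by rw [hf₁.nat i hi, hik]
      refine Ensures.straight rfl ⟨k - 1, by omega, by omega, ?_, ?_⟩
      · simp [h1]; omega
      · have : n - (k - 1) = n - k + 1 := by omega
        rw [this]
        simpa [h1] using hI₁
    · rintro s' hf ⟨⟨k, hk, hik, hI⟩, hb⟩
      have := hn s' (hF s' ⟨hf.nat, hf.real⟩)
      simp at hb
      have : k = 0 := by omega
      subst this
      simpa using hI
  have h1 : Ensures (.letN i (.const 0)) s 1 (fun s' => s' = s.updNat i 0 0) :=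
    Ensures.straight rfl rfl
  refine (h1.seq (T₂ := n * (T + 1 + 1) + 1) ?_).mono ?_ (fun _ _ h => h)
  · rintro _ _ rfl
    exact hl
  · have := Nat.mul_le_mul_right (T + 2) hZ
    have : n * (T + 1 + 1) = n * (T + 2) := by ring
    omega

/-- Fill the first `n` cells of a natural-number array. -/
theorem Ensures.fillNat {i a n Z : ℕ} {ne e : NExp} {s : State} (f : ℕ → ℕ) (hia : i ≠ a)
    (hn : ∀ s', Frame (Prog.forTo i ne (.setNat a (nv i) e)) s s' → ne.eval s' = n) (hZ : n ≤ Z)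
    (he : ∀ k < n, ∀ s', Frame (Prog.forTo i ne (.setNat a (nv i) e)) s s' → s'.nat i 0 = k →
      s'.nat a k = s.nat a k → e.eval s' = f k) :
    Ensures (Prog.forTo i ne (.setNat a (nv i) e)) s (Z * 3 + 2)
      (fun s' => s'.nat a = fun j => if j < n then f j else s.nat a j) := by
  refine (Ensures.forTo (T := 1)
    (fun k s' => s'.nat a = fun j => if j < k then f j else s.nat a j) (by simp [Prog.writesNat, hia])
    hn hZ (by simp [hia.symm]) ?_)
  intro k hk s' hf hik hI
  refine Ensures.straight rfl ?_
  have h1 := he k hk s' hf hik (by rw [hI]; simp)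
  funext j
  simp only [Prog.exec, NExp.eval, hik, h1, State.updNat_nat, hia.symm, if_false, if_true,
    Function.update_apply, hI]
  split_ifs <;> first | rfl | omega | (subst_vars; rfl)

/-- Fill the first `n` cells of a real array. -/
theorem Ensures.fillReal {i a n Z : ℕ} {ne : NExp} {e : RExp} {s : State} (f : ℕ → ℝ)
    (hn : ∀ s', Frame (Prog.forTo i ne (.setReal a (nv i) e)) s s' → ne.eval s' = n) (hZ : n ≤ Z)
    (he : ∀ k < n, ∀ s', Frame (Prog.forTo i ne (.setReal a (nv i) e)) s s' → s'.nat i 0 = k →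
      s'.real a k = s.real a k → e.eval s' = f k) :
    Ensures (Prog.forTo i ne (.setReal a (nv i) e)) s (Z * 3 + 2)
      (fun s' => s'.real a = fun j => if j < n then f j else s.real a j) := by
  refine (Ensures.forTo (T := 1)
    (fun k s' => s'.real a = fun j => if j < k then f j else s.real a j) rfl hn hZ (by simp) ?_)
  intro k hk s' hf hik hI
  refine Ensures.straight rfl ?_
  have h1 := he k hk s' hf hik (by rw [hI]; simp)
  funext j
  simp only [Prog.exec, NExp.eval, hik, h1, State.updNat_real, State.updReal_real, if_true,
    Function.update_apply, hI]
  split_ifs <;> first | rfl | omega | (subst_vars; rfl)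

/-- Sum up `n` terms. -/
theorem Ensures.sumReal {i a n Z : ℕ} {ne : NExp} {e : RExp} {s : State} (f : ℕ → ℝ)
    (hn : ∀ s', Frame (.seq (.letR a (.const 0)) (Prog.forTo i ne (.letR a (.add (rv a) e)))) s s' →
      ne.eval s' = n) (hZ : n ≤ Z)
    (he : ∀ k < n, ∀ s', Frame (.seq (.letR a (.const 0)) (Prog.forTo i ne (.letR a (.add (rv a) e)))) s s' →
      s'.nat i 0 = k → e.eval s' = f k) :
    Ensures (.seq (.letR a (.const 0)) (Prog.forTo i ne (.letR a (.add (rv a) e)))) s (Z * 3 + 3)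
      (fun s' => s'.real a 0 = ∑ j ∈ Finset.range n, f j) := by
  have hfr : ∀ s', Frame (Prog.forTo i ne (.letR a (.add (rv a) e))) (s.updReal a 0 0) s' →
      Frame (.seq (.letR a (.const 0)) (Prog.forTo i ne (.letR a (.add (rv a) e)))) s s' := by
    intro s' h
    refine ⟨fun b hb => ?_, fun b hb => ?_⟩
    · simp only [Prog.writesNat, Bool.or_eq_false_iff] at hb
      rw [h.nat b hb.2]; rfl
    · simp only [Prog.writesReal, Bool.or_eq_false_iff] at hb
      rw [h.real b hb.2]
      have : b ≠ a := by simpa using hb.1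
      simp [this]
  have h1 : Ensures (.letR a (.const 0)) s 1 (fun s' => s' = s.updReal a 0 0) :=
    Ensures.straight rfl (by simp)
  refine (h1.seq (T₂ := Z * 3 + 2) ?_).mono (by omega) (fun _ _ h => h)
  rintro _ _ rfl
  refine (Ensures.forTo (T := 1)
    (fun k s' => s'.real a 0 = ∑ j ∈ Finset.range k, f j) rfl (fun s' h => hn s' (hfr s' h)) hZ
      (by simp) ?_)
  intro k hk s' hf hik hI
  refine Ensures.straight rfl ?_
  have h1 := he k hk s' (hfr s' hf) hik
  simp [h1, hI, Finset.sum_range_succ]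

end RealRAM

/-! ### Minimum cost perfect matchings in a bipartite multigraph -/

namespace Assignment

open Finset

/-- A bipartite multigraph with rows and columns `0, …, N - 1` and edges `0, …, m - 1`, in which
every row is joined to every column. -/
structure Net (N m : ℕ) (row col : ℕ → ℕ) : Prop where
  row_lt : ∀ e < m, row e < N
  col_lt : ∀ e < m, col e < N
  complete : ∀ r < N, ∀ j < N, ∃ e < m, row e = r ∧ col e = j

/-- A perfect matching: row `r` is matched by the edge `M r`. -/
structure IsMatching (N m : ℕ) (row col : ℕ → ℕ) (M : ℕ → ℕ) : Prop where
  lt : ∀ r < N, M r < m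
  row_eq : ∀ r < N, row (M r) = r
  inj : ∀ r < N, ∀ q < N, col (M r) = col (M q) → r = q

/-- A choice of one edge per row that covers every column once, except that `h` is covered once less
and `d` once more. -/
structure IsNearMatching (N m : ℕ) (row col : ℕ → ℕ) (x : ℕ → ℕ) (h d : ℕ) : Prop where
  lt : ∀ r < N, x r < m
  row_eq : ∀ r < N, row (x r) = r
  sum_col : ∀ g : ℕ → ℝ, ∑ r ∈ range N, g (col (x r)) = ∑ j ∈ range N, g j + g d - g h

/-- The total of `f` over the chosen edges. -/
noncomputable def total (N : ℕ) (f : ℕ → ℝ) (M : ℕ → ℕ) : ℝ := ∑ r ∈ range N, f (M r)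

/-- A matching of the rows below `k` with a dual solution under which its edges are tight. -/
structure Partial (N m : ℕ) (row col : ℕ → ℕ) (w : ℕ → ℝ) (k : ℕ) (X : ℕ → ℕ) (u v : ℕ → ℝ) :
    Prop where
  feas : ∀ e < m, u (row e) + v (col e) ≤ w e
  lt : ∀ q < k, X q < m
  row_eq : ∀ q < k, row (X q) = q
  tight : ∀ q < k, w (X q) = u q + v (col (X q))
  inj : ∀ q < k, ∀ q' < k, col (X q) = col (X q') → q = q'

/-! ### Linear programming duality for perfect matchings -/

variable {N m : ℕ} {row col : ℕ → ℕ} {w : ℕ → ℝ} {M X : ℕ → ℕ} {u v : ℕ → ℝ}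

/-- There are as many columns as rows, so the injective map from rows to columns is a bijection and
reindexes the sum. -/
theorem IsMatching.sum_col (hn : Net N m row col) (hM : IsMatching N m row col M) (g : ℕ → ℝ) :
    ∑ r ∈ range N, g (col (M r)) = ∑ j ∈ range N, g j := by
  have hmaps : ∀ r (hr : r ∈ range N), col (M r) ∈ range N := fun r hr => by
    simp only [mem_range] at hr ⊢
    exact hn.col_lt _ (hM.lt r hr)
  have hinj : ∀ r q (hr : r ∈ range N) (hq : q ∈ range N), col (M r) = col (M q) → r = q :=
    fun r q hr hq h => hM.inj r (by simpa using hr) q (by simpa using hq) h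
  refine Finset.sum_nbij (fun r => col (M r)) hmaps ?_ ?_ (fun _ _ => rfl)
  · intro r hr q hq h
    exact hinj r q hr hq h
  · intro j hj
    obtain ⟨r, hr, h⟩ := Finset.surj_on_of_inj_on_of_card_le (fun r _ => col (M r)) hmaps hinj le_rfl j hj
    exact ⟨r, hr, h.symm⟩

/-- With `h = d` the two corrections cancel; the index `0` is arbitrary. -/
theorem IsMatching.isNear (hn : Net N m row col) (hM : IsMatching N m row col M) :
    IsNearMatching N m row col M 0 0 :=
  ⟨hM.lt, hM.row_eq, fun g => by rw [hM.sum_col hn]; ring⟩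

theorem Partial.isMatching (h : Partial N m row col w N X u v) : IsMatching N m row col X :=
  ⟨h.lt, h.row_eq, h.inj⟩

/-- Weak duality: the dual constraints are added up over the edges of the matching, which meets
every row and every column once. -/
theorem dual_le (hn : Net N m row col) (hf : ∀ e < m, u (row e) + v (col e) ≤ w e)
    (hM : IsMatching N m row col M) :
    ∑ r ∈ range N, u r + ∑ j ∈ range N, v j ≤ total N w M := by
  rw [← hM.sum_col hn v, ← sum_add_distrib]
  refine sum_le_sum fun r hr => ?_
  have hr' := mem_range.1 hr
  have := hf _ (hM.lt r hr')
  rwa [hM.row_eq r hr'] at this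

theorem Partial.total_eq (hn : Net N m row col) (h : Partial N m row col w N X u v) :
    total N w X = ∑ r ∈ range N, u r + ∑ j ∈ range N, v j := by
  rw [← h.isMatching.sum_col hn v, ← sum_add_distrib]
  exact sum_congr rfl fun r hr => h.tight r (mem_range.1 hr)

theorem Partial.total_le (hn : Net N m row col) (h : Partial N m row col w N X u v)
    (hM : IsMatching N m row col M) : total N w X ≤ total N w M :=
  (h.total_eq hn).trans_le (dual_le hn h.feas hM)

/-- An optimal matching is tight for every optimal dual solution. -/
theorem Partial.tight_of_total_le (hn : Net N m row col) (h : Partial N m row col w N X u v)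
    (hM : IsMatching N m row col M) (hle : total N w M ≤ total N w X) :
    ∀ r < N, w (M r) = u r + v (col (M r)) := by
  intro r hr
  have h0 : ∀ q ∈ range N, 0 ≤ w (M q) - (u q + v (col (M q))) := fun q hq => by
    have hq' := mem_range.1 hq
    have := h.feas _ (hM.lt q hq')
    rw [hM.row_eq q hq'] at this
    linarith
  -- Complementary slackness: the total slack of `M` is its cost minus the dual value, and the dual
  -- value is the cost of `X`.
  have h1 : ∑ q ∈ range N, (w (M q) - (u q + v (col (M q)))) = 0 := by
    refine le_antisymm ?_ (sum_nonneg h0)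
    rw [sum_sub_distrib, sum_add_distrib, hM.sum_col hn, ← h.total_eq hn]
    simpa [total] using hle
  have := (sum_eq_zero_iff_of_nonneg h0).1 h1 r (mem_range.2 hr)
  linarith

/-! #### The Hungarian method -/

/-- The state of the search for an augmenting path for row `k`. `S` and `T` mark the reached rows and
columns; `A r` is the matching of the rows `≤ k` other than `r` that arises from `X` by shifting along
the alternating path to the reached row `r`. -/
structure Phase (N m : ℕ) (row col : ℕ → ℕ) (w : ℕ → ℝ) (k : ℕ) (X : ℕ → ℕ) (u v : ℕ → ℝ)
    (S T : ℕ → ℕ) (A : ℕ → ℕ → ℕ) : Prop where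
  feas : ∀ e < m, u (row e) + v (col e) ≤ w e
  root : 1 ≤ S k
  S_le : ∀ r < N, 1 ≤ S r → r ≤ k
  lt : ∀ r ≤ k, 1 ≤ S r → ∀ q ≤ k, q ≠ r → A r q < m
  row_eq : ∀ r ≤ k, 1 ≤ S r → ∀ q ≤ k, q ≠ r → row (A r q) = q
  tight : ∀ r ≤ k, 1 ≤ S r → ∀ q ≤ k, q ≠ r → w (A r q) = u q + v (col (A r q))
  inj : ∀ r ≤ k, 1 ≤ S r → ∀ q ≤ k, q ≠ r → ∀ q' ≤ k, q' ≠ r → col (A r q) = col (A r q') → q = q'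
  marked : ∀ r ≤ k, 1 ≤ S r → ∀ q ≤ k, q ≠ r → 1 ≤ S q → 1 ≤ T (col (A r q))
  unmarked : ∀ r ≤ k, 1 ≤ S r → ∀ q ≤ k, q ≠ r → S q = 0 → A r q = X q ∧ T (col (X q)) = 0
  cols : ∀ j < N, 1 ≤ T j → ∃ q < k, col (X q) = j

variable {k : ℕ} {S T : ℕ → ℕ} {A : ℕ → ℕ → ℕ}

/-- At the start only the root `k` is reached, by the empty path, so the shifted matching `A k` is
`X` itself. -/
theorem Phase.init (h : Partial N m row col w k X u v) (hS : ∀ r < N, S r = if r = k then 1 else 0)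
    (hk : k < N) (hT : ∀ j < N, T j = 0) (hn : Net N m row col) (hA : ∀ q < k, A k q = X q) :
    Phase N m row col w k X u v S T A := by
  have hSk : ∀ r ≤ k, 1 ≤ S r → r = k := fun r hr h1 => by
    by_contra hne
    rw [hS r (by omega), if_neg hne] at h1
    omega
  have hq : ∀ q ≤ k, q ≠ k → q < k := fun q h1 h2 => by omega
  refine ⟨h.feas, by simp [hS k hk], fun r hr h1 => ?_, ?_, ?_, ?_, ?_, ?_, ?_, ?_⟩
  · by_contra hne
    rw [hS r hr, if_neg (by omega)] at h1
    omega
  · intro r hr h1 q hq1 hq2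
    obtain rfl := hSk r hr h1
    rw [hA q (hq q hq1 hq2)]; exact h.lt q (hq q hq1 hq2)
  · intro r hr h1 q hq1 hq2
    obtain rfl := hSk r hr h1
    rw [hA q (hq q hq1 hq2)]; exact h.row_eq q (hq q hq1 hq2)
  · intro r hr h1 q hq1 hq2
    obtain rfl := hSk r hr h1
    rw [hA q (hq q hq1 hq2)]; exact h.tight q (hq q hq1 hq2)
  · intro r hr h1 q hq1 hq2 q' hq1' hq2'
    obtain rfl := hSk r hr h1
    rw [hA q (hq q hq1 hq2), hA q' (hq q' hq1' hq2')]
    exact h.inj q (hq q hq1 hq2) q' (hq q' hq1' hq2')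
  · intro r hr h1 q hq1 hq2 hq3
    obtain rfl := hSk r hr h1
    exact absurd (hSk q hq1 hq3) hq2
  · intro r hr h1 q hq1 hq2 _
    obtain rfl := hSk r hr h1
    have hq' := hq q hq1 hq2
    exact ⟨hA q hq', hT _ (hn.col_lt _ (h.lt q hq'))⟩
  · intro j hj h1
    rw [hT j hj] at h1
    omega

/-- Some reached row is joined to some column not yet reached. -/
theorem Phase.exists_edge (hn : Net N m row col) (hk : k < N)
    (h : Phase N m row col w k X u v S T A) : ∃ e < m, 1 ≤ S (row e) ∧ T (col e) = 0 := by
  -- The `k < N` matched rows leave some column free. Reached columns are all occupied by `X`, so a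
  -- free column has not been reached, and the root is joined to it.
  have : ∃ j ∈ range N, j ∉ (range k).image fun q => col (X q) := by
    refine Finset.exists_mem_notMem_of_card_lt_card (card_image_le.trans_lt ?_)
    simpa using hk
  obtain ⟨j, hj, hj'⟩ := this
  have hjN := mem_range.1 hj
  obtain ⟨e, he, h1, h2⟩ := hn.complete k hk j hjN
  refine ⟨e, he, by rw [h1]; exact h.root, ?_⟩
  by_contra hne
  obtain ⟨q, hq, hqj⟩ := h.cols j hjN (by rw [h2] at hne; omega)
  exact hj' (mem_image.2 ⟨q, mem_range.2 hq, hqj⟩)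

/-- The dual change: the reached rows gain `δ`, the reached columns lose `δ`. -/
theorem Phase.dual (hn : Net N m row col) (hk : k < N) (h : Phase N m row col w k X u v S T A)
    {δ : ℝ} (h0 : 0 ≤ δ)
    (hδ : ∀ e < m, 1 ≤ S (row e) → T (col e) = 0 → δ ≤ w e - u (row e) - v (col e))
    {u' v' : ℕ → ℝ} (hu : ∀ r < N, u' r = if 1 ≤ S r then u r + δ else u r)
    (hv : ∀ j < N, v' j = if 1 ≤ T j then v j - δ else v j) :
    Phase N m row col w k X u' v' S T A := by
  refine ⟨fun e he => ?_, h.root, h.S_le, h.lt, h.row_eq, fun r hr h1 q hq1 hq2 => ?_, h.inj,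
    h.marked, h.unmarked, h.cols⟩
  · rw [hu _ (hn.row_lt e he), hv _ (hn.col_lt e he)]
    have := h.feas e he
    split_ifs with h1 h2
    · linarith
    · have := hδ e he h1 (by omega)
      linarith
    · linarith
    · linarith
  · have hc := hn.col_lt _ (h.lt r hr h1 q hq1 hq2)
    have ht := h.tight r hr h1 q hq1 hq2
    rw [hu q (by omega), hv _ hc, ht]
    -- A matched row is reached exactly when its column is, so on an edge of `A r` the two changes
    -- cancel or neither takes place.
    by_cases hq3 : 1 ≤ S q
    · have := h.marked r hr h1 q hq1 hq2 hq3
      rw [if_pos hq3, if_pos this]; ring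
    · have := h.unmarked r hr h1 q hq1 hq2 (by omega)
      rw [this.1, if_neg hq3, if_neg (by omega)]

/-- The tight edge `e` leads to the matched row `p`, which becomes reached. -/
theorem Phase.grow (h : Phase N m row col w k X u v S T A) (hn : Net N m row col)
    {e p : ℕ} (he : e < m) (heS : 1 ≤ S (row e)) (heT : T (col e) = 0)
    (hte : w e = u (row e) + v (col e)) (hp : p ≤ k) (hpr : p ≠ row e)
    (hpc : col (A (row e) p) = col e) {A' : ℕ → ℕ → ℕ}
    (hA : ∀ r ≤ k, r ≠ p → ∀ q ≤ k, A' r q = A r q)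
    (hA1 : ∀ q ≤ k, q ≠ row e → A' p q = A (row e) q) (hA2 : A' p (row e) = e) :
    Phase N m row col w k X u v (Function.update S p 1) (Function.update T (col e) 1) A' := by
  have hr0 := h.S_le _ (hn.row_lt e he) heS
  -- Were `p` reached already, `marked` would make its column reached, but that is the column of
  -- `e`.
  have hSp : S p = 0 := by
    by_contra hne
    have := h.marked _ hr0 heS p hp hpr (by omega)
    rw [hpc] at this
    omega
  have hpX := (h.unmarked _ hr0 heS p hp hpr hSp).1
  rw [hpX] at hpc
  -- Marking the column of `e` affects no unreached row other than `p`, so `unmarked` survives.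
  have hXp : ∀ q ≤ k, q ≠ p → S q = 0 → col (X q) ≠ col e := by
    intro q hq hqp hSq hc
    have hqr : q ≠ row e := by rintro rfl; omega
    have h1 := (h.unmarked _ hr0 heS q hq hqr hSq).1
    exact hqp (h.inj _ hr0 heS q hq hqr p hp hpr (by rw [h1, hpX, hc, hpc]))
  have hT' : ∀ j, 1 ≤ T j → 1 ≤ Function.update T (col e) 1 j := fun j hj => by
    simp only [Function.update_apply]; split_ifs <;> omega
  have hcase : ∀ q, 1 ≤ Function.update S p 1 q → q = p ∨ (q ≠ p ∧ 1 ≤ S q) := fun q hq => by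
    by_cases hqp : q = p
    · exact Or.inl hqp
    · simp only [Function.update_apply, if_neg hqp] at hq
      exact Or.inr ⟨hqp, hq⟩
  have hkp : k ≠ p := by rintro rfl; have := h.root; omega
  refine ⟨h.feas, by simpa [Function.update_apply, hkp] using h.root, ?_, ?_, ?_, ?_, ?_, ?_, ?_, ?_⟩
  · intro r hr h1
    rcases hcase r h1 with rfl | ⟨_, h2⟩
    · exact hp
    · exact h.S_le r hr h2
  · intro r hr h1 q hq1 hq2
    rcases hcase r h1 with rfl | ⟨h2, h3⟩
    · by_cases hqr : q = row e
      · rw [hqr, hA2]; exact he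
      · rw [hA1 q hq1 hqr]; exact h.lt _ hr0 heS q hq1 hqr
    · rw [hA r hr h2 q hq1]; exact h.lt r hr h3 q hq1 hq2
  · intro r hr h1 q hq1 hq2
    rcases hcase r h1 with rfl | ⟨h2, h3⟩
    · by_cases hqr : q = row e
      · rw [hqr, hA2]
      · rw [hA1 q hq1 hqr]; exact h.row_eq _ hr0 heS q hq1 hqr
    · rw [hA r hr h2 q hq1]; exact h.row_eq r hr h3 q hq1 hq2
  · intro r hr h1 q hq1 hq2
    rcases hcase r h1 with rfl | ⟨h2, h3⟩
    · by_cases hqr : q = row e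
      · rw [hqr, hA2, hte]
      · rw [hA1 q hq1 hqr]; exact h.tight _ hr0 heS q hq1 hqr
    · rw [hA r hr h2 q hq1]; exact h.tight r hr h3 q hq1 hq2
  · have haux : ∀ q ≤ k, q ≠ row e → q ≠ p → col (A (row e) q) ≠ col e := by
      intro q hq hqr hqp hc
      exact hqp (h.inj _ hr0 heS q hq hqr p hp hpr (by rw [hc, hpX, hpc]))
    intro r hr h1 q hq1 hq2 q' hq1' hq2' hc
    rcases hcase r h1 with rfl | ⟨h2, h3⟩
    · by_cases hqr : q = row e
      · by_cases hqr' : q' = row e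
        · rw [hqr, hqr']
        · rw [hqr, hA2, hA1 q' hq1' hqr'] at hc
          exact absurd hc.symm (haux q' hq1' hqr' hq2')
      · by_cases hqr' : q' = row e
        · rw [hqr', hA2, hA1 q hq1 hqr] at hc
          exact absurd hc (haux q hq1 hqr hq2)
        · rw [hA1 q hq1 hqr, hA1 q' hq1' hqr'] at hc
          exact h.inj _ hr0 heS q hq1 hqr q' hq1' hqr' hc
    · rw [hA r hr h2 q hq1, hA r hr h2 q' hq1'] at hc
      exact h.inj r hr h3 q hq1 hq2 q' hq1' hq2' hc
  · intro r hr h1 q hq1 hq2 hq3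
    rcases hcase r h1 with rfl | ⟨h2, h3⟩
    · by_cases hqr : q = row e
      · rw [hqr, hA2]; simp
      · rw [hA1 q hq1 hqr]
        rcases hcase q hq3 with rfl | ⟨h4, h5⟩
        · exact absurd rfl hq2
        · exact hT' _ (h.marked _ hr0 heS q hq1 hqr h5)
    · rw [hA r hr h2 q hq1]
      rcases hcase q hq3 with rfl | ⟨h4, h5⟩
      · rw [(h.unmarked r hr h3 q hq1 hq2 hSp).1, hpc]; simp
      · exact hT' _ (h.marked r hr h3 q hq1 hq2 h5)
  · intro r hr h1 q hq1 hq2 hq3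
    have hqp : q ≠ p := by rintro rfl; simp at hq3
    simp only [Function.update_apply, if_neg hqp] at hq3
    have hqr : q ≠ row e := by rintro rfl; omega
    have hu := h.unmarked _ hr0 heS q hq1 hqr hq3
    refine ⟨?_, ?_⟩
    · rcases hcase r h1 with rfl | ⟨h2, h3⟩
      · rw [hA1 q hq1 hqr, hu.1]
      · rw [hA r hr h2 q hq1]; exact (h.unmarked r hr h3 q hq1 hq2 hq3).1
    · rw [Function.update_apply, if_neg (hXp q hq1 hqp hq3)]
      exact hu.2
  · intro j hj h1
    by_cases hjc : j = col e
    · exact ⟨p, by omega, by rw [hpc, hjc]⟩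
    · rw [Function.update_apply, if_neg hjc] at h1
      exact h.cols j hj h1

/-- The tight edge `e` leads to a free column: augment. -/
theorem Phase.finish (h : Phase N m row col w k X u v S T A) (hn : Net N m row col)
    {e : ℕ} (he : e < m) (heS : 1 ≤ S (row e))
    (hte : w e = u (row e) + v (col e))
    (hfree : ∀ q ≤ k, q ≠ row e → col (A (row e) q) ≠ col e) {X' : ℕ → ℕ}
    (hX : ∀ q ≤ k, q ≠ row e → X' q = A (row e) q) (hX2 : X' (row e) = e) :
    Partial N m row col w (k + 1) X' u v := by
  have hr0 := h.S_le _ (hn.row_lt e he) heS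
  refine ⟨h.feas, ?_, ?_, ?_, ?_⟩
  · intro q hq
    by_cases hqr : q = row e
    · rw [hqr, hX2]; exact he
    · rw [hX q (by omega) hqr]; exact h.lt _ hr0 heS q (by omega) hqr
  · intro q hq
    by_cases hqr : q = row e
    · rw [hqr, hX2]
    · rw [hX q (by omega) hqr]; exact h.row_eq _ hr0 heS q (by omega) hqr
  · intro q hq
    by_cases hqr : q = row e
    · rw [hqr, hX2, hte]
    · rw [hX q (by omega) hqr]; exact h.tight _ hr0 heS q (by omega) hqr
  · intro q hq q' hq' hc
    by_cases hqr : q = row e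
    · by_cases hqr' : q' = row e
      · rw [hqr, hqr']
      · rw [hqr, hX2, hX q' (by omega) hqr'] at hc
        exact absurd hc.symm (hfree q' (by omega) hqr')
    · by_cases hqr' : q' = row e
      · rw [hqr', hX2, hX q (by omega) hqr] at hc
        exact absurd hc (hfree q (by omega) hqr)
      · rw [hX q (by omega) hqr, hX q' (by omega) hqr'] at hc
        exact h.inj _ hr0 heS q (by omega) hqr q' (by omega) hqr' hc

/-! #### Mixing two optimal matchings -/

/-- `x` uses `M₂` on the rows marked by `P` and `M₁` elsewhere; column `d` is covered once more and
column `h` once less than by a matching. -/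
structure Mixture (N : ℕ) (col : ℕ → ℕ) (M₁ M₂ x P : ℕ → ℕ) (h d : ℕ) : Prop where
  eq : ∀ r < N, x r = if 1 ≤ P r then M₂ r else M₁ r
  balance : ∀ g : ℕ → ℝ, ∑ r ∈ range N, (if 1 ≤ P r then g (col (M₂ r)) - g (col (M₁ r)) else 0) =
    g d - g h

variable {M₁ M₂ x P : ℕ → ℕ} {h d : ℕ}

theorem Mixture.isNear (hn : Net N m row col) (h₁ : IsMatching N m row col M₁)
    (h₂ : IsMatching N m row col M₂) (hx : Mixture N col M₁ M₂ x P h d) :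
    IsNearMatching N m row col x h d := by
  refine ⟨fun r hr => ?_, fun r hr => ?_, fun g => ?_⟩
  · rw [hx.eq r hr]; split_ifs
    · exact h₂.lt r hr
    · exact h₁.lt r hr
  · rw [hx.eq r hr]; split_ifs
    · exact h₂.row_eq r hr
    · exact h₁.row_eq r hr
  · have : ∑ r ∈ range N, g (col (x r)) = ∑ r ∈ range N, g (col (M₁ r)) +
        ∑ r ∈ range N, (if 1 ≤ P r then g (col (M₂ r)) - g (col (M₁ r)) else 0) := by
      rw [← sum_add_distrib]
      refine sum_congr rfl fun r hr => ?_
      rw [hx.eq r (mem_range.1 hr)]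
      split_ifs <;> ring
    rw [this, hx.balance, h₁.sum_col hn]; ring

/-- An unbalanced mixture has a row whose `M₁`-edge covers the column `d` and is still in use. -/
theorem Mixture.exists_next (hn : Net N m row col) (h₁ : IsMatching N m row col M₁)
    (hx : Mixture N col M₁ M₂ x P h d) (hd : d < N) (hne : d ≠ h)
    (hmem : ∃ r < N, 1 ≤ P r ∧ col (M₂ r) = d) (h₂ : IsMatching N m row col M₂) :
    ∃ a < N, P a = 0 ∧ col (M₁ a) = d := by
  classical
  obtain ⟨a, ha, hac⟩ : ∃ a < N, col (M₁ a) = d := by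
    obtain ⟨r, hr, hrd⟩ := Finset.surj_on_of_inj_on_of_card_le (s := range N) (t := range N)
      (fun r _ => col (M₁ r)) (fun r hr => mem_range.2 (hn.col_lt _ (h₁.lt r (mem_range.1 hr))))
      (fun r q hr hq hc => h₁.inj r (mem_range.1 hr) q (mem_range.1 hq) hc) le_rfl d (mem_range.2 hd)
    exact ⟨r, mem_range.1 hr, hrd.symm⟩
  refine ⟨a, ha, ?_, hac⟩
  by_contra hPa
  obtain ⟨r, hr, hPr, hrd⟩ := hmem
  -- Tested on the indicator of `d`, the right side is `1`. If the row `a` were marked, its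
  -- `M₁`-edge would cancel the `M₂`-edge of `r` on the left, which would be `0`.
  have hb := hx.balance fun j => if j = d then 1 else 0
  simp only [if_true, if_neg hne.symm] at hb
  have e1 : ∑ q ∈ range N, (if 1 ≤ P q then (if col (M₂ q) = d then (1 : ℝ) else 0) -
      (if col (M₁ q) = d then (1 : ℝ) else 0) else 0) =
      ∑ q ∈ range N, (if q = r then (1 : ℝ) else 0) - ∑ q ∈ range N, (if q = a then (1 : ℝ) else 0) := by
    rw [← sum_sub_distrib]
    refine sum_congr rfl fun q hq => ?_
    have hq' := mem_range.1 hq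
    have i1 : (col (M₂ q) = d) ↔ q = r :=
      ⟨fun hc => h₂.inj q hq' r hr (hc.trans hrd.symm), fun hc => hc ▸ hrd⟩
    have i2 : (col (M₁ q) = d) ↔ q = a :=
      ⟨fun hc => h₁.inj q hq' a ha (hc.trans hac.symm), fun hc => hc ▸ hac⟩
    simp only [i1, i2]
    by_cases hPq : 1 ≤ P q
    · simp [hPq]
    · have : q ≠ r := by rintro rfl; exact hPq hPr
      have : q ≠ a := by rintro rfl; omega
      simp [*]
  rw [e1] at hb
  simp [hr, ha] at hb

/-- Removing the `M₁`-edge of `a` takes the surplus away from `d`, and inserting the `M₂`-edge moves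
it to `col (M₂ a)`; the deficit stays at `h`. -/
theorem Mixture.swap (hx : Mixture N col M₁ M₂ x P h d) {a : ℕ} (ha : a < N) (hPa : P a = 0)
    (had : col (M₁ a) = d) :
    Mixture N col M₁ M₂ (Function.update x a (M₂ a)) (Function.update P a 1) h (col (M₂ a)) := by
  refine ⟨fun r hr => ?_, fun g => ?_⟩
  · by_cases hra : r = a
    · subst hra; simp
    · simp only [Function.update_apply, if_neg hra]; exact hx.eq r hr
  · have : ∑ r ∈ range N, (if 1 ≤ Function.update P a 1 r then g (col (M₂ r)) - g (col (M₁ r)) else 0)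
        = ∑ r ∈ range N, (if 1 ≤ P r then g (col (M₂ r)) - g (col (M₁ r)) else 0) +
          ∑ r ∈ range N, (if r = a then g (col (M₂ r)) - g (col (M₁ r)) else 0) := by
      rw [← sum_add_distrib]
      refine sum_congr rfl fun r hr => ?_
      by_cases hra : r = a
      · subst hra; simp [hPa]
      · simp [hra]
    rw [this, hx.balance]
    simp [ha, had]

/-- On a closed cycle surplus and deficit cancel, so both may be relocated to the column where the
next cycle is entered. -/
theorem Mixture.reset (hx : Mixture N col M₁ M₂ x P h h) (j : ℕ) :
    Mixture N col M₁ M₂ x P j j :=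
  ⟨hx.eq, fun g => by rw [hx.balance]; ring⟩

/-- A mixture of two tight matchings is no more expensive than a matching if the potential of its
doubly covered column does not exceed that of its uncovered one. -/
theorem Mixture.total_le (hn : Net N m row col) (h₁ : IsMatching N m row col M₁)
    (h₂ : IsMatching N m row col M₂) (hx : Mixture N col M₁ M₂ x P h d)
    (t₁ : ∀ r < N, w (M₁ r) = u r + v (col (M₁ r))) (t₂ : ∀ r < N, w (M₂ r) = u r + v (col (M₂ r)))
    (hv : v d ≤ v h) : total N w x ≤ ∑ r ∈ range N, u r + ∑ j ∈ range N, v j := by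
  have : total N w x = ∑ r ∈ range N, u r + ∑ r ∈ range N, v (col (x r)) := by
    rw [total, ← sum_add_distrib]
    refine sum_congr rfl fun r hr => ?_
    have hr' := mem_range.1 hr
    rw [hx.eq r hr']
    split_ifs
    · exact t₂ r hr'
    · exact t₁ r hr'
  rw [this, (hx.isNear hn h₁ h₂).sum_col]
  linarith

theorem total_update (f : ℕ → ℝ) (x : ℕ → ℕ) {a : ℕ} (ha : a < N) (e : ℕ) :
    total N f (Function.update x a e) = total N f x + f e - f (x a) := by
  have : total N f (Function.update x a e) =
      total N f x + ∑ r ∈ range N, (if r = a then f e - f (x a) else 0) := by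
    rw [total, total, ← sum_add_distrib]
    refine sum_congr rfl fun r hr => ?_
    by_cases hra : r = a
    · subst hra; simp
    · simp [hra]
  rw [this]
  simp [ha]; ring

theorem total_combine (c w : ℕ → ℝ) (a b : ℝ) (x : ℕ → ℕ) :
    total N (fun e => a * c e + b * w e) x = a * total N c x + b * total N w x := by
  simp [total, sum_add_distrib, mul_sum]

/-! #### Searching for the multiplier -/

/-- `c₁, w₁` minimizes `a₁ c + b₁ w`, `c₂, w₂` minimizes `a₂ c + b₂ w`, and `cx, wx` lies strictly
below the line through the two. -/
theorem between_of_below {a₁ b₁ a₂ b₂ c₁ w₁ c₂ w₂ cx wx l : ℝ} (ha₁ : 0 ≤ a₁) (hb₁ : 0 < b₁)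
    (ha₂ : 0 < a₂) (hb₂ : 0 ≤ b₂) (hw : w₁ < w₂) (hl : l = (c₁ - c₂) / (w₂ - w₁))
    (h₁ : a₁ * c₁ + b₁ * w₁ ≤ a₁ * c₂ + b₁ * w₂) (h₁x : a₁ * c₁ + b₁ * w₁ ≤ a₁ * cx + b₁ * wx)
    (h₂ : a₂ * c₂ + b₂ * w₂ ≤ a₂ * c₁ + b₂ * w₁) (h₂x : a₂ * c₂ + b₂ * w₂ ≤ a₂ * cx + b₂ * wx)
    (hlt : cx + l * wx < c₁ + l * w₁) :
    0 < l ∧ cx < c₁ ∧ (c₂ < cx ∨ (b₂ = 0 ∧ c₂ ≤ cx)) := by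
  have hd : 0 < w₂ - w₁ := sub_pos.2 hw
  have hl' : l * (w₂ - w₁) = c₁ - c₂ := by rw [hl]; field_simp
  have hlt2 : cx + l * wx < c₂ + l * w₂ := by nlinarith
  -- Comparing the two minimizers with each other places `l` between the multipliers `b₂ / a₂` and
  -- `b₁ / a₁` for which they are optimal. The inequalities are kept free of division because `a₁`
  -- may vanish.
  have e1 : a₁ * l ≤ b₁ := by
    have : a₁ * l * (w₂ - w₁) ≤ b₁ * (w₂ - w₁) := by rw [mul_assoc, hl']; nlinarith
    exact le_of_mul_le_mul_right this hd
  have e2 : b₂ ≤ a₂ * l := by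
    have : b₂ * (w₂ - w₁) ≤ a₂ * l * (w₂ - w₁) := by rw [mul_assoc, hl']; nlinarith
    exact le_of_mul_le_mul_right this hd
  have hl0 : 0 ≤ l := by
    by_contra hneg
    have := mul_neg_of_pos_of_neg ha₂ (not_le.1 hneg)
    linarith
  -- To the left of the first point, its optimality keeps everything on or above a line that is at
  -- least as steep as the one through the two points.
  have hwx : w₁ ≤ wx := by
    by_contra hneg
    push Not at hneg
    have p : 0 < w₁ - wx := sub_pos.2 hneg
    have q1 : b₁ * (w₁ - wx) ≤ a₁ * (cx - c₁) := by nlinarith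
    have q2 : cx - c₁ < l * (w₁ - wx) := by nlinarith
    have q3 : a₁ * l * (w₁ - wx) ≤ b₁ * (w₁ - wx) := mul_le_mul_of_nonneg_right e1 p.le
    rcases ha₁.eq_or_lt with h0 | h0
    · rw [← h0] at q1
      have := mul_pos hb₁ p
      linarith
    · have := mul_lt_mul_of_pos_left q2 h0
      nlinarith
  have hc : cx < c₁ := by nlinarith [mul_nonneg hl0 (sub_nonneg.2 hwx)]
  -- If `cx ≤ c₂`, optimality of the second point forces `w₂ ≤ wx`, and there nothing lies below the
  -- line. The exception is `b₂ = 0`: then only the cost was minimized, and `cx` may tie with `c₂`.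
  have key : c₂ < cx ∨ (b₂ = 0 ∧ c₂ ≤ cx) := by
    by_contra hneg
    push Not at hneg
    obtain ⟨g1, g2⟩ := hneg
    have r1 : a₂ * (c₂ - cx) ≤ b₂ * (wx - w₂) := by nlinarith
    have r2 : 0 ≤ a₂ * (c₂ - cx) := mul_nonneg ha₂.le (by linarith)
    have hb0 : 0 < b₂ := by
      rcases hb₂.eq_or_lt with h0 | h0
      · have := g2 h0.symm
        rw [← h0] at r1
        have := mul_pos ha₂ (sub_pos.2 this)
        linarith
      · exact h0
    have hwx2 : 0 ≤ wx - w₂ := nonneg_of_mul_nonneg_right (r2.trans r1) hb0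
    have r3 : b₂ * (wx - w₂) ≤ a₂ * l * (wx - w₂) := mul_le_mul_of_nonneg_right e2 hwx2
    have r4 : l * (wx - w₂) < c₂ - cx := by nlinarith
    have := mul_lt_mul_of_pos_left r4 ha₂
    nlinarith
  refine ⟨?_, hc, key⟩
  rcases hl0.eq_or_lt with h0 | h0
  · exfalso
    rw [← h0] at e2 hlt2
    rcases key with h5 | ⟨_, h5⟩ <;> linarith
  · exact h0

end Assignment

namespace RRRP

open Finset RealRAM Assignment

/- Natural-number arrays of the solver: sizes, row offsets and edge ends of the network, and the
variables of the Hungarian method. -/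
local notation "aN" => (10 : ℕ)
local notation "aM" => (11 : ℕ)
local notation "aOff" => (12 : ℕ)
local notation "aRow" => (13 : ℕ)
local notation "aCol" => (14 : ℕ)
local notation "cK" => (15 : ℕ)
local notation "cI" => (16 : ℕ)
local notation "aA" => (20 : ℕ)
local notation "aS" => (21 : ℕ)
local notation "aT" => (22 : ℕ)
local notation "aFin" => (23 : ℕ)
local notation "aBest" => (24 : ℕ)
local notation "aOwn" => (26 : ℕ)
local notation "aX" => (27 : ℕ)

/- Real arrays. -/
local notation "rL" => (3 : ℕ)
local notation "rU" => (4 : ℕ)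
local notation "rV" => (5 : ℕ)
local notation "rDelta" => (6 : ℕ)

/- Further natural-number arrays: two matchings, their mixture, flags, and the variables of the walk
along the alternating cycles. -/
local notation "aM₁" => (28 : ℕ)
local notation "aM₂" => (29 : ℕ)
local notation "aY" => (30 : ℕ)
local notation "aOk" => (31 : ℕ)
local notation "aDone" => (32 : ℕ)
local notation "aP" => (33 : ℕ)
local notation "aH" => (34 : ℕ)
local notation "aD" => (35 : ℕ)
local notation "aPick" => (36 : ℕ)

/- Further real arrays: coefficients of the combined cost, weights and costs of the edges, and the
total weights and costs of the matchings. -/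
local notation "rIn" => (0 : ℕ)
local notation "rA" => (7 : ℕ)
local notation "rB" => (8 : ℕ)
local notation "rW" => (9 : ℕ)
local notation "rC" => (10 : ℕ)
local notation "rW₁" => (11 : ℕ)
local notation "rC₁" => (12 : ℕ)
local notation "rW₂" => (13 : ℕ)
local notation "rC₂" => (14 : ℕ)
local notation "rWX" => (15 : ℕ)
local notation "rCX" => (16 : ℕ)
local notation "rWY" => (24 : ℕ)

/- The arrays of the instance and of the output. -/
local notation "aIn" => (0 : ℕ)
local notation "aOwner" => (1 : ℕ)
local notation "aSrc" => (2 : ℕ)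
local notation "aDst" => (3 : ℕ)
local notation "aOut" => (4 : ℕ)
local notation "rCost" => (1 : ℕ)
local notation "rWeight" => (2 : ℕ)

/- Natural-number arrays for the enumeration of the guesses. -/
local notation "aCnt" => (37 : ℕ)
local notation "aG" => (38 : ℕ)
local notation "aTup" => (39 : ℕ)
local notation "aEd" => (40 : ℕ)
local notation "aRo" => (41 : ℕ)
local notation "aStop" => (42 : ℕ)
local notation "aHave" => (43 : ℕ)
local notation "aPtr" => (44 : ℕ)
local notation "aJ" => (45 : ℕ)

/- Real arrays: the least cost of a guessed edge, the unit of the rounding, the number of UAVs, and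
auxiliary values. -/
local notation "rCm" => (17 : ℕ)
local notation "rDel" => (18 : ℕ)
local notation "rN" => (19 : ℕ)
local notation "rAcc" => (20 : ℕ)
local notation "rBest" => (21 : ℕ)
local notation "rCur" => (22 : ℕ)
local notation "rQ" => (23 : ℕ)
local notation "rT" => (25 : ℕ)

namespace Solver

/-! ### The program for minimum cost perfect matchings -/

section

/-- The memory holds the network. -/
structure Holds (N m : ℕ) (row col : ℕ → ℕ) (s : State) : Prop where
  rows : s.nat aN 0 = N
  edges : s.nat aM 0 = m
  off : ∀ r < N, s.nat aOff r = r * N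
  row : s.nat aRow = row
  col : s.nat aCol = col

variable {N m k Z : ℕ} {row col : ℕ → ℕ} {s s' : State} {w : ℕ → ℝ}

theorem Holds.frame {c : Prog} (h : Holds N m row col s) (hf : Frame c s s')
    (hc : [aN, aM, aOff, aRow, aCol].all (fun a => !c.writesNat a) = true := by rfl) :
    Holds N m row col s' := by
  simp only [List.all_cons, List.all_nil, Bool.and_eq_true, Bool.not_eq_true'] at hc
  obtain ⟨h1, h2, h3, h4, h5, _⟩ := hc
  exact ⟨by rw [hf.nat _ h1, h.rows], by rw [hf.nat _ h2, h.edges],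
    by rw [hf.nat _ h3]; exact h.off, by rw [hf.nat _ h4, h.row], by rw [hf.nat _ h5, h.col]⟩

/-- Uniqueness of division with remainder. It separates the blocks of the two-dimensional table `aA`
and, later, the digits of a guess. -/
theorem offset_inj {r q r' q' : ℕ} (hq : q < N) (hq' : q' < N) (h : r * N + q = r' * N + q') :
    r = r' ∧ q = q' := by
  have h1 : (r * N + q) / N = r := by
    rw [mul_comm, Nat.mul_add_div (by omega), Nat.div_eq_of_lt hq, add_zero]
  have h2 : (r' * N + q') / N = r' := by
    rw [mul_comm, Nat.mul_add_div (by omega), Nat.div_eq_of_lt hq', add_zero]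
  have : r = r' := by rw [← h1, h, h2]
  subst this
  exact ⟨rfl, by omega⟩

abbrev BExp.natEq (e₁ e₂ : NExp) : BExp := .and (.natLE e₁ e₂) (.natLE e₂ e₁)

/-- The slack of the edge `i`. -/
def slack (i : NExp) : RExp :=
  .sub (.sub (.get rL i) (.get rU (.get aRow i))) (.get rV (.get aCol i))

def bestRow : NExp := .get aRow (nv aBest)

def bestCol : NExp := .get aCol (nv aBest)

/-- Find the edge of least slack from a reached row to a column not yet reached. -/
def findEdge : Prog :=
  .seq (.letN aBest (nv aM)) (.forTo cI (nv aM)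
    (.cond (.and (.and (.natLE (.const 1) (.get aS (.get aRow (nv cI))))
        (.natLE (.get aT (.get aCol (nv cI))) (.const 0)))
        (.or (.natLE (nv aM) (nv aBest)) (.realLT (slack (nv cI)) (rv rDelta))))
      (.seq (.letN aBest (nv cI)) (.letR rDelta (slack (nv cI)))) .skip))

/-- The value `m` of `aBest` stands for "nothing found yet" and makes the stale contents of `rDelta`
irrelevant; `hex` excludes it at the end. -/
theorem findEdge_spec (h : Holds N m row col s) (hm : m ≤ Z)
    (hex : ∃ e < m, 1 ≤ s.nat aS (row e) ∧ s.nat aT (col e) = 0) :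
    Ensures findEdge s (Z * 6 + 3) (fun s' => s'.nat aBest 0 < m ∧
      1 ≤ s.nat aS (row (s'.nat aBest 0)) ∧ s.nat aT (col (s'.nat aBest 0)) = 0 ∧
      s'.real rDelta 0 = s.real rL (s'.nat aBest 0) - s.real rU (row (s'.nat aBest 0)) -
        s.real rV (col (s'.nat aBest 0)) ∧
      ∀ e < m, 1 ≤ s.nat aS (row e) → s.nat aT (col e) = 0 →
        s'.real rDelta 0 ≤ s.real rL e - s.real rU (row e) - s.real rV (col e)) := by
  have h1 : Ensures (.letN aBest (nv aM)) s 1 (fun s' => s' = s.updNat aBest 0 m) :=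
    Ensures.straight rfl (by simp [h.edges])
  refine (h1.seq (T₂ := Z * 6 + 2) ?_).mono (by omega) (fun _ _ h => h)
  rintro _ _ rfl
  refine (Ensures.forTo (n := m) (T := 4) (fun k s' =>
    (s'.nat aBest 0 = m ∧ ∀ e < k, ¬ (1 ≤ s.nat aS (row e) ∧ s.nat aT (col e) = 0)) ∨
    (s'.nat aBest 0 < m ∧
      1 ≤ s.nat aS (row (s'.nat aBest 0)) ∧ s.nat aT (col (s'.nat aBest 0)) = 0 ∧
      s'.real rDelta 0 = s.real rL (s'.nat aBest 0) - s.real rU (row (s'.nat aBest 0)) -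
        s.real rV (col (s'.nat aBest 0)) ∧
      ∀ e < k, 1 ≤ s.nat aS (row e) → s.nat aT (col e) = 0 →
        s'.real rDelta 0 ≤ s.real rL e - s.real rU (row e) - s.real rV (col e))) rfl
    (fun s' hf => ?_) hm ?_ ?_).post ?_
  · have := hf.nat aM rfl
    simp [this, h.edges]
  · left; simp
  · intro k hk s' hf hik hI
    have e1 : s'.nat aRow = row := by rw [hf.nat aRow rfl]; simp [h.row]
    have e2 : s'.nat aCol = col := by rw [hf.nat aCol rfl]; simp [h.col]
    have e3 : s'.nat aM 0 = m := by rw [hf.nat aM rfl]; simp [h.edges]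
    have e4 : s'.nat aS = s.nat aS := by rw [hf.nat aS rfl]; simp
    have e5 : s'.nat aT = s.nat aT := by rw [hf.nat aT rfl]; simp
    have e6 : s'.real rL = s.real rL := by rw [hf.real rL rfl]; simp
    have e7 : s'.real rU = s.real rU := by rw [hf.real rU rfl]; simp
    have e8 : s'.real rV = s.real rV := by rw [hf.real rV rfl]; simp
    refine Ensures.straight rfl ?_
    simp only [Prog.exec, BExp.Holds, NExp.eval, RExp.eval, slack, e1, e2, e3, e4, e5, e6, e7, e8, hik]
    split_ifs with hc
    · obtain ⟨⟨c1, c2⟩, c3⟩ := hc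
      right
      simp only [State.updNat_nat, State.updReal_nat, State.updNat_real, State.updReal_real, e1, e2,
        e6, e7, e8]
      refine ⟨by simpa using hk, by simpa using c1, by simpa using c2, by simp [hik], ?_⟩
      intro e he g1 g2
      rcases Nat.lt_succ_iff_lt_or_eq.1 he with he' | rfl
      · rcases hI with ⟨_, hI⟩ | ⟨i1, _, _, _, i5⟩
        · exact absurd ⟨g1, g2⟩ (hI e he')
        · have := i5 e he' g1 g2
          simp only [not_and, not_not, not_le] at c3
          have := c3 i1
          simp [hik]
          linarith
      · simp [hik]
    · simp only [State.updNat_nat, State.updNat_real, if_neg (show ¬ (24 = 16) by decide)]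
      rcases hI with ⟨i1, i2⟩ | ⟨i1, i2, i3, i4, i5⟩
      · left
        refine ⟨i1, fun e he hce => ?_⟩
        rcases Nat.lt_succ_iff_lt_or_eq.1 he with he' | rfl
        · exact i2 e he' hce
        · exact hc ⟨⟨hce.1, hce.2.le⟩, by simp [i1]⟩
      · right
        refine ⟨i1, i2, i3, i4, fun e he g1 g2 => ?_⟩
        rcases Nat.lt_succ_iff_lt_or_eq.1 he with he' | rfl
        · exact i5 e he' g1 g2
        · by_contra hlt
          exact hc ⟨⟨g1, g2.le⟩, by push Not at hlt; simp [i1, hlt]⟩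
  · rintro s' - (⟨_, hI⟩ | hI)
    · obtain ⟨e, he, hce⟩ := hex
      exact absurd hce (hI e he)
    · exact hI

/-- Raise the potentials of the reached rows and lower those of the reached columns. -/
def shiftDuals : Prog :=
  .forTo cI (nv aN) (.seq
    (.cond (.natLE (.const 1) (.get aS (nv cI)))
      (.setReal rU (nv cI) (.add (.get rU (nv cI)) (rv rDelta))) .skip)
    (.cond (.natLE (.const 1) (.get aT (nv cI)))
      (.setReal rV (nv cI) (.sub (.get rV (nv cI)) (rv rDelta))) .skip))

theorem shiftDuals_spec (h : Holds N m row col s) (hN : N ≤ Z) :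
    Ensures shiftDuals s (Z * 8 + 2) (fun s' =>
      (∀ r < N, s'.real rU r = if 1 ≤ s.nat aS r then s.real rU r + s.real rDelta 0 else s.real rU r) ∧
      (∀ j < N, s'.real rV j = if 1 ≤ s.nat aT j then s.real rV j - s.real rDelta 0
        else s.real rV j)) := by
  refine (Ensures.forTo (n := N) (T := 6) (fun k s' =>
    (∀ r, s'.real rU r = if r < k ∧ 1 ≤ s.nat aS r then s.real rU r + s.real rDelta 0
      else s.real rU r) ∧
    (∀ j, s'.real rV j = if j < k ∧ 1 ≤ s.nat aT j then s.real rV j - s.real rDelta 0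
        else s.real rV j)) rfl (fun s' hf => ?_) hN ?_ ?_).post ?_
  · simpa [h.rows] using congrFun (hf.nat aN rfl) 0
  · simp
  · intro k hk s' hf hik ⟨i1, i2⟩
    have e1 : s'.nat aS = s.nat aS := hf.nat aS rfl
    have e2 : s'.nat aT = s.nat aT := hf.nat aT rfl
    have e3 : s'.real rDelta = s.real rDelta := hf.real rDelta rfl
    refine Ensures.straight rfl ⟨fun r => ?_, fun r => ?_⟩
    · by_cases hr : r = k
      · subst hr
        by_cases h1 : 1 ≤ s.nat aS r <;> by_cases h2 : 1 ≤ s.nat aT r <;>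
          simp [hik, e1, e2, e3, h1, h2, i1]
      · have hlt : r < k + 1 ↔ r < k := by omega
        simp only [hlt]
        rw [← i1 r]
        by_cases h1 : 1 ≤ s.nat aS k <;> by_cases h2 : 1 ≤ s.nat aT k <;>
          simp [hik, e1, e2, e3, h1, h2, hr]
    · by_cases hr : r = k
      · subst hr
        by_cases h1 : 1 ≤ s.nat aS r <;> by_cases h2 : 1 ≤ s.nat aT r <;>
          simp [hik, e1, e2, e3, h1, h2, i2]
      · have hlt : r < k + 1 ↔ r < k := by omega
        simp only [hlt]
        rw [← i2 r]
        by_cases h1 : 1 ≤ s.nat aS k <;> by_cases h2 : 1 ≤ s.nat aT k <;>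
          simp [hik, e1, e2, e3, h1, h2, hr]
  · rintro s' - ⟨i1, i2⟩
    exact ⟨fun r hr => by simp [i1, hr], fun r hr => by simp [i2, hr]⟩

/-- The matching that belongs to the row of the best edge. -/
def bestShift (q : NExp) : NExp := .get aA (.add (.get aOff bestRow) q)

/-- Find the row that occupies the column of the best edge. -/
def findOwner : Prog :=
  .seq (.letN aOwn (nv aN)) (.forTo cI (.add (nv cK) (.const 1))
    (.cond (.and (.not (BExp.natEq (nv cI) bestRow))
        (BExp.natEq (.get aCol (bestShift (nv cI))) bestCol))
      (.letN aOwn (nv cI)) .skip))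

/-- The value `N` of `aOwn`, which is not a row, signals a free column. The row of the best edge is
skipped because its own matching leaves it out. -/
theorem findOwner_spec (h : Holds N m row col s) (hZ : k + 1 ≤ Z) (hk : s.nat cK 0 = k)
    (hr : row (s.nat aBest 0) < N) :
    Ensures findOwner s (Z * 5 + 3) (fun s' =>
      (s'.nat aOwn 0 = N ∧ ∀ q ≤ k, q ≠ row (s.nat aBest 0) →
        col (s.nat aA (row (s.nat aBest 0) * N + q)) ≠ col (s.nat aBest 0)) ∨
      (s'.nat aOwn 0 ≤ k ∧ s'.nat aOwn 0 ≠ row (s.nat aBest 0) ∧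
        col (s.nat aA (row (s.nat aBest 0) * N + s'.nat aOwn 0)) = col (s.nat aBest 0))) := by
  have h1 : Ensures (.letN aOwn (nv aN)) s 1 (fun s' => s' = s.updNat aOwn 0 N) :=
    Ensures.straight rfl (by simp [h.rows])
  refine (h1.seq (T₂ := Z * 5 + 2) ?_).mono (by omega) (fun _ _ h => h)
  rintro _ _ rfl
  refine (Ensures.forTo (n := k + 1) (T := 3) (fun i s' =>
    (s'.nat aOwn 0 = N ∧ ∀ q < i, q ≠ row (s.nat aBest 0) →
        col (s.nat aA (row (s.nat aBest 0) * N + q)) ≠ col (s.nat aBest 0)) ∨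
      (s'.nat aOwn 0 ≤ k ∧ s'.nat aOwn 0 ≠ row (s.nat aBest 0) ∧
        col (s.nat aA (row (s.nat aBest 0) * N + s'.nat aOwn 0)) = col (s.nat aBest 0)))
    rfl (fun s' hf => ?_) hZ ?_ ?_).post ?_
  · have := hf.nat cK rfl
    simp [this, hk]
  · left; simp
  · intro i hi s' hf hik hI
    have e1 : s'.nat aRow = row := by rw [hf.nat aRow rfl]; simp [h.row]
    have e2 : s'.nat aCol = col := by rw [hf.nat aCol rfl]; simp [h.col]
    have e3 : s'.nat aA = s.nat aA := by rw [hf.nat aA rfl]; simp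
    have e4 : s'.nat aBest = s.nat aBest := by rw [hf.nat aBest rfl]; simp
    have e5 : s'.nat aOff (row (s.nat aBest 0)) = row (s.nat aBest 0) * N := by
      rw [hf.nat aOff rfl]; simpa using h.off _ hr
    refine Ensures.straight rfl ?_
    simp only [Prog.exec, BExp.Holds, NExp.eval, bestRow, bestCol, bestShift, e1, e2, e3, e4, e5, hik,
      ← le_antisymm_iff]
    split_ifs with hc
    · right
      simpa using ⟨by omega, hc.1, hc.2⟩
    · simp only [State.updNat_nat, if_neg (show ¬ (26 = 16) by decide)]
      rcases hI with ⟨i1, i2⟩ | hI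
      · left
        refine ⟨i1, fun q hq hqr hqc => ?_⟩
        rcases Nat.lt_succ_iff_lt_or_eq.1 hq with hq' | rfl
        · exact i2 q hq' hqr hqc
        · exact hc ⟨hqr, hqc⟩
      · exact Or.inr hI
  · rintro s' - (⟨i1, i2⟩ | hI)
    · exact Or.inl ⟨i1, fun q hq => i2 q (by omega)⟩
    · exact Or.inr hI

/-- The row that was found becomes reached. -/
def growTree : Prog :=
  .seq (.forTo cI (nv aN) (.setNat aA (.add (.get aOff (nv aOwn)) (nv cI)) (bestShift (nv cI))))
    (.seq (.setNat aA (.add (.get aOff (nv aOwn)) bestRow) (nv aBest))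
      (.setNat aS (nv aOwn) (.const 1)))

theorem growTree_spec (h : Holds N m row col s) (hN : N ≤ Z) (hr : row (s.nat aBest 0) < N)
    (hp : s.nat aOwn 0 < N) (hne : s.nat aOwn 0 ≠ row (s.nat aBest 0)) :
    Ensures growTree s (Z * 3 + 4) (fun s' =>
      s'.nat aS = Function.update (s.nat aS) (s.nat aOwn 0) 1 ∧
      (∀ r, r ≠ s.nat aOwn 0 → ∀ q < N, s'.nat aA (r * N + q) = s.nat aA (r * N + q)) ∧
      (∀ q < N, q ≠ row (s.nat aBest 0) → s'.nat aA (s.nat aOwn 0 * N + q) =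
        s.nat aA (row (s.nat aBest 0) * N + q)) ∧
      s'.nat aA (s.nat aOwn 0 * N + row (s.nat aBest 0)) = s.nat aBest 0) := by
  have h1 : Ensures (.forTo cI (nv aN) (.setNat aA (.add (.get aOff (nv aOwn)) (nv cI))
      (bestShift (nv cI)))) s (Z * 3 + 2) (fun s' =>
      (∀ r, r ≠ s.nat aOwn 0 → ∀ q < N, s'.nat aA (r * N + q) = s.nat aA (r * N + q)) ∧
      (∀ q < N, s'.nat aA (s.nat aOwn 0 * N + q) = s.nat aA (row (s.nat aBest 0) * N + q))) := by
    refine (Ensures.forTo (n := N) (T := 1) (fun i s' =>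
      (∀ r, r ≠ s.nat aOwn 0 → ∀ q < N, s'.nat aA (r * N + q) = s.nat aA (r * N + q)) ∧
      (∀ q < i, s'.nat aA (s.nat aOwn 0 * N + q) = s.nat aA (row (s.nat aBest 0) * N + q)))
      rfl (fun s' hf => ?_) hN ?_ ?_).post (fun _ _ h => h)
    · simpa [h.rows] using congrFun (hf.nat aN rfl) 0
    · exact ⟨fun _ _ _ _ => by simp, fun q hq => by omega⟩
    · intro i hi s' hf hik ⟨i1, i2⟩
      have e1 : s'.nat aRow = row := by rw [hf.nat aRow rfl, h.row]
      have e2 : s'.nat aOff = s.nat aOff := hf.nat aOff rfl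
      have e3 : s'.nat aOwn = s.nat aOwn := hf.nat aOwn rfl
      have e4 : s'.nat aBest = s.nat aBest := hf.nat aBest rfl
      -- The block that is read differs from the block that is being overwritten.
      have e5 := i1 _ hne.symm i hi
      refine Ensures.straight rfl ?_
      simp only [Prog.exec, NExp.eval, bestRow, bestShift, e1, e2, e3, e4, h.off _ hr, h.off _ hp, hik,
        e5, State.updNat_nat, Function.update_apply, if_true, if_neg (show ¬ (20 = 16) by decide)]
      refine ⟨fun r hr' q hq => ?_, fun q hq => ?_⟩
      · rw [if_neg (fun hh => hr' (offset_inj hq hi hh).1)]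
        exact i1 r hr' q hq
      · by_cases hqi : q = i
        · simp [hqi]
        · rw [if_neg (by omega)]
          exact i2 q (by omega)
  refine (h1.seq (T₂ := 2) ?_).mono (by omega) (fun _ _ h => h)
  rintro s' hf ⟨i1, i2⟩
  have e1 : s'.nat aRow = row := by rw [hf.nat aRow rfl, h.row]
  have e2 : s'.nat aOff = s.nat aOff := hf.nat aOff rfl
  have e3 : s'.nat aOwn = s.nat aOwn := hf.nat aOwn rfl
  have e4 : s'.nat aBest = s.nat aBest := hf.nat aBest rfl
  have e5 : s'.nat aS = s.nat aS := hf.nat aS rfl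
  refine Ensures.straight rfl ?_
  simp only [Prog.exec, NExp.eval, bestRow, e1, e2, e3, e4, e5, h.off _ hp,
    State.updNat_nat, if_true, if_neg (show ¬ (20 = 21) by decide),
    if_neg (show ¬ (21 = 20) by decide), if_neg (show ¬ (26 = 20) by decide), Function.update_apply, true_and, and_true]
  refine ⟨fun r hr' q hq => ?_, fun q hq hqr => ?_⟩
  · rw [if_neg (fun hh => hr' (offset_inj hq hr hh).1)]
    exact i1 r hr' q hq
  · rw [if_neg (by omega)]
    exact i2 q hq

/-- The matching is augmented. -/
def augment : Prog :=
  .seq (.forTo cI (.add (nv cK) (.const 1)) (.setNat aX (nv cI) (bestShift (nv cI))))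
    (.seq (.setNat aX bestRow (nv aBest)) (.letN aFin (.const 1)))

theorem augment_spec (h : Holds N m row col s) (hZ : k + 1 ≤ Z) (hk : s.nat cK 0 = k)
    (hr : row (s.nat aBest 0) < N) :
    Ensures augment s (Z * 3 + 4) (fun s' => s'.nat aFin 0 = 1 ∧
      (∀ q ≤ k, q ≠ row (s.nat aBest 0) → s'.nat aX q = s.nat aA (row (s.nat aBest 0) * N + q)) ∧
      s'.nat aX (row (s.nat aBest 0)) = s.nat aBest 0) := by
  refine ((Ensures.fillNat (fun q => s.nat aA (row (s.nat aBest 0) * N + q)) (by decide)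
    (n := k + 1) ?_ hZ ?_).seq (T₂ := 2) ?_).mono (by omega) (fun _ _ h => h)
  · intro s' hf
    have := hf.nat cK rfl
    simp [this, hk]
  · intro i hi s' hf hik _
    have e1 : s'.nat aRow = row := by rw [hf.nat aRow rfl, h.row]
    have e2 : s'.nat aOff = s.nat aOff := hf.nat aOff rfl
    have e4 : s'.nat aBest = s.nat aBest := hf.nat aBest rfl
    have e5 : s'.nat aA = s.nat aA := hf.nat aA rfl
    simp [bestShift, bestRow, e1, e2, e4, e5, hik, h.off _ hr]
  · intro s' hf hI
    have e1 : s'.nat aRow = row := by rw [hf.nat aRow rfl, h.row]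
    have e4 : s'.nat aBest = s.nat aBest := hf.nat aBest rfl
    refine Ensures.straight rfl ?_
    simp only [Prog.exec, NExp.eval, bestRow, e1, e4, State.updNat_nat, hI]
    refine ⟨by simp, fun q hq hqr => ?_, by simp⟩
    simp only [Function.update_apply, if_neg hqr, if_pos (Nat.lt_succ_of_le hq), if_true,
      if_neg (show ¬ (27 = 23) by decide)]

/-- One step of the search for an augmenting path. -/
def searchStep : Prog :=
  .seq findEdge (.seq shiftDuals (.seq (.setNat aT bestCol (.const 1)) (.seq findOwner
    (.cond (.natLT (nv aOwn) (nv aN)) growTree augment))))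

/-- The state of the search is that of `Phase`, with all its data in memory. -/
def InPhase (N m : ℕ) (row col : ℕ → ℕ) (w : ℕ → ℝ) (k : ℕ) (s : State) : Prop :=
  Phase N m row col w k (s.nat aX) (s.real rU) (s.real rV) (s.nat aS) (s.nat aT)
    (fun r q => s.nat aA (r * N + q))

/-- A step that does not augment reaches a new column, which bounds the number of steps. -/
theorem searchStep_spec (hn : Net N m row col) (h : Holds N m row col s) (hN : N ≤ Z) (hm : m ≤ Z)
    (hk : s.nat cK 0 = k) (hkN : k < N) (hw : s.real rL = w) (hp : InPhase N m row col w k s)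
    (hfin : s.nat aFin 0 = 0) :
    Ensures searchStep s (Z * 22 + 14) (fun s' =>
      (s'.nat aFin 0 = 1 ∧ Partial N m row col w (k + 1) (s'.nat aX) (s'.real rU) (s'.real rV)) ∨
      (s'.nat aFin 0 = 0 ∧ InPhase N m row col w k s' ∧
        ∃ j < N, s.nat aT j = 0 ∧ s'.nat aT = Function.update (s.nat aT) j 1)) := by
  refine ((findEdge_spec h hm (hp.exists_edge hn hkN)).seq (T₂ := Z * 16 + 11) ?_).mono (by omega)
    (fun _ _ h => h)
  intro s₁ f₁ ⟨b1, b2, b3, b4, b5⟩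
  have h₁ := h.frame f₁
  have a1 : s₁.nat aS = s.nat aS := f₁.nat aS rfl
  have a2 : s₁.nat aT = s.nat aT := f₁.nat aT rfl
  have a3 : s₁.real rU = s.real rU := f₁.real rU rfl
  have a4 : s₁.real rV = s.real rV := f₁.real rV rfl
  have a5 : s₁.nat aX = s.nat aX := f₁.nat aX rfl
  have a6 : s₁.nat aA = s.nat aA := f₁.nat aA rfl
  refine ((shiftDuals_spec h₁ hN).seq (T₂ := Z * 8 + 9) ?_).mono (by omega) (fun _ _ h => h)
  intro s₂ f₂ ⟨d1, d2⟩
  have h₂ := h₁.frame f₂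
  have g1 : s₂.nat aBest = s₁.nat aBest := f₂.nat aBest rfl
  generalize hb : s₁.nat aBest 0 = b at *
  have hrow := hn.row_lt b b1
  have hcol := hn.col_lt b b1
  rw [a1, a3] at d1
  rw [a2, a4] at d2
  have hp₂ : Phase N m row col w k (s.nat aX) (s₂.real rU) (s₂.real rV) (s.nat aS) (s.nat aT)
      (fun r q => s.nat aA (r * N + q)) := by
    refine hp.dual hn hkN (δ := s₁.real rDelta 0) ?_ ?_ d1 d2
    · rw [b4, hw]
      have := hp.feas b b1
      linarith
    · rw [← hw]; exact b5
  -- The shift equals the slack of the edge `b`, whose row is raised and whose column is not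
  -- lowered.
  have htight : w b = s₂.real rU (row b) + s₂.real rV (col b) := by
    rw [d1 _ hrow, d2 _ hcol, if_pos b2, if_neg (by omega), b4, hw]; ring
  have h3 : Ensures (.setNat aT bestCol (.const 1)) s₂ 1 (fun s' => s' = s₂.updNat aT (col b) 1) :=
    Ensures.straight rfl (by simp [bestCol, g1, hb, h₂.col])
  refine (h3.seq (T₂ := Z * 8 + 8) ?_).mono (by omega) (fun _ _ h => h)
  rintro _ f₃ rfl
  have h₃ := h₂.frame f₃
  have q1 : (s₂.updNat aT (col b) 1).nat aBest 0 = b := by simp [g1, hb]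
  have q2 : (s₂.updNat aT (col b) 1).nat aA = s.nat aA := by
    simp [f₂.nat aA rfl, a6]
  have hcK : (s₂.updNat aT (col b) 1).nat cK 0 = k := by
    simp [f₂.nat cK rfl, f₁.nat cK rfl, hk]
  refine ((findOwner_spec h₃ (k := k) (Z := Z) (by omega) hcK (by rw [q1]; exact hrow)).seq
    (T₂ := Z * 3 + 5) ?_).mono (by omega) (fun _ _ h => h)
  rw [q1, q2]
  intro s₄ f₄ ho
  have h₄ := h₃.frame f₄
  have r1 : s₄.nat aBest 0 = b := by rw [f₄.nat aBest rfl, q1]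
  have r2 : s₄.nat aA = s.nat aA := by rw [f₄.nat aA rfl, q2]
  have r3 : s₄.nat aS = s.nat aS := by
    rw [f₄.nat aS rfl, ← a1, ← f₂.nat aS rfl]; simp
  have r4 : s₄.nat aT = Function.update (s.nat aT) (col b) 1 := by
    rw [f₄.nat aT rfl, ← a2, ← f₂.nat aT rfl]; simp
  have r5 : s₄.nat aX = s.nat aX := by
    rw [f₄.nat aX rfl, ← a5, ← f₂.nat aX rfl]; simp
  have r6 : s₄.real rU = s₂.real rU := by rw [f₄.real rU rfl]; simp
  have r7 : s₄.real rV = s₂.real rV := by rw [f₄.real rV rfl]; simp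
  have r8 : s₄.nat aFin = s.nat aFin := by
    rw [f₄.nat aFin rfl, ← f₁.nat aFin rfl, ← f₂.nat aFin rfl]; simp
  have r9 : s₄.nat cK 0 = k := by rw [f₄.nat cK rfl, hcK]
  refine (Ensures.cond (T := Z * 3 + 4) (fun hc => ?_) (fun hc => ?_)).mono le_rfl (fun _ _ h => h)
  · simp only [BExp.Holds, NExp.eval, h₄.rows, not_le] at hc
    rcases ho with ⟨o1, _⟩ | ⟨o1, o2, o3⟩
    · omega
    refine (growTree_spec h₄ hN (by rw [r1]; exact hrow) hc (by rw [r1]; exact o2)).post ?_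
    rw [r1, r2, r3]
    intro s₅ f₅ ⟨t1, t2, t3, t4⟩
    right
    refine ⟨by rw [f₅.nat aFin rfl, r8, hfin], ?_, col b, hcol, b3, by rw [f₅.nat aT rfl, r4]⟩
    have := hp₂.grow hn b1 b2 b3 htight o1 o2 o3 (A' := fun r q => s₅.nat aA (r * N + q))
      (fun r _ hrp q hq => t2 r hrp q (by omega)) (fun q hq hqr => t3 q (by omega) hqr) t4
    rw [InPhase, f₅.nat aX rfl, f₅.real rU rfl, f₅.real rV rfl, f₅.nat aT rfl, r4, r5, r6, r7, t1]
    exact this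
  · simp only [BExp.Holds, NExp.eval, h₄.rows, not_le, not_lt] at hc
    rcases ho with ⟨_, o1⟩ | ⟨o1, o2, o3⟩
    swap
    · omega
    refine (augment_spec h₄ (Z := Z) (by omega) r9 (by rw [r1]; exact hrow)).post ?_
    rw [r1, r2]
    intro s₅ f₅ ⟨t1, t2, t3⟩
    left
    refine ⟨t1, ?_⟩
    rw [f₅.real rU rfl, f₅.real rV rfl, r6, r7]
    exact hp₂.finish hn b1 b2 htight o1 t2 t3

/-- Prepare the search for an augmenting path for row `k`. -/
def startPhase : Prog :=
  .seq (.forTo cI (nv aN) (.seq (.setNat aS (nv cI) (.const 0)) (.seq (.setNat aT (nv cI) (.const 0))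
      (.setNat aA (.add (.get aOff (nv cK)) (nv cI)) (.get aX (nv cI))))))
    (.seq (.setNat aS (nv cK) (.const 1)) (.letN aFin (.const 0)))

theorem startPhase_spec (hn : Net N m row col) (h : Holds N m row col s) (hN : N ≤ Z)
    (hk : s.nat cK 0 = k) (hkN : k < N)
    (hp : Partial N m row col w k (s.nat aX) (s.real rU) (s.real rV)) :
    Ensures startPhase s (Z * 5 + 4) (fun s' => s'.nat aFin 0 = 0 ∧ InPhase N m row col w k s') := by
  have h1 : Ensures (.forTo cI (nv aN) (.seq (.setNat aS (nv cI) (.const 0))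
      (.seq (.setNat aT (nv cI) (.const 0))
      (.setNat aA (.add (.get aOff (nv cK)) (nv cI)) (.get aX (nv cI)))))) s (Z * 5 + 2) (fun s' =>
      (∀ j < N, s'.nat aS j = 0) ∧ (∀ j < N, s'.nat aT j = 0) ∧
      (∀ q < N, s'.nat aA (k * N + q) = s.nat aX q)) := by
    refine (Ensures.forTo (n := N) (T := 3) (fun i s' =>
      (∀ j < i, s'.nat aS j = 0) ∧ (∀ j < i, s'.nat aT j = 0) ∧
      (∀ q < i, s'.nat aA (k * N + q) = s.nat aX q)) rfl (fun s' hf => ?_) hN ?_ ?_).post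
      (fun _ _ h => h)
    · simpa [h.rows] using congrFun (hf.nat aN rfl) 0
    · simp
    · intro i hi s' hf hik ⟨i1, i2, i3⟩
      have e2 : s'.nat aOff = s.nat aOff := hf.nat aOff rfl
      have e3 : s'.nat cK 0 = k := by rw [hf.nat cK rfl, hk]
      have e4 : s'.nat aX = s.nat aX := hf.nat aX rfl
      refine Ensures.straight rfl ⟨fun j hj => ?_, fun j hj => ?_, fun j hj => ?_⟩
      · by_cases hji : j = i
        · simp [hik, hji]
        · simpa [hik, hji] using i1 j (by omega)
      · by_cases hji : j = i
        · simp [hik, hji]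
        · simpa [hik, hji] using i2 j (by omega)
      · by_cases hji : j = i
        · simp [hik, hji, e2, e3, e4, h.off k hkN]
        · simpa [hik, hji, e2, e3, e4, h.off k hkN] using i3 j (by omega)
  refine (h1.seq (T₂ := 2) ?_).mono (by omega) (fun _ _ h => h)
  intro s' hf ⟨i1, i2, i3⟩
  have e3 : s'.nat cK 0 = k := by rw [hf.nat cK rfl, hk]
  refine Ensures.straight rfl ⟨by simp, ?_⟩
  have : Phase N m row col w k (s.nat aX) (s.real rU) (s.real rV) (Function.update (s'.nat aS) k 1)
      (s'.nat aT) (fun r q => s'.nat aA (r * N + q)) :=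
    Phase.init hp (fun r hr => by rw [Function.update_apply, i1 r hr]) hkN i2 hn
      (fun q hq => i3 q (by omega))
  simpa [InPhase, e3, hf.nat aX rfl, hf.real rU rfl, hf.real rV rfl] using this

def phase : Prog := .seq startPhase (.loop (.natLE (nv aFin) (.const 0)) searchStep)

theorem phase_spec (hn : Net N m row col) (h : Holds N m row col s) (hN : N ≤ Z) (hm : m ≤ Z)
    (hk : s.nat cK 0 = k) (hkN : k < N) (hw : s.real rL = w)
    (hp : Partial N m row col w k (s.nat aX) (s.real rU) (s.real rV)) :
    Ensures phase s (Z * 5 + 4 + ((Z + 1) * (Z * 22 + 15) + 1)) (fun s' =>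
      Partial N m row col w (k + 1) (s'.nat aX) (s'.real rU) (s'.real rV)) := by
  refine (startPhase_spec hn h hN hk hkN hp).seq ?_
  intro s₁ f₁ ⟨i1, i2⟩
  -- The number of unreached columns bounds the growing steps; one more round is reserved for the
  -- augmentation.
  refine (Ensures.loop (T := Z * 22 + 14) (fun K s' =>
    (s'.nat aFin 0 = 0 ∧ InPhase N m row col w k s' ∧
      #{j ∈ range N | s'.nat aT j = 0} + 1 ≤ K) ∨ (s'.nat aFin 0 = 1 ∧
      Partial N m row col w (k + 1) (s'.nat aX) (s'.real rU) (s'.real rV))) (Z + 1)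
    (Or.inl ⟨i1, i2, ?_⟩) ?_).post ?_
  · have := card_filter_le (range N) (fun j => s₁.nat aT j = 0)
    rw [card_range] at this
    omega
  · intro K s' f' hI hb
    simp only [BExp.Holds, NExp.eval, Nat.le_zero] at hb
    rcases hI with ⟨_, j1, j2⟩ | ⟨j1, _⟩
    swap
    · omega
    have hh := (h.frame f₁).frame f'
    refine (searchStep_spec hn hh hN hm (by rw [f'.nat cK rfl, f₁.nat cK rfl, hk]) hkN
      (by rw [f'.real rL rfl, f₁.real rL rfl, hw]) j1 hb).post ?_
    rintro s'' _ (⟨l1, l2⟩ | ⟨l1, l2, j, hj, hj0, hj1⟩)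
    · exact ⟨0, by omega, Or.inr ⟨l1, l2⟩⟩
    · refine ⟨K - 1, by omega, Or.inl ⟨l1, l2, ?_⟩⟩
      have : #{i ∈ range N | s''.nat aT i = 0} < #{i ∈ range N | s'.nat aT i = 0} := by
        refine card_lt_card ⟨fun i hi => ?_, fun hsub => ?_⟩
        · rw [mem_filter] at hi ⊢
          refine ⟨hi.1, ?_⟩
          have := hi.2
          rw [hj1, Function.update_apply] at this
          split_ifs at this
          exact this
        · have := hsub (mem_filter.2 ⟨mem_range.2 hj, hj0⟩)
          rw [mem_filter, hj1] at this
          simp at this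
      omega
  · rintro s' _ ⟨⟨K, hI⟩, hb⟩
    simp only [BExp.Holds, NExp.eval, Nat.le_zero] at hb
    rcases hI with ⟨j1, _⟩ | ⟨_, j2⟩
    · omega
    · exact j2

/-- The Hungarian method: a minimum cost perfect matching and an optimal dual solution. -/
def hungarian : Prog :=
  .seq (.forTo cI (nv aN) (.seq (.setReal rU (nv cI) (.const 0)) (.setReal rV (nv cI) (.const 0))))
    (.forTo cK (nv aN) phase)

/-- Time bounds mirror the structure of the program, so that the composition rules produce them as
they stand; that they are polynomial is shown separately at the end. -/
def hungarianTime (Z : ℕ) : ℕ :=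
  Z * 4 + 2 + (Z * (Z * 5 + 4 + ((Z + 1) * (Z * 22 + 15) + 1) + 2) + 2)

/-- Zero potentials are feasible because the edge weights are nonnegative; each phase then matches
one more row. -/
theorem hungarian_spec (hn : Net N m row col) (h : Holds N m row col s) (hN : N ≤ Z) (hm : m ≤ Z)
    (hw : s.real rL = w) (hw0 : ∀ e < m, 0 ≤ w e) :
    Ensures hungarian s (hungarianTime Z) (fun s' =>
      Partial N m row col w N (s'.nat aX) (s'.real rU) (s'.real rV)) := by
  have h1 : Ensures (.forTo cI (nv aN) (.seq (.setReal rU (nv cI) (.const 0))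
      (.setReal rV (nv cI) (.const 0)))) s (Z * 4 + 2) (fun s' =>
      (∀ j < N, s'.real rU j = 0) ∧ (∀ j < N, s'.real rV j = 0)) := by
    refine (Ensures.forTo (n := N) (T := 2) (fun i s' =>
      (∀ j < i, s'.real rU j = 0) ∧ (∀ j < i, s'.real rV j = 0)) rfl (fun s' hf => ?_) hN ?_ ?_).post
      (fun _ _ h => h)
    · simpa [h.rows] using congrFun (hf.nat aN rfl) 0
    · simp
    · intro i hi s' hf hik ⟨i1, i2⟩
      refine Ensures.straight rfl ⟨fun j hj => ?_, fun j hj => ?_⟩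
      · by_cases hji : j = i
        · simp [hik, hji]
        · simpa [hik, hji] using i1 j (by omega)
      · by_cases hji : j = i
        · simp [hik, hji]
        · simpa [hik, hji] using i2 j (by omega)
  refine h1.seq ?_
  intro s₁ f₁ ⟨i1, i2⟩
  have hh := h.frame f₁
  refine Ensures.forTo (n := N) (fun k s' =>
    Partial N m row col w k (s'.nat aX) (s'.real rU) (s'.real rV)) rfl (fun s' hf => ?_) hN ?_ ?_
  · simpa [hh.rows] using congrFun (hf.nat aN rfl) 0
  · refine ⟨fun e he => ?_, by simp, by simp, by simp, by simp⟩
    simpa [i1 _ (hn.row_lt e he), i2 _ (hn.col_lt e he)] using hw0 e he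
  · intro k hk s' hf hik hI
    refine (phase_spec hn (hh.frame hf) hN hm hik hk
      (by rw [hf.real rL rfl, f₁.real rL rfl, hw]) hI).post ?_
    intro s'' _ hq
    simpa using hq

end

/-! ### Lagrangian relaxation of the knapsack constraint -/

section

variable {N m Z : ℕ} {row col : ℕ → ℕ} {s s' : State} {c w : ℕ → ℝ} {B : ℝ}

/-- The memory holds the network, the costs, the weights and the bound. -/
structure HoldsAll (N m : ℕ) (row col : ℕ → ℕ) (c w : ℕ → ℝ) (B : ℝ) (s : State) : Prop
    extends Holds N m row col s where
  cost : s.real rC = c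
  weight : s.real rW = w
  bound : s.real rIn 1 = B

theorem HoldsAll.frame {p : Prog} (h : HoldsAll N m row col c w B s) (hf : Frame p s s')
    (hc : [aN, aM, aOff, aRow, aCol].all (fun a => !p.writesNat a) = true := by rfl)
    (hr : [rC, rW, rIn].all (fun a => !p.writesReal a) = true := by rfl) :
    HoldsAll N m row col c w B s' := by
  refine ⟨h.toHolds.frame hf hc, ?_, ?_, ?_⟩ <;>
  simp only [List.all_cons, List.all_nil, Bool.and_eq_true, Bool.not_eq_true'] at hr <;>
  obtain ⟨h1, h2, h3, _⟩ := hr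
  · rw [hf.real _ h1, h.cost]
  · rw [hf.real _ h2, h.weight]
  · rw [hf.real _ h3, h.bound]

/-- Copy the row-indexed array `x` into `y`. -/
def copyRows (x y : ℕ) : Prog := .forTo cI (nv aN) (.setNat y (nv cI) (.get x (nv cI)))

theorem copyRows_spec {x y : ℕ} (h : Holds N m row col s) (hN : N ≤ Z) (hxy : y ≠ x) (hx : x ≠ cI)
    (hy : y ≠ cI) (hyN : y ≠ aN) :
    Ensures (copyRows x y) s (Z * 3 + 2) (fun s' => ∀ r < N, s'.nat y r = s.nat x r) := by
  refine (Ensures.fillNat (n := N) (s.nat x) hy.symm (fun s' hf => ?_) hN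
    (fun k _ s' hf hik _ => ?_)).post ?_
  · have := hf.nat aN (by simp [Prog.forTo, Prog.writesNat, hyN.symm])
    simp [this, h.rows]
  · have := hf.nat x (by simp [Prog.forTo, Prog.writesNat, hxy.symm, hx])
    simp [this, hik]
  · intro s' _ hq r hr
    rw [hq]; simp [hr]

/-- Store in `t` the total of `f` over the edges in `x`. -/
def sumOver (t f x : ℕ) : Prog :=
  .seq (.letR t (.const 0)) (.forTo cI (nv aN) (.letR t (.add (rv t) (.get f (.get x (nv cI))))))

theorem sumOver_spec {t f x : ℕ} (h : Holds N m row col s) (hN : N ≤ Z) (ht : t ≠ f) (hx : x ≠ cI) :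
    Ensures (sumOver t f x) s (Z * 3 + 3)
      (fun s' => s'.real t 0 = total N (s.real f) (s.nat x)) := by
  refine Ensures.sumReal (n := N) (fun r => s.real f (s.nat x r)) (fun s' hf => ?_) hN
    (fun k _ s' hf hik => ?_)
  · have := hf.nat aN rfl
    simp [this, h.rows]
  · have h1 := hf.nat x (by simp [Prog.forTo, Prog.writesNat, hx])
    have h2 := hf.real f (by simp [Prog.forTo, Prog.writesReal, ht.symm])
    simp [h1, h2, hik]

/-- Find a perfect matching of minimum combined cost `a c + b w`, with its cost and its weight. -/
def solve (a b : RExp) : Prog :=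
  .seq (.letR rA a) (.seq (.letR rB b) (.seq
    (.forTo cI (nv aM) (.setReal rL (nv cI)
      (.add (.mul (rv rA) (.get rC (nv cI))) (.mul (rv rB) (.get rW (nv cI))))))
    (.seq hungarian (.seq (sumOver rWX rW aX) (sumOver rCX rC aX)))))

def solveTime (Z : ℕ) : ℕ := 1 + (1 + (Z * 3 + 2 + (hungarianTime Z + (Z * 3 + 3 + (Z * 3 + 3)))))

/-- The coefficient `b` is evaluated after `rA` has been written, hence its hypothesis over framed
states. -/
theorem solve_spec (hn : Net N m row col) (h : HoldsAll N m row col c w B s) (hN : N ≤ Z)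
    (hm : m ≤ Z) (hc : ∀ e < m, 0 ≤ c e) (hw : ∀ e < m, 0 ≤ w e) {a b : RExp} {α β : ℝ}
    (ha : a.eval s = α) (hb : ∀ s', Frame (.letR rA a) s s' → b.eval s' = β)
    (hα : 0 ≤ α) (hβ : 0 ≤ β) :
    Ensures (solve a b) s (solveTime Z) (fun s' =>
      Partial N m row col (fun e => α * c e + β * w e) N (s'.nat aX) (s'.real rU) (s'.real rV) ∧
      s'.real rWX 0 = total N w (s'.nat aX) ∧ s'.real rCX 0 = total N c (s'.nat aX) ∧
      s'.real rB 0 = β) := by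
  have h1 : Ensures (.letR rA a) s 1 (fun s' => s'.real rA 0 = α) :=
    Ensures.straight rfl (by simp [ha])
  refine h1.seq fun s₁ f₁ a1 => ?_
  have h2 : Ensures (.letR rB b) s₁ 1 (fun s' => s'.real rB 0 = β) :=
    Ensures.straight rfl (by simp [hb s₁ f₁])
  refine h2.seq fun s₂ f₂ a2 => ?_
  have a1' : s₂.real rA 0 = α := by rw [f₂.real rA rfl, a1]
  have hh := (h.frame f₁).frame f₂
  have h3 := Ensures.fillReal (n := m) (Z := Z) (i := cI) (a := rL) (ne := nv aM)
    (e := .add (.mul (rv rA) (.get rC (nv cI))) (.mul (rv rB) (.get rW (nv cI)))) (s := s₂)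
    (fun e => α * c e + β * w e) (fun s' hf => ?_) hm (fun k hk s' hf hik _ => ?_)
  rotate_left
  · have := hf.nat aM rfl
    simp [this, hh.edges]
  · have e1 := hf.real rA rfl
    have e2 := hf.real rB rfl
    have e3 := hf.real rC rfl
    have e4 := hf.real rW rfl
    simp [e1, e2, e3, e4, a1', a2, hh.cost, hh.weight, hik]
  refine h3.seq fun s₃ f₃ a3 => ?_
  have hh3 := hh.frame f₃
  have hval : ∀ e < m, s₃.real rL e = α * c e + β * w e := fun e he => by rw [a3]; simp [he]
  refine (hungarian_spec hn hh3.toHolds hN hm rfl (fun e he => ?_)).seq fun s₄ f₄ a4 => ?_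
  · rw [hval e he]
    exact add_nonneg (mul_nonneg hα (hc e he)) (mul_nonneg hβ (hw e he))
  have hh4 := hh3.frame f₄
  refine (sumOver_spec hh4.toHolds hN (by decide) (by decide)).seq fun s₅ f₅ a5 => ?_
  have hh5 := hh4.frame f₅
  refine (sumOver_spec hh5.toHolds hN (by decide) (by decide)).post fun s₆ f₆ a6 => ?_
  have x5 : s₅.nat aX = s₄.nat aX := f₅.nat aX rfl
  have x6 : s₆.nat aX = s₄.nat aX := by rw [f₆.nat aX rfl, x5]
  rw [x6]
  refine ⟨?_, ?_, ?_, ?_⟩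
  · rw [f₆.real rU rfl, f₆.real rV rfl, f₅.real rU rfl, f₅.real rV rfl]
    exact ⟨fun e he => by rw [← hval e he]; exact a4.feas e he, a4.lt, a4.row_eq,
      fun q hq => by rw [← hval _ (a4.lt q hq)]; exact a4.tight q hq, a4.inj⟩
  · rw [f₆.real rWX rfl, a5, hh4.weight]
  · rw [a6, hh5.cost, x5]
  · rw [f₆.real rB rfl, f₅.real rB rfl, f₄.real rB rfl, f₃.real rB rfl, a2]

/-- Array `x` holds a perfect matching whose weight and cost are stored in `rw` and `rc`. -/
structure Stored (N m : ℕ) (row col : ℕ → ℕ) (c w : ℕ → ℝ) (x rw rc : ℕ) (s : State) : Prop where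
  isMatching : IsMatching N m row col (s.nat x)
  weight : s.real rw 0 = total N w (s.nat x)
  cost : s.real rc 0 = total N c (s.nat x)

theorem Stored.congr {x rw rc : ℕ} (h : Stored N m row col c w x rw rc s) (hx : s'.nat x = s.nat x)
    (hw : s'.real rw = s.real rw) (hc : s'.real rc = s.real rc) :
    Stored N m row col c w x rw rc s' :=
  ⟨by rw [hx]; exact h.isMatching, by rw [hx, hw]; exact h.weight, by rw [hx, hc]; exact h.cost⟩

def store (x rw rc : ℕ) : Prog := .seq (copyRows aX x) (.seq (.letR rw (rv rWX)) (.letR rc (rv rCX)))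

theorem total_congr {f : ℕ → ℝ} {M M' : ℕ → ℕ} (h : ∀ r < N, M r = M' r) :
    total N f M = total N f M' :=
  sum_congr rfl fun r hr => by rw [h r (mem_range.1 hr)]

theorem isMatching_congr {M M' : ℕ → ℕ} (h : ∀ r < N, M' r = M r) (hM : IsMatching N m row col M) :
    IsMatching N m row col M' :=
  ⟨fun r hr => by rw [h r hr]; exact hM.lt r hr, fun r hr => by rw [h r hr]; exact hM.row_eq r hr,
    fun r hr q hq => by rw [h r hr, h q hq]; exact hM.inj r hr q hq⟩

theorem store_spec {x rw rc : ℕ} (h : Holds N m row col s) (hN : N ≤ Z)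
    (hs : Stored N m row col c w aX rWX rCX s) (hx : x ≠ aX) (hx1 : x ≠ cI) (hx2 : x ≠ aN)
    (hrc : rc ≠ rw) (hrw : rCX ≠ rw) :
    Ensures (store x rw rc) s (Z * 3 + 4) (fun s' => Stored N m row col c w x rw rc s' ∧
      ∀ r < N, s'.nat x r = s.nat aX r) := by
  refine ((copyRows_spec h hN hx (by decide) hx1 hx2).seq (T₂ := 2) fun s₁ f₁ a1 => ?_).mono
    (by omega) (fun _ _ h => h)
  have e1 : s₁.real rWX = s.real rWX := f₁.real rWX rfl
  have e2 : s₁.real rCX = s.real rCX := f₁.real rCX rfl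
  refine Ensures.straight rfl ⟨⟨?_, ?_, ?_⟩, ?_⟩
  · exact isMatching_congr (by simpa using a1) hs.isMatching
  · simpa [hrc.symm, e1, hs.weight] using (total_congr a1).symm
  · simpa [hrw, e2, hs.cost] using (total_congr a1).symm
  · simpa using a1

/-! #### The search for the multiplier -/

/-- The multiplier for which the two stored matchings have the same combined cost. -/
def newMultiplier : RExp := .div (.sub (rv rC₁) (rv rC₂)) (.sub (rv rW₂) (rv rW₁))

def combined (c w : ℕ) : RExp := .add (rv c) (.mul (rv rB) (rv w))

/-- The discrete Newton method: `M₁` respects the bound, `M₂` does not; stop as soon as both are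
optimal for the same multiplier. -/
def newton : Prog :=
  .seq (.letN aDone (.const 0)) (.loop (.natLE (nv aDone) (.const 0))
    (.seq (solve (.const 1) newMultiplier)
      (.cond (.realLE (combined rC₁ rW₁) (combined rCX rWX)) (.letN aDone (.const 1))
        (.cond (.realLE (rv rWX) (.get rIn (.const 1))) (store aM₁ rW₁ rC₁) (store aM₂ rW₂ rC₂)))))

def newtonTime (Z : ℕ) : ℕ := 1 + ((Z + 2) * (solveTime Z + (Z * 3 + 6) + 1) + 1)

/-- Both stored matchings are optimal for the multiplier `l`, as the dual solution in memory shows. -/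
structure Balanced (N m : ℕ) (row col : ℕ → ℕ) (c w : ℕ → ℝ) (l : ℝ) (s : State) : Prop where
  nonneg : 0 ≤ l
  dual : Partial N m row col (fun e => c e + l * w e) N (s.nat aX) (s.real rU) (s.real rV)
  left_le : total N (fun e => c e + l * w e) (s.nat aM₁) ≤
    total N (fun e => c e + l * w e) (s.nat aX)
  right_le : total N (fun e => c e + l * w e) (s.nat aM₂) ≤
    total N (fun e => c e + l * w e) (s.nat aX)

/-- The two stored matchings lie on either side of the bound. -/
structure Bracket (N m : ℕ) (row col : ℕ → ℕ) (c w : ℕ → ℝ) (B : ℝ) (s : State) : Prop where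
  left : Stored N m row col c w aM₁ rW₁ rC₁ s
  right : Stored N m row col c w aM₂ rW₂ rC₂ s
  left_le : total N w (s.nat aM₁) ≤ B
  lt_right : B < total N w (s.nat aM₂)

theorem Bracket.frame {p : Prog} (h : Bracket N m row col c w B s) (hf : Frame p s s')
    (hc : [aM₁, aM₂].all (fun a => !p.writesNat a) = true := by rfl)
    (hr : [rW₁, rC₁, rW₂, rC₂].all (fun a => !p.writesReal a) = true := by rfl) :
    Bracket N m row col c w B s' := by
  simp only [List.all_cons, List.all_nil, Bool.and_eq_true, Bool.not_eq_true'] at hr hc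
  obtain ⟨h1, h2, _⟩ := hc
  obtain ⟨g1, g2, g3, g4, _⟩ := hr
  exact ⟨h.left.congr (hf.nat _ h1) (hf.real _ g1) (hf.real _ g2),
    h.right.congr (hf.nat _ h2) (hf.real _ g3) (hf.real _ g4),
    by rw [hf.nat _ h1]; exact h.left_le, by rw [hf.nat _ h2]; exact h.lt_right⟩

/-- `M` minimizes `a c + b w`. -/
def Minimizes (N m : ℕ) (row col : ℕ → ℕ) (c w : ℕ → ℝ) (a b : ℝ) (M : ℕ → ℕ) : Prop :=
  ∀ M', IsMatching N m row col M' →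
    a * total N c M + b * total N w M ≤ a * total N c M' + b * total N w M'

theorem Minimizes.of_partial (hn : Net N m row col) {a b : ℝ} {X : ℕ → ℕ} {u v : ℕ → ℝ}
    (h : Partial N m row col (fun e => a * c e + b * w e) N X u v) :
    Minimizes N m row col c w a b X := fun M' hM' => by
  have := h.total_le hn hM'
  rwa [total_combine, total_combine] at this

theorem Minimizes.congr {a b : ℝ} {M M' : ℕ → ℕ} (hM : Minimizes N m row col c w a b M)
    (h : ∀ r < N, M' r = M r) : Minimizes N m row col c w a b M' := fun M'' h'' => by
  rw [total_congr h, total_congr h]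
  exact hM M'' h''

open Classical in
/-- The invariant of the search, with at most `K` rounds to go. -/
def Searching (N m : ℕ) (row col : ℕ → ℕ) (c w : ℕ → ℝ) (K : ℕ) (s : State) : Prop :=
  ∃ a₁ b₁ a₂ b₂ : ℝ, 0 ≤ a₁ ∧ 0 < b₁ ∧ 0 < a₂ ∧ 0 ≤ b₂ ∧
    Minimizes N m row col c w a₁ b₁ (s.nat aM₁) ∧ Minimizes N m row col c w a₂ b₂ (s.nat aM₂) ∧
    total N c (s.nat aM₁) - total N c (s.nat aM₂) + (if b₂ = 0 then 1 else 0) + 1 ≤ K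

/-- Turns a strict inequality between costs into a difference of at least one. -/
theorem exists_total_eq_natCast {cn : ℕ → ℕ} (hm : ∀ e < m, c e = cn e) {M : ℕ → ℕ}
    (hM : ∀ r < N, M r < m) : ∃ z : ℕ, total N c M = z :=
  ⟨∑ r ∈ range N, cn (M r), by
    rw [total, Nat.cast_sum]
    exact sum_congr rfl fun r hr => hm _ (hM r (mem_range.1 hr))⟩

/-- The integer cost gap between `M₁` and `M₂` drops with every replacement, except possibly for the
one that first replaces the cheapest matching; the indicator of `b₂ = 0` in `Searching` pays for
that one, and its last summand for the round that stops. Together with a gap of at most `Z` this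
gives `Z + 2` rounds. -/
theorem newton_spec (hn : Net N m row col) (h : HoldsAll N m row col c w B s) (hN : N ≤ Z)
    (hm : m ≤ Z) {cn : ℕ → ℕ} (hcn : ∀ e < m, c e = cn e) (hw : ∀ e < m, 0 ≤ w e)
    (hb : Bracket N m row col c w B s) (h₁ : Minimizes N m row col c w 0 1 (s.nat aM₁))
    (h₂ : Minimizes N m row col c w 1 0 (s.nat aM₂))
    (hd : total N c (s.nat aM₁) - total N c (s.nat aM₂) ≤ Z) :
    Ensures newton s (newtonTime Z) (fun s' => Bracket N m row col c w B s' ∧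
      ∃ l, Balanced N m row col c w l s') := by
  have hc : ∀ e < m, 0 ≤ c e := fun e he => by rw [hcn e he]; positivity
  have h1 : Ensures (.letN aDone (.const 0)) s 1 (fun s' => s'.nat aDone 0 = 0) :=
    Ensures.straight rfl (by simp)
  refine h1.seq fun s₁ f₁ a1 => ?_
  have hh := h.frame f₁
  refine (Ensures.loop (T := solveTime Z + (Z * 3 + 6)) (fun K s' => Bracket N m row col c w B s' ∧
    ((s'.nat aDone 0 = 0 ∧ Searching N m row col c w K s') ∨
     (s'.nat aDone 0 = 1 ∧ ∃ l, Balanced N m row col c w l s'))) (Z + 2) ⟨?_, Or.inl ⟨a1, ?_⟩⟩ ?_).post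
    ?_
  · exact hb.frame f₁
  · have e1 : s₁.nat aM₁ = s.nat aM₁ := f₁.nat _ rfl
    have e2 : s₁.nat aM₂ = s.nat aM₂ := f₁.nat _ rfl
    refine ⟨0, 1, 1, 0, le_rfl, one_pos, one_pos, le_rfl, by rwa [e1], by rwa [e2], ?_⟩
    rw [e1, e2]
    push_cast
    simp
    linarith
  · intro K s₂ f₂ ⟨b2, hI⟩ ht
    simp only [BExp.Holds, NExp.eval, Nat.le_zero] at ht
    rcases hI with ⟨_, a₁, b₁, a₂, b₂, ha₁, hb₁, ha₂, hb₂, min₁, min₂, hK⟩ | ⟨hI, _⟩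
    swap
    · omega
    have hh2 := hh.frame f₂
    have hlt := b2.left_le.trans_lt b2.lt_right
    set l := (total N c (s₂.nat aM₁) - total N c (s₂.nat aM₂)) /
      (total N w (s₂.nat aM₂) - total N w (s₂.nat aM₁)) with hl
    -- The second matching is heavier and minimizes `a₂ c + b₂ w` with `a₂ > 0`, so it cannot be the
    -- more expensive one.
    have hl0 : 0 ≤ l := by
      refine div_nonneg ?_ (by linarith)
      have := min₂ _ b2.left.isMatching
      have h3 : b₂ * (total N w (s₂.nat aM₁) - total N w (s₂.nat aM₂)) ≤ 0 :=
        mul_nonpos_of_nonneg_of_nonpos hb₂ (by linarith)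
      have h4 : 0 ≤ a₂ * (total N c (s₂.nat aM₁) - total N c (s₂.nat aM₂)) := by linarith
      exact nonneg_of_mul_nonneg_right h4 ha₂
    have hll : l * (total N w (s₂.nat aM₂) - total N w (s₂.nat aM₁)) =
        total N c (s₂.nat aM₁) - total N c (s₂.nat aM₂) := by
      rw [hl]
      have : total N w (s₂.nat aM₂) - total N w (s₂.nat aM₁) ≠ 0 := by linarith
      field_simp
    have hval : ∀ s', Frame (.letR rA (.const 1)) s₂ s' → newMultiplier.eval s' = l := by
      intro s' hf
      simp only [newMultiplier, RExp.eval, NExp.eval, hf.real rC₁ rfl, hf.real rC₂ rfl,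
        hf.real rW₁ rfl, hf.real rW₂ rfl, b2.left.cost, b2.left.weight, b2.right.cost,
        b2.right.weight, hl]
    refine (solve_spec hn hh2 hN hm hc hw (a := .const 1) (α := 1) (by simp) hval zero_le_one
      hl0).seq (T₂ := Z * 3 + 6) fun s₃ f₃ ⟨p3, w3, c3, hB⟩ => ?_
    have hh3 := hh2.frame f₃
    have m1 : s₃.nat aM₁ = s₂.nat aM₁ := f₃.nat _ rfl
    have m2 : s₃.nat aM₂ = s₂.nat aM₂ := f₃.nat _ rfl
    have st1 : Stored N m row col c w aM₁ rW₁ rC₁ s₃ :=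
      b2.left.congr m1 (f₃.real _ rfl) (f₃.real _ rfl)
    have st2 : Stored N m row col c w aM₂ rW₂ rC₂ s₃ :=
      b2.right.congr m2 (f₃.real _ rfl) (f₃.real _ rfl)
    have stX : Stored N m row col c w aX rWX rCX s₃ := ⟨p3.isMatching, w3, c3⟩
    have b3 : Bracket N m row col c w B s₃ :=
      ⟨st1, st2, by rw [m1]; exact b2.left_le, by rw [m2]; exact b2.lt_right⟩
    have minX := Minimizes.of_partial hn p3
    refine (Ensures.cond (T := Z * 3 + 5) (fun ht => ?_) (fun ht => ?_)).mono le_rfl (fun _ _ h => h)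
    · simp only [BExp.Holds, combined, RExp.eval, NExp.eval, st1.weight, st1.cost, w3, c3, hB, m1] at ht
      have hdone : Ensures (.letN aDone (.const 1)) s₃ 1 (fun s' => s'.nat aDone 0 = 1) :=
        Ensures.straight rfl (by simp)
      refine hdone.mono (by omega) fun s₄ f₄ d4 => ⟨0, ?_, b3.frame f₄, Or.inr ⟨d4, l, hl0, ?_, ?_, ?_⟩⟩
      · by_contra hK0
        obtain rfl : K = 0 := by omega
        have h5 : (0 : ℝ) ≤ if b₂ = 0 then 1 else 0 := by split_ifs <;> norm_num
        have h6 : 0 ≤ l * (total N w (s₂.nat aM₂) - total N w (s₂.nat aM₁)) :=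
          mul_nonneg hl0 (by linarith)
        push_cast at hK
        linarith
      · rw [f₄.nat aX rfl, f₄.real rU rfl, f₄.real rV rfl]
        simpa using p3
      · rw [f₄.nat aM₁ rfl, f₄.nat aX rfl, m1]
        have h5 := total_combine (N := N) c w 1 l
        simp only [one_mul] at h5
        rw [h5, h5]
        exact ht
      · rw [f₄.nat aM₂ rfl, f₄.nat aX rfl, m2]
        have h5 := total_combine (N := N) c w 1 l
        simp only [one_mul] at h5
        rw [h5, h5]
        linarith
    · simp only [BExp.Holds, combined, RExp.eval, NExp.eval, st1.weight, st1.cost, w3, c3, hB, m1,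
        not_le] at ht
      obtain ⟨hlpos, hlt1, hlt2⟩ := between_of_below ha₁ hb₁ ha₂ hb₂ hlt hl
        (min₁ _ b2.right.isMatching) (min₁ _ p3.isMatching) (min₂ _ b2.left.isMatching)
        (min₂ _ p3.isMatching) ht
      obtain ⟨z₁, hz₁⟩ := exists_total_eq_natCast hcn b2.left.isMatching.lt
      obtain ⟨z₂, hz₂⟩ := exists_total_eq_natCast hcn b2.right.isMatching.lt
      obtain ⟨zx, hzx⟩ := exists_total_eq_natCast hcn p3.isMatching.lt
      rw [hz₁, hzx] at hlt1
      rw [hz₂, hzx] at hlt2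
      rw [hz₁, hz₂] at hK
      have hlt1' : (zx : ℝ) + 1 ≤ z₁ := by exact_mod_cast hlt1
      -- A tie with `M₂` is possible only as long as `b₂ = 0`. When `M₂` is replaced, the new
      -- coefficient is `l > 0` and the indicator is spent.
      have hlt2' : (zx : ℝ) ≥ z₂ + 1 - (if b₂ = 0 then 1 else 0) := by
        rcases hlt2 with h6 | ⟨h6, h7⟩
        · have : (z₂ : ℝ) + 1 ≤ zx := by exact_mod_cast h6
          split_ifs <;> linarith
        · rw [if_pos h6]
          linarith
      have hK1 : 1 ≤ K := by
        have h5 : (0 : ℝ) ≤ if b₂ = 0 then 1 else 0 := by split_ifs <;> norm_num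
        by_contra hK0
        obtain rfl : K = 0 := by omega
        push_cast at hK
        linarith
      have hKc : ((K - 1 : ℕ) : ℝ) = K - 1 := by push_cast [hK1]; ring
      refine Ensures.cond (T := Z * 3 + 4) (fun hwB => ?_) (fun hwB => ?_)
      · simp only [BExp.Holds, RExp.eval, NExp.eval, w3, hh3.bound] at hwB
        refine (store_spec hh3.toHolds hN stX (by decide) (by decide) (by decide) (by decide)
          (by decide)).post fun s₄ f₄ ⟨d1, d2⟩ => ?_
        have n2 : s₄.nat aM₂ = s₂.nat aM₂ := by rw [f₄.nat aM₂ rfl, m2]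
        refine ⟨K - 1, by omega, ⟨d1, st2.congr (f₄.nat _ rfl) (f₄.real _ rfl) (f₄.real _ rfl), ?_, ?_⟩,
          Or.inl ⟨by rw [f₄.nat aDone rfl, f₃.nat aDone rfl, ‹s₂.nat aDone 0 = 0›], 1, l, a₂, b₂,
            zero_le_one, hlpos, ha₂, hb₂, minX.congr d2, by rw [n2]; exact min₂, ?_⟩⟩
        · rw [total_congr d2]; exact hwB
        · rw [n2]; exact b2.lt_right
        · rw [total_congr d2, n2, hzx, hz₂, hKc]
          linarith
      · simp only [BExp.Holds, RExp.eval, NExp.eval, w3, hh3.bound, not_le] at hwB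
        refine (store_spec hh3.toHolds hN stX (by decide) (by decide) (by decide) (by decide)
          (by decide)).post fun s₄ f₄ ⟨d1, d2⟩ => ?_
        have n1 : s₄.nat aM₁ = s₂.nat aM₁ := by rw [f₄.nat aM₁ rfl, m1]
        refine ⟨K - 1, by omega, ⟨st1.congr (f₄.nat _ rfl) (f₄.real _ rfl) (f₄.real _ rfl), d1, ?_, ?_⟩,
          Or.inl ⟨by rw [f₄.nat aDone rfl, f₃.nat aDone rfl, ‹s₂.nat aDone 0 = 0›], a₁, b₁, 1, l,
            ha₁, hb₁, one_pos, hlpos.le, by rw [n1]; exact min₁, minX.congr d2, ?_⟩⟩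
        · rw [n1]; exact b2.left_le
        · rw [total_congr d2]; exact hwB
        · rw [total_congr d2, n1, hzx, hz₁, hKc, if_neg hlpos.ne']
          linarith
  · rintro s₂ - ⟨⟨K, b2, hI⟩, ht⟩
    simp only [BExp.Holds, NExp.eval, Nat.le_zero] at ht
    rcases hI with ⟨hI, _⟩ | ⟨_, hI⟩
    · omega
    · exact ⟨b2, hI⟩

end

section

variable {N m Z : ℕ} {row col : ℕ → ℕ} {s s' : State} {c w : ℕ → ℝ} {B : ℝ}

/-! #### The walk along the alternating cycles -/

/-- The potential of the column of `r` in the first matching. -/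
def leftPotential (r : NExp) : RExp := .get rV (.get aCol (.get aM₁ r))

/-- Pick the unprocessed row of largest potential. -/
def pickLargest : Prog :=
  .seq (.letN aPick (nv aN)) (.forTo cI (nv aN)
    (.cond (.and (.natLE (.get aP (nv cI)) (.const 0)) (.or (.natLE (nv aN) (nv aPick))
        (.realLT (leftPotential (nv aPick)) (leftPotential (nv cI)))))
      (.letN aPick (nv cI)) .skip))

theorem pickLargest_spec (h : Holds N m row col s) (hN : N ≤ Z) (hex : ∃ r < N, s.nat aP r = 0) :
    Ensures pickLargest s (Z * 5 + 3) (fun s' => s'.nat aPick 0 < N ∧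
      s.nat aP (s'.nat aPick 0) = 0 ∧ ∀ r < N, s.nat aP r = 0 →
        s.real rV (col (s.nat aM₁ r)) ≤ s.real rV (col (s.nat aM₁ (s'.nat aPick 0)))) := by
  have h1 : Ensures (.letN aPick (nv aN)) s 1 (fun s' => s' = s.updNat aPick 0 N) :=
    Ensures.straight rfl (by simp [h.rows])
  refine (h1.seq (T₂ := Z * 5 + 2) ?_).mono (by omega) (fun _ _ h => h)
  rintro _ _ rfl
  refine (Ensures.forTo (n := N) (T := 3) (fun k s' =>
    (s'.nat aPick 0 = N ∧ ∀ r < k, s.nat aP r ≠ 0) ∨ (s'.nat aPick 0 < N ∧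
      s.nat aP (s'.nat aPick 0) = 0 ∧ ∀ r < k, s.nat aP r = 0 →
        s.real rV (col (s.nat aM₁ r)) ≤ s.real rV (col (s.nat aM₁ (s'.nat aPick 0))))) rfl
    (fun s' hf => ?_) hN (Or.inl (by simp)) ?_).post ?_
  · have := hf.nat aN rfl
    simp [this, h.rows]
  · intro k hk s' hf hik hI
    have e1 : s'.nat aN 0 = N := by rw [hf.nat aN rfl]; simp [h.rows]
    have e2 : s'.nat aCol = col := by rw [hf.nat aCol rfl]; simp [h.col]
    have e3 : s'.nat aP = s.nat aP := by rw [hf.nat aP rfl]; simp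
    have e4 : s'.nat aM₁ = s.nat aM₁ := by rw [hf.nat aM₁ rfl]; simp
    have e5 : s'.real rV = s.real rV := by rw [hf.real rV rfl]; simp
    refine Ensures.straight rfl ?_
    simp only [Prog.exec, BExp.Holds, NExp.eval, RExp.eval, leftPotential, e1, e2, e3, e4, e5, hik]
    split_ifs with hc
    · right
      simp only [State.updNat_nat, if_true, if_neg (show ¬ (36 = 16) by decide),
        Function.update_self]
      refine ⟨hk, by simpa using hc.1, fun r hr h0 => ?_⟩
      rcases Nat.lt_succ_iff_lt_or_eq.1 hr with hr' | rfl
      · rcases hI with ⟨_, hI⟩ | ⟨i1, _, i3⟩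
        · exact absurd h0 (hI r hr')
        · have := hc.2
          simp only [not_and, not_not, not_le] at this
          exact (i3 r hr' h0).trans (this i1).le
      · exact le_rfl
    · simp only [State.updNat_nat, if_neg (show ¬ (36 = 16) by decide)]
      rcases hI with ⟨i1, i2⟩ | ⟨i1, i2, i3⟩
      · left
        refine ⟨i1, fun r hr h0 => ?_⟩
        rcases Nat.lt_succ_iff_lt_or_eq.1 hr with hr' | rfl
        · exact i2 r hr' h0
        · exact hc ⟨h0.le, by simp [i1]⟩
      · right
        refine ⟨i1, i2, fun r hr h0 => ?_⟩
        rcases Nat.lt_succ_iff_lt_or_eq.1 hr with hr' | rfl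
        · exact i3 r hr' h0
        · by_contra hlt
          push Not at hlt
          exact hc ⟨h0.le, by simp [i1, hlt]⟩
  · rintro s' - (⟨_, hI⟩ | hI)
    · obtain ⟨r, hr, h0⟩ := hex
      exact absurd h0 (hI r hr)
    · exact hI

/-- Find the unprocessed row whose first matching edge covers the column `d`. -/
def findNext : Prog :=
  .forTo cI (nv aN) (.cond (.and (.natLE (.get aP (nv cI)) (.const 0))
      (BExp.natEq (.get aCol (.get aM₁ (nv cI))) (nv aD))) (.letN aPick (nv cI)) .skip)

theorem findNext_spec (h : Holds N m row col s) (hN : N ≤ Z)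
    (hex : ∃ r < N, s.nat aP r = 0 ∧ col (s.nat aM₁ r) = s.nat aD 0) :
    Ensures findNext s (Z * 5 + 2) (fun s' => s'.nat aPick 0 < N ∧
      s.nat aP (s'.nat aPick 0) = 0 ∧ col (s.nat aM₁ (s'.nat aPick 0)) = s.nat aD 0) := by
  refine (Ensures.forTo (n := N) (T := 3) (fun k s' =>
    (∃ r < k, s.nat aP r = 0 ∧ col (s.nat aM₁ r) = s.nat aD 0) → (s'.nat aPick 0 < N ∧
      s.nat aP (s'.nat aPick 0) = 0 ∧ col (s.nat aM₁ (s'.nat aPick 0)) = s.nat aD 0)) rfl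
    (fun s' hf => ?_) hN (by simp) ?_).post (fun s' _ hI => hI hex)
  · simpa [h.rows] using congrFun (hf.nat aN rfl) 0
  · intro k hk s' hf hik hI
    have e2 : s'.nat aCol = col := by rw [hf.nat aCol rfl, h.col]
    have e3 : s'.nat aP = s.nat aP := hf.nat aP rfl
    have e4 : s'.nat aM₁ = s.nat aM₁ := hf.nat aM₁ rfl
    have e5 : s'.nat aD = s.nat aD := hf.nat aD rfl
    refine Ensures.straight rfl ?_
    simp only [Prog.exec, BExp.Holds, NExp.eval, e2, e3, e4, e5, hik, ← le_antisymm_iff, Nat.le_zero]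
    split_ifs with hc
    · simpa using fun _ _ _ _ => ⟨hk, hc⟩
    · simp only [State.updNat_nat, if_neg (show ¬ (36 = 16) by decide)]
      rintro ⟨r, hr, hr1⟩
      refine hI ⟨r, ?_, hr1⟩
      rcases Nat.lt_succ_iff_lt_or_eq.1 hr with hr' | rfl
      · exact hr'
      · exact absurd hr1 hc

/-- The weight after the next exchange. -/
def nextWeight : RExp :=
  .sub (.add (rv rWY) (.get rW (.get aM₂ (nv aPick)))) (.get rW (.get aM₁ (nv aPick)))

/-- Choose where to go on: if a cycle has been closed, start the next one at the unprocessed row of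
largest potential. -/
def chooseRow : Prog :=
  .seq (.cond (BExp.natEq (nv aH) (nv aD))
    (.seq pickLargest (.seq (.letN aH (.get aCol (.get aM₁ (nv aPick)))) (.letN aD (nv aH)))) .skip)
    findNext

/-- Exchange one edge, unless the bound would be violated. -/
def exchange : Prog :=
  .cond (.realLE nextWeight (.get rIn (.const 1)))
    (.seq (.letR rWY nextWeight) (.seq (.setNat aY (nv aPick) (.get aM₂ (nv aPick)))
      (.seq (.setNat aP (nv aPick) (.const 1)) (.letN aD (.get aCol (.get aM₂ (nv aPick)))))))
    (.letN aDone (.const 1))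

/-- Replace edges of the first matching by edges of the second one along the alternating cycles, as
long as the bound permits. -/
def mix : Prog :=
  .seq (.forTo cI (nv aN) (.seq (.setNat aP (nv cI) (.const 0))
      (.setNat aY (nv cI) (.get aM₁ (nv cI)))))
    (.seq (.seq (.letN aH (.const 0)) (.seq (.letN aD (.const 0)) (.seq (.letN aDone (.const 0))
        (.letR rWY (rv rW₁)))))
      (.loop (.natLE (nv aDone) (.const 0)) (.seq chooseRow exchange)))

/-- The state of the walk. -/
structure Walking (N : ℕ) (row col : ℕ → ℕ) (w : ℕ → ℝ) (B : ℝ) (s : State) : Prop where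
  mixture : Mixture N col (s.nat aM₁) (s.nat aM₂) (s.nat aY) (s.nat aP) (s.nat aH 0) (s.nat aD 0)
  weight : s.real rWY 0 = total N w (s.nat aY)
  weight_le : total N w (s.nat aY) ≤ B
  status : s.nat aH 0 = s.nat aD 0 ∨ (s.nat aD 0 < N ∧
    (∀ r < N, s.nat aP r = 0 → s.real rV (col (s.nat aM₁ r)) ≤ s.real rV (s.nat aH 0)) ∧
    ∃ r < N, 1 ≤ s.nat aP r ∧ col (s.nat aM₂ r) = s.nat aD 0)

/-- A mixture with all rows processed is `M₂`, which is too heavy. So the walk must stop at the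
bound before it runs out of rows. -/
theorem Walking.exists_unprocessed (h : Walking N row col w B s)
    (hB : B < total N w (s.nat aM₂)) : ∃ r < N, s.nat aP r = 0 := by
  by_contra hne
  push Not at hne
  have : total N w (s.nat aY) = total N w (s.nat aM₂) := total_congr fun r hr => by
    rw [h.mixture.eq r hr, if_pos (Nat.one_le_iff_ne_zero.2 (hne r hr))]
  have := h.weight_le
  linarith

/-- After a closed cycle, entering the next one at a row of largest potential makes `v h` an upper
bound for the `M₁`-columns of all unprocessed rows. On an open cycle this bound is inherited, and
`Mixture.exists_next` provides the row to continue with. -/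
theorem chooseRow_spec (hn : Net N m row col) (h : Holds N m row col s) (hN : N ≤ Z)
    (h₁ : IsMatching N m row col (s.nat aM₁)) (h₂ : IsMatching N m row col (s.nat aM₂))
    (hw : Walking N row col w B s) (hB : B < total N w (s.nat aM₂)) :
    Ensures chooseRow s (Z * 10 + 8) (fun s' =>
      Mixture N col (s.nat aM₁) (s.nat aM₂) (s.nat aY) (s.nat aP) (s'.nat aH 0) (s'.nat aD 0) ∧
      (∀ r < N, s.nat aP r = 0 → s.real rV (col (s.nat aM₁ r)) ≤ s.real rV (s'.nat aH 0)) ∧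
      s'.nat aPick 0 < N ∧ s.nat aP (s'.nat aPick 0) = 0 ∧
      col (s.nat aM₁ (s'.nat aPick 0)) = s'.nat aD 0) := by
  have key : Ensures (.cond (BExp.natEq (nv aH) (nv aD)) (.seq pickLargest
      (.seq (.letN aH (.get aCol (.get aM₁ (nv aPick)))) (.letN aD (nv aH)))) .skip) s (Z * 5 + 6)
      (fun s' =>
      Mixture N col (s.nat aM₁) (s.nat aM₂) (s.nat aY) (s.nat aP) (s'.nat aH 0) (s'.nat aD 0) ∧
      (∀ r < N, s.nat aP r = 0 → s.real rV (col (s.nat aM₁ r)) ≤ s.real rV (s'.nat aH 0)) ∧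
      ∃ r < N, s.nat aP r = 0 ∧ col (s.nat aM₁ r) = s'.nat aD 0) := by
    refine Ensures.cond (T := Z * 5 + 5) (fun hc => ?_) (fun hc => ?_)
    · simp only [BExp.Holds, NExp.eval, ← le_antisymm_iff] at hc
      refine ((pickLargest_spec h hN (hw.exists_unprocessed hB)).seq (T₂ := 2)
        fun s₁ f₁ ⟨i1, i2, i3⟩ => ?_).mono (by omega) (fun _ _ h => h)
      have e1 : s₁.nat aCol = col := by rw [f₁.nat aCol rfl, h.col]
      have e2 : s₁.nat aM₁ = s.nat aM₁ := f₁.nat aM₁ rfl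
      refine Ensures.straight rfl ?_
      simp only [Prog.exec, NExp.eval, e1, e2, State.updNat_nat, if_true, Function.update_self,
        if_neg (show ¬ (34 = 35) by decide)]
      have hm := hw.mixture
      rw [← hc] at hm
      exact ⟨hm.reset _, i3, _, i1, i2, rfl⟩
    · simp only [BExp.Holds, NExp.eval, ← le_antisymm_iff] at hc
      rcases hw.status with hs | ⟨g1, g2, g3⟩
      · exact absurd hs hc
      refine (Ensures.straight (c := .skip) rfl ?_).mono (show 1 ≤ _ by omega) (fun _ _ h => h)
      exact ⟨hw.mixture, g2, hw.mixture.exists_next hn h₁ g1 (Ne.symm hc) g3 h₂⟩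
  refine (key.seq (T₂ := Z * 5 + 2) fun s₁ f₁ ⟨i1, i2, i3⟩ => ?_).mono (by omega) (fun _ _ h => h)
  have e2 : s₁.nat aM₁ = s.nat aM₁ := f₁.nat aM₁ rfl
  have e3 : s₁.nat aP = s.nat aP := f₁.nat aP rfl
  refine (findNext_spec (h.frame f₁) hN (by rw [e2, e3]; exact i3)).post fun s₂ f₂ hq => ?_
  rw [e2, e3] at hq
  rw [f₂.nat aH rfl, f₂.nat aD rfl]
  exact ⟨i1, i2, hq⟩

/-- The result of the solver: a near matching that respects the bound and costs at most `t` more than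
any perfect matching that respects the bound. -/
def IsSolution (N m : ℕ) (row col : ℕ → ℕ) (c w : ℕ → ℝ) (B t : ℝ) (x : ℕ → ℕ) : Prop :=
  (∃ h d, IsNearMatching N m row col x h d) ∧ total N w x ≤ B ∧
    ∀ M, IsMatching N m row col M → total N w M ≤ B → total N c x ≤ total N c M + t

/-- The rejected exchange is used in the argument only. After it, all edges are tight and the
surplus column has potential at most `v h`, so the combined cost is at most that of any matching
`M`. Its weight exceeds `B`, so if `M` is within the bound, its cost is at most that of `M`; undoing
the exchange adds at most `c (M₁ a) ≤ t`. -/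
theorem Mixture.isSolution (hn : Net N m row col) {M₁ M₂ x P X : ℕ → ℕ} {h d a : ℕ} {l t : ℝ}
    {u v : ℕ → ℝ} (h₁ : IsMatching N m row col M₁) (h₂ : IsMatching N m row col M₂) (hl : 0 ≤ l)
    (hd : Partial N m row col (fun e => c e + l * w e) N X u v)
    (l₁ : total N (fun e => c e + l * w e) M₁ ≤ total N (fun e => c e + l * w e) X)
    (l₂ : total N (fun e => c e + l * w e) M₂ ≤ total N (fun e => c e + l * w e) X)
    (hx : Mixture N col M₁ M₂ x P h d) (htop : ∀ r < N, P r = 0 → v (col (M₁ r)) ≤ v h)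
    (ha : a < N) (hPa : P a = 0) (had : col (M₁ a) = d) (hxB : total N w x ≤ B)
    (hnext : B < total N w x + w (M₂ a) - w (M₁ a)) (hct : ∀ e < m, c e ≤ t)
    (hc : ∀ e < m, 0 ≤ c e) : IsSolution N m row col c w B t x := by
  refine ⟨⟨h, d, hx.isNear hn h₁ h₂⟩, hxB, fun M hM hMB => ?_⟩
  have hxa : x a = M₁ a := by rw [hx.eq a ha, if_neg (by omega)]
  have hs := hx.swap ha hPa had
  -- Either the exchange closes the cycle, or the surplus column is the `M₁`-column of a row that is
  -- still unprocessed, to which `htop` applies.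
  have hv : v (col (M₂ a)) ≤ v h := by
    by_cases hne : col (M₂ a) = h
    · rw [hne]
    obtain ⟨a', ha', hPa', hca'⟩ := hs.exists_next hn h₁ (hn.col_lt _ (h₂.lt a ha)) hne
      ⟨a, ha, by simp, rfl⟩ h₂
    rw [← hca']
    refine htop a' ha' ?_
    rw [Function.update_apply] at hPa'
    split_ifs at hPa'
    exact hPa'
  have e1 := hs.total_le hn h₁ h₂ (hd.tight_of_total_le hn h₁ l₁) (hd.tight_of_total_le hn h₂ l₂) hv
  have e2 := dual_le hn hd.feas hM
  have e3 := total_combine (N := N) c w 1 l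
  simp only [one_mul] at e3
  have e4 := e1.trans e2
  rw [e3, e3, total_update _ _ ha, total_update _ _ ha, hxa] at e4
  have e5 : l * total N w M ≤ l * (total N w x + w (M₂ a) - w (M₁ a)) :=
    mul_le_mul_of_nonneg_left (by linarith) hl
  have e6 := hct _ (h₁.lt a ha)
  have e7 := hc _ (h₂.lt a ha)
  linarith

theorem mix_spec (hn : Net N m row col) (h : HoldsAll N m row col c w B s) (hN : N ≤ Z)
    (hb : Bracket N m row col c w B s) {l t : ℝ} (hl : Balanced N m row col c w l s)
    (hct : ∀ e < m, c e ≤ t) (hc : ∀ e < m, 0 ≤ c e) :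
    Ensures mix s (Z * 4 + 2 + (4 + ((Z + 1) * (Z * 10 + 14) + 1))) (fun s' =>
      IsSolution N m row col c w B t (s'.nat aY)) := by
  have h1 : Ensures (.forTo cI (nv aN) (.seq (.setNat aP (nv cI) (.const 0))
      (.setNat aY (nv cI) (.get aM₁ (nv cI))))) s (Z * 4 + 2) (fun s' =>
      ∀ r < N, s'.nat aP r = 0 ∧ s'.nat aY r = s.nat aM₁ r) := by
    refine Ensures.forTo (n := N) (T := 2) (fun k s' =>
      ∀ r < k, s'.nat aP r = 0 ∧ s'.nat aY r = s.nat aM₁ r) rfl (fun s' hf => ?_) hN (by simp) ?_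
    · simpa [h.rows] using congrFun (hf.nat aN rfl) 0
    · intro k hk s' hf hik hI
      have e1 : s'.nat aM₁ = s.nat aM₁ := hf.nat _ rfl
      refine Ensures.straight rfl fun r hr => ?_
      by_cases hrk : r = k
      · simp [hik, hrk, e1]
      · simpa [hik, hrk] using hI r (by omega)
  refine h1.seq fun s₁ f₁ i1 => ?_
  have h2 : Ensures (.seq (.letN aH (.const 0)) (.seq (.letN aD (.const 0))
      (.seq (.letN aDone (.const 0)) (.letR rWY (rv rW₁))))) s₁ 4 (fun s' =>
      s'.nat aH 0 = 0 ∧ s'.nat aD 0 = 0 ∧ s'.nat aDone 0 = 0 ∧ s'.real rWY 0 = s₁.real rW₁ 0) :=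
    Ensures.straight rfl (by simp)
  refine h2.seq fun s₂ f₂ ⟨j1, j2, j3, j4⟩ => ?_
  have hY : ∀ r < N, s₂.nat aY r = s.nat aM₁ r := fun r hr => by rw [f₂.nat aY rfl]; exact (i1 r hr).2
  have hP : ∀ r < N, s₂.nat aP r = 0 := fun r hr => by rw [f₂.nat aP rfl]; exact (i1 r hr).1
  have hh := (h.frame f₁).frame f₂
  have k1 : s₂.nat aM₁ = s.nat aM₁ := by rw [f₂.nat _ rfl, f₁.nat _ rfl]
  refine (Ensures.loop (T := Z * 10 + 13) (fun K s' => (s'.nat aDone 0 = 0 ∧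
      Walking N row col w B s' ∧ #{r ∈ range N | s'.nat aP r = 0} + 1 ≤ K) ∨
    (s'.nat aDone 0 = 1 ∧ IsSolution N m row col c w B t (s'.nat aY))) (Z + 1)
    (Or.inl ⟨j3, ⟨⟨fun r hr => ?_, fun g => ?_⟩, ?_, ?_, Or.inl (by rw [j1, j2])⟩, ?_⟩) ?_).post ?_
  · rw [hY r hr, hP r hr, k1]; rfl
  · rw [j1, j2, sub_self]
    refine sum_eq_zero fun r hr => ?_
    rw [hP r (mem_range.1 hr)]; rfl
  · rw [j4, total_congr hY, f₁.real rW₁ rfl, hb.left.weight]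
  · rw [total_congr hY]; exact hb.left_le
  · have := card_filter_le (range N) (fun r => s₂.nat aP r = 0)
    rw [card_range] at this
    omega
  · intro K s₃ f₃ hI ht
    simp only [BExp.Holds, NExp.eval, Nat.le_zero] at ht
    rcases hI with ⟨_, hw, hK⟩ | ⟨hI, _⟩
    swap
    · omega
    have hh3 := hh.frame f₃
    have l1 : s₃.nat aM₁ = s.nat aM₁ := by rw [f₃.nat _ rfl, k1]
    have l2 : s₃.nat aM₂ = s.nat aM₂ := by rw [f₃.nat _ rfl, f₂.nat _ rfl, f₁.nat _ rfl]
    have l3 : s₃.real rV = s.real rV := by rw [f₃.real _ rfl, f₂.real _ rfl, f₁.real _ rfl]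
    have m1 := hb.left.isMatching
    have m2 := hb.right.isMatching
    refine ((chooseRow_spec hn hh3.toHolds hN (by rwa [l1]) (by rwa [l2]) hw
      (by rw [l2]; exact hb.lt_right)).seq (T₂ := 5) fun s₄ f₄ ⟨q1, q2, q3, q4, q5⟩ => ?_).mono
      (by omega) (fun _ _ h => h)
    rw [l1, l2] at q1
    rw [l1, l3] at q2
    rw [l1] at q5
    have hh4 := hh3.frame f₄
    have n1 : s₄.nat aM₁ = s.nat aM₁ := by rw [f₄.nat _ rfl, l1]
    have n2 : s₄.nat aM₂ = s.nat aM₂ := by rw [f₄.nat _ rfl, l2]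
    have n3 : s₄.nat aY = s₃.nat aY := f₄.nat _ rfl
    have n4 : s₄.nat aP = s₃.nat aP := f₄.nat _ rfl
    have n5 : s₄.real rWY = s₃.real rWY := f₄.real _ rfl
    have n6 : s₄.real rV = s.real rV := by rw [f₄.real _ rfl, l3]
    have n7 : s₄.nat aDone 0 = 0 := by rw [f₄.nat _ rfl, ht]
    have hyp : s₃.nat aY (s₄.nat aPick 0) = s.nat aM₁ (s₄.nat aPick 0) := by
      rw [q1.eq _ q3, if_neg (by omega)]
    refine Ensures.cond (T := 4) (fun hB => ?_) (fun hB => ?_)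
    · simp only [BExp.Holds, nextWeight, RExp.eval, NExp.eval, n1, n2, n5, hw.weight, hh4.weight,
        hh4.bound] at hB
      refine Ensures.straight rfl ⟨K - 1, by omega, Or.inl ⟨by simpa using n7, ?_, ?_⟩⟩
      · refine ⟨?_, ?_, ?_, Or.inr ⟨?_, ?_, s₄.nat aPick 0, q3, ?_⟩⟩
        · simpa [n1, n2, n3, n4, hh4.col] using q1.swap q3 q4 q5
        · simp [nextWeight, n1, n2, n3, n5, hw.weight, hh4.weight, total_update _ _ q3, hyp]
        · simpa [n2, n3, total_update _ _ q3, hyp] using hB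
        · simpa [n2, hh4.col] using hn.col_lt _ (m2.lt _ q3)
        · intro r hr h0
          have hra : r ≠ s₄.nat aPick 0 := by
            rintro rfl
            simp at h0
          simp [n4, hra] at h0
          simpa [n1, n6] using q2 r hr h0
        · simp [n2, hh4.col]
      · have : #{r ∈ range N | Function.update (s₃.nat aP) (s₄.nat aPick 0) 1 r = 0} <
            #{r ∈ range N | s₃.nat aP r = 0} := by
          refine card_lt_card ⟨fun i hi => ?_, fun hsub => ?_⟩
          · rw [mem_filter] at hi ⊢
            refine ⟨hi.1, ?_⟩
            have := hi.2
            rw [Function.update_apply] at this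
            split_ifs at this
            exact this
          · have := hsub (mem_filter.2 ⟨mem_range.2 q3, q4⟩)
            rw [mem_filter] at this
            simp at this
        simp [n4]
        omega
    · simp only [BExp.Holds, nextWeight, RExp.eval, NExp.eval, n1, n2, n5, hw.weight, hh4.weight,
        hh4.bound, not_le] at hB
      refine (Ensures.straight (c := .letN aDone (.const 1)) rfl
        ⟨0, by omega, Or.inr ⟨by simp, ?_⟩⟩).mono (show 1 ≤ _ by omega) (fun _ _ h => h)
      have := Mixture.isSolution hn m1 m2 hl.nonneg hl.dual hl.left_le hl.right_le q1 q2 q3 q4 q5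
        hw.weight_le hB hct hc
      simpa [n3] using this
  · rintro s₃ - ⟨⟨K, hI⟩, ht⟩
    simp only [BExp.Holds, NExp.eval, Nat.le_zero] at ht
    rcases hI with ⟨hI, _⟩ | ⟨_, hI⟩
    · omega
    · exact hI

/-! #### The solver -/

/-- Find a near matching within the bound that is almost as cheap as any matching within the bound. -/
def solver : Prog :=
  .seq (.letN aOk (.const 0)) (.seq (solve (.const 0) (.const 1)) (.seq (store aM₁ rW₁ rC₁)
    (.cond (.realLE (rv rW₁) (.get rIn (.const 1)))
      (.seq (.letN aOk (.const 1)) (.seq (solve (.const 1) (.const 0)) (.seq (store aM₂ rW₂ rC₂)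
        (.cond (.realLE (rv rW₂) (.get rIn (.const 1))) (copyRows aM₂ aY) (.seq newton mix)))))
      .skip)))

def solverTime (Z : ℕ) : ℕ :=
  1 + (solveTime Z + (Z * 3 + 4 + (1 + (solveTime Z + (Z * 3 + 4 + (newtonTime Z +
    (Z * 4 + 2 + (4 + ((Z + 1) * (Z * 10 + 14) + 1))) + Z * 3 + 2 + 1))) + 1)))

/-- The lightest matching decides whether the bound can be met at all; a cheapest matching within
the bound is optimal; otherwise the two bracket the bound. Integer costs of at most `t` give an
initial gap of at most `N * t`, which is why `Z` must dominate it. -/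
theorem solver_spec (hn : Net N m row col) (h : HoldsAll N m row col c w B s)
    (hm : m ≤ Z) {cn : ℕ → ℕ} (hcn : ∀ e < m, c e = cn e) {t : ℕ} (ht : ∀ e < m, cn e ≤ t)
    (hN : N ≤ Z) (htZ : N * t ≤ Z) (hw : ∀ e < m, 0 ≤ w e) :
    Ensures solver s (solverTime Z) (fun s' =>
      (s'.nat aOk 0 = 1 ∧ IsSolution N m row col c w B t (s'.nat aY)) ∨
      (s'.nat aOk 0 = 0 ∧ ∀ M, IsMatching N m row col M → B < total N w M)) := by
  have hc : ∀ e < m, 0 ≤ c e := fun e he => by rw [hcn e he]; positivity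
  have hct : ∀ e < m, c e ≤ t := fun e he => by rw [hcn e he]; exact_mod_cast ht e he
  have h0 : Ensures (.letN aOk (.const 0)) s 1 (fun s' => s'.nat aOk 0 = 0) :=
    Ensures.straight rfl (by simp)
  refine h0.seq fun s₁ f₁ a1 => ?_
  have hh1 := h.frame f₁
  refine (solve_spec hn hh1 hN hm hc hw (a := .const 0) (b := .const 1) (α := 0) (β := 1) (by simp)
    (by simp) le_rfl zero_le_one).seq fun s₂ f₂ ⟨p2, w2, c2, _⟩ => ?_
  have hh2 := hh1.frame f₂
  have min₁ := Minimizes.of_partial hn p2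
  refine (store_spec hh2.toHolds hN ⟨p2.isMatching, w2, c2⟩ (x := aM₁) (rw := rW₁) (rc := rC₁)
    (by decide) (by decide) (by decide) (by decide) (by decide)).seq fun s₃ f₃ ⟨st3, eq3⟩ => ?_
  have hh3 := hh2.frame f₃
  have min₁' := min₁.congr eq3
  have ok3 : s₃.nat aOk 0 = 0 := by rw [f₃.nat _ rfl, f₂.nat _ rfl, a1]
  refine Ensures.cond (fun hc1 => ?_) (fun hc1 => ?_)
  swap
  · simp only [BExp.Holds, RExp.eval, NExp.eval, st3.weight, hh3.bound, not_le] at hc1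
    refine (Ensures.straight (c := .skip) rfl ?_).mono (show 1 ≤ _ by omega) (fun _ _ h => h)
    refine Or.inr ⟨ok3, fun M hM => ?_⟩
    have := min₁' M hM
    simp only [zero_mul, one_mul, zero_add] at this
    linarith
  simp only [BExp.Holds, RExp.eval, NExp.eval, st3.weight, hh3.bound] at hc1
  have h1 : Ensures (.letN aOk (.const 1)) s₃ 1 (fun s' => s'.nat aOk 0 = 1) :=
    Ensures.straight rfl (by simp)
  refine h1.seq fun s₄ f₄ ok4 => ?_
  have hh4 := hh3.frame f₄
  refine (solve_spec hn hh4 hN hm hc hw (a := .const 1) (b := .const 0) (α := 1) (β := 0) (by simp)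
    (by simp) zero_le_one le_rfl).seq fun s₅ f₅ ⟨p5, w5, c5, _⟩ => ?_
  have hh5 := hh4.frame f₅
  have min₂ := Minimizes.of_partial hn p5
  refine (store_spec hh5.toHolds hN ⟨p5.isMatching, w5, c5⟩ (x := aM₂) (rw := rW₂) (rc := rC₂)
    (by decide) (by decide) (by decide) (by decide) (by decide)).seq fun s₆ f₆ ⟨st6, eq6⟩ => ?_
  have hh6 := hh5.frame f₆
  have min₂' := min₂.congr eq6
  have ok6 : s₆.nat aOk 0 = 1 := by rw [f₆.nat _ rfl, f₅.nat _ rfl, ok4]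
  have k1 : s₆.nat aM₁ = s₃.nat aM₁ := by rw [f₆.nat _ rfl, f₅.nat _ rfl, f₄.nat _ rfl]
  have st1 : Stored N m row col c w aM₁ rW₁ rC₁ s₆ := st3.congr k1
    (by rw [f₆.real _ rfl, f₅.real _ rfl, f₄.real _ rfl])
    (by rw [f₆.real _ rfl, f₅.real _ rfl, f₄.real _ rfl])
  refine Ensures.cond (fun hc2 => ?_) (fun hc2 => ?_)
  · simp only [BExp.Holds, RExp.eval, NExp.eval, st6.weight, hh6.bound] at hc2
    refine (copyRows_spec hh6.toHolds hN (by decide) (by decide) (by decide) (by decide)).mono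
      (by omega) fun s₇ f₇ eq7 => Or.inl ⟨by rw [f₇.nat _ rfl, ok6], ?_⟩
    have hM := isMatching_congr eq7 st6.isMatching
    refine ⟨⟨0, 0, hM.isNear hn⟩, by rwa [total_congr eq7], fun M hM' _ => ?_⟩
    have := min₂' M hM'
    simp only [zero_mul, one_mul, add_zero] at this
    rw [total_congr eq7]
    have : (0 : ℝ) ≤ t := by positivity
    linarith
  · simp only [BExp.Holds, RExp.eval, NExp.eval, st6.weight, hh6.bound, not_le] at hc2
    have hb : Bracket N m row col c w B s₆ := ⟨st1, st6, by rwa [k1], hc2⟩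
    refine ((newton_spec hn hh6 hN hm hcn hw hb (by rwa [k1]) min₂' ?_).seq
      fun s₇ f₇ ⟨b7, l, bal7⟩ => (mix_spec hn (hh6.frame f₇) hN b7 bal7 hct hc).post
        fun s₈ f₈ hq => Or.inl ⟨by rw [f₈.nat _ rfl, f₇.nat _ rfl, ok6], hq⟩).mono (by omega)
        (fun _ _ h => h)
    have e1 : total N c (s₆.nat aM₁) ≤ N * t := by
      refine (sum_le_card_nsmul _ _ (t : ℝ) fun r hr =>
        hct _ (st1.isMatching.lt r (mem_range.1 hr))).trans ?_
      simp
    have e2 : 0 ≤ total N c (s₆.nat aM₂) :=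
      sum_nonneg fun r hr => hc _ (st6.isMatching.lt r (mem_range.1 hr))
    have e3 : ((N * t : ℕ) : ℝ) ≤ Z := by exact_mod_cast htZ
    push_cast at e3
    linarith

end

section

/-! ### Guessing the most expensive edges -/

/-- The network of an instance: rows below `n` are UAVs, edges below `E` are genuine, and every row
and column are joined by a further edge. -/
structure Network (n E N m : ℕ) (row col : ℕ → ℕ) : Prop extends Net N m row col where
  n_le : n ≤ N
  extra : ∀ r < N, ∀ j < N, ∃ e < m, E ≤ e ∧ row e = r ∧ col e = j

/-- A feasible assignment: the UAV `r` uses the edge `π r`. -/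
structure IsAssignment (n E : ℕ) (row col : ℕ → ℕ) (weight : ℕ → ℝ) (B : ℝ) (π : ℕ → ℕ) : Prop where
  lt : ∀ r < n, π r < E
  row_eq : ∀ r < n, row (π r) = r
  inj : ∀ r < n, ∀ q < n, col (π r) = col (π q) → r = q
  weight_le : ∑ r ∈ range n, weight (π r) ≤ B

/-- An assignment of the UAVs within the bound that overloads at most one column, by at most one. -/
structure IsRelaxed (n E N : ℕ) (row col : ℕ → ℕ) (weight : ℕ → ℝ) (B : ℝ) (x : ℕ → ℕ) : Prop where
  lt : ∀ r < n, x r < E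
  row_eq : ∀ r < n, row (x r) = r
  weight_le : ∑ r ∈ range n, weight (x r) ≤ B
  load : ∃ d, ∀ j < N, #{r ∈ range n | col (x r) = j} ≤ 1 + if j = d then 1 else 0

/-- The first `g` entries of `τ` are the most expensive edges of `π`. -/
def IsTop (n g : ℕ) (cost : ℕ → ℝ) (π τ : ℕ → ℕ) : Prop :=
  ∃ σ : ℕ → ℕ, (∀ i < g, σ i < n ∧ τ i = π (σ i)) ∧ (∀ i < g, ∀ j < g, σ i = σ j → i = j) ∧
    ∀ r < n, (∃ i < g, σ i = r) ∨ ∀ i < g, cost (π r) ≤ cost (τ i)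

/-- `ed` and `ro` mark the guessed edges and their rows; `cm` is the least cost of a guessed edge. -/
structure Marks (E N g : ℕ) (row : ℕ → ℕ) (cost : ℕ → ℝ) (τ ed ro : ℕ → ℕ) (cm : ℝ) : Prop where
  edge : ∀ e < E, 1 ≤ ed e ↔ ∃ i < g, τ i = e
  row : ∀ r < N, 1 ≤ ro r ↔ ∃ i < g, row (τ i) = r
  le : ∀ i < g, cm ≤ cost (τ i)
  eq : 0 < g → ∃ i < g, cm = cost (τ i)
  nonneg : 0 ≤ cm

/-- Edge weights for a guess: excluded edges are too heavy to be used. -/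
noncomputable def guessWeight (n E : ℕ) (row : ℕ → ℕ) (cost weight : ℕ → ℝ) (B : ℝ) (ed ro : ℕ → ℕ)
    (cm : ℝ) (e : ℕ) : ℝ :=
  if E ≤ e then (if n ≤ row e then 0 else B + 1)
  else if 1 ≤ ed e then weight e
  else if ro (row e) = 0 ∧ cost e ≤ cm then weight e else B + 1

/-- Scaled edge costs for a guess: only the edges that may complete the guess have a cost. -/
noncomputable def guessCost (E : ℕ) (row : ℕ → ℕ) (cost : ℕ → ℝ) (ed ro : ℕ → ℕ) (cm δ : ℝ)
    (e : ℕ) : ℝ :=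
  if E ≤ e then 0 else if 1 ≤ ed e then 0
  else if ro (row e) = 0 ∧ cost e ≤ cm then cost e / δ else 0

variable {n E N m g : ℕ} {row col τ ed ro π x : ℕ → ℕ} {cost weight : ℕ → ℝ} {B cm ε : ℝ}

theorem guessWeight_nonneg (hB : 0 ≤ B) (hw : ∀ e, 0 ≤ weight e) (e : ℕ) :
    0 ≤ guessWeight n E row cost weight B ed ro cm e := by
  unfold guessWeight
  have := hw e
  split_ifs <;> linarith

/-- An edge with a scaled cost has cost at most `cm`, that is, `n²` units of `cm / n²`. If the unit
is zero, division by zero returns zero. The bound controls the number of Newton rounds, the time for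
rounding and the additive error alike. -/
theorem guessCost_le (hcm : 0 ≤ cm) (e : ℕ) :
    guessCost E row cost ed ro cm (cm / (n * n)) e ≤ (n * n : ℕ) := by
  have h0 : (0 : ℝ) ≤ (n * n : ℕ) := by positivity
  unfold guessCost
  split_ifs with h1 h2 h3
  · exact h0
  · exact h0
  · rcases hcm.eq_or_lt with h | h
    · rw [← h, zero_div, div_zero]; exact h0
    · rcases Nat.eq_zero_or_pos n with rfl | hn
      · simp
      · have hn' : (0 : ℝ) < n * n := by positivity
        rw [div_le_iff₀ (div_pos h hn')]
        push_cast
        rw [mul_div_cancel₀ _ hn'.ne']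
        exact h3.2
  · exact h0

/-- The rows from `n` on are matched greedily: before each of them fewer than `N` columns are
occupied, and an extra edge leads to a free one. -/
theorem IsAssignment.exists_extension (hn : Network n E N m row col)
    (hE : E ≤ m) (hπ : IsAssignment n E row col weight B π) :
    ∃ M, IsMatching N m row col M ∧ (∀ r < n, M r = π r) ∧ ∀ r < N, n ≤ r → E ≤ M r := by
  suffices H : ∀ k, n + k ≤ N → ∃ M : ℕ → ℕ, ((∀ r < n + k, M r < m) ∧ (∀ r < n + k, row (M r) = r) ∧
      ∀ r < n + k, ∀ q < n + k, col (M r) = col (M q) → r = q) ∧ (∀ r < n, M r = π r) ∧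
      ∀ r < n + k, n ≤ r → E ≤ M r by
    obtain ⟨M, ⟨h1, h2, h3⟩, h4, h5⟩ := H (N - n) (by have := hn.n_le; omega)
    have : n + (N - n) = N := by have := hn.n_le; omega
    rw [this] at h1 h2 h3 h5
    exact ⟨M, ⟨h1, h2, h3⟩, h4, h5⟩
  intro k
  induction k with
  | zero =>
    exact fun _ => ⟨π, ⟨fun r hr => (hπ.lt r hr).trans_le hE, hπ.row_eq, hπ.inj⟩, fun _ _ => rfl,
      fun r hr hr' => by omega⟩
  | succ k ih =>
    intro hk
    obtain ⟨M, ⟨h1, h2, h3⟩, h4, h5⟩ := ih (by omega)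
    obtain ⟨j, hj, hj'⟩ : ∃ j ∈ range N, j ∉ (range (n + k)).image fun q => col (M q) := by
      refine Finset.exists_mem_notMem_of_card_lt_card (card_image_le.trans_lt ?_)
      rw [card_range, card_range]; omega
    obtain ⟨e, he, heE, her, hec⟩ := hn.extra (n + k) (by omega) j (mem_range.1 hj)
    have hfree : ∀ q < n + k, col (M q) ≠ col e := fun q hq hc =>
      hj' (mem_image.2 ⟨q, mem_range.2 hq, hc.trans hec⟩)
    have hup : ∀ r, r ≠ n + k → Function.update M (n + k) e r = M r := fun r hr => by simp [hr]
    have hup' : Function.update M (n + k) e (n + k) = e := by simp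
    refine ⟨Function.update M (n + k) e, ⟨fun r hr => ?_, fun r hr => ?_, fun r hr q hq hc => ?_⟩,
      fun r hr => ?_, fun r hr hr' => ?_⟩
    · by_cases h : r = n + k
      · rw [h, hup']; exact he
      · rw [hup r h]; exact h1 r (by omega)
    · by_cases h : r = n + k
      · rw [h, hup']; exact her
      · rw [hup r h]; exact h2 r (by omega)
    · by_cases h : r = n + k
      · by_cases h' : q = n + k
        · rw [h, h']
        · rw [h, hup', hup q h'] at hc
          exact absurd hc.symm (hfree q (by omega))
      · by_cases h' : q = n + k
        · rw [h', hup', hup r h] at hc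
          exact absurd hc (hfree r (by omega))
        · rw [hup r h, hup q h'] at hc
          exact h3 r (by omega) q (by omega) hc
    · rw [hup r (by omega)]; exact h4 r hr
    · by_cases h : r = n + k
      · rw [h, hup']; exact heE
      · rw [hup r h]; exact h5 r (by omega) hr'

/-- The rows below `n` of a solution use permitted genuine edges only. -/
theorem genuine_of_total_le (hn : Network n E N m row col) (hB : 0 ≤ B) (hw : ∀ e, 0 ≤ weight e)
    (hrow : ∀ r < N, row (x r) = r)
    (hx : total N (guessWeight n E row cost weight B ed ro cm) x ≤ B) {r : ℕ} (hr : r < n) :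
    x r < E ∧ guessWeight n E row cost weight B ed ro cm (x r) = weight (x r) ∧
      (1 ≤ ed (x r) ∨ (ro r = 0 ∧ cost (x r) ≤ cm ∧ ed (x r) = 0)) := by
  have hrN : r < N := hr.trans_le hn.n_le
  -- Weights are nonnegative, so no single edge exceeds the total; this excludes the edges of weight
  -- `B + 1`.
  have h1 : guessWeight n E row cost weight B ed ro cm (x r) ≤ B :=
    (single_le_sum (f := fun r => guessWeight n E row cost weight B ed ro cm (x r))
      (fun q _ => guessWeight_nonneg hB hw (x q)) (mem_range.2 hrN)).trans hx
  have hr' := hrow r hrN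
  unfold guessWeight at h1 ⊢
  rw [hr'] at h1 ⊢
  split_ifs at h1 ⊢ with g1 g2 g3 g4
  · omega
  · linarith
  · exact ⟨by omega, rfl, Or.inl g3⟩
  · exact ⟨by omega, rfl, Or.inr ⟨g4.1, g4.2, by omega⟩⟩
  · linarith

/-- Holds for every guess, right or wrong. Dropping the rows from `n` on can only lower the weight
and the loads. -/
theorem isRelaxed_of_isSolution (hn : Network n E N m row col) (hB : 0 ≤ B) (hw : ∀ e, 0 ≤ weight e)
    {c : ℕ → ℝ} {t : ℝ}
    (hx : IsSolution N m row col c (guessWeight n E row cost weight B ed ro cm) B t x) :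
    IsRelaxed n E N row col weight B x := by
  obtain ⟨⟨h, d, hnear⟩, hxB, -⟩ := hx
  have key := fun r (hr : r < n) => genuine_of_total_le hn hB hw hnear.row_eq hxB hr
  refine ⟨fun r hr => (key r hr).1, fun r hr => hnear.row_eq r (hr.trans_le hn.n_le), ?_, d, ?_⟩
  · refine le_trans ?_ hxB
    rw [sum_congr rfl fun r hr => (key r (mem_range.1 hr)).2.1.symm]
    exact sum_le_sum_of_subset_of_nonneg (range_mono hn.n_le)
      fun q _ _ => guessWeight_nonneg hB hw (x q)
  · intro j hj
    have h1 := hnear.sum_col fun i => if i = j then 1 else 0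
    have h2 : (#{r ∈ range n | col (x r) = j} : ℝ) ≤ ∑ r ∈ range N, if col (x r) = j then 1 else 0 := by
      rw [← sum_boole]
      exact sum_le_sum_of_subset_of_nonneg (range_mono hn.n_le) fun q _ _ => by split_ifs <;> norm_num
    rw [h1] at h2
    have h3 : (∑ i ∈ range N, if i = j then (1 : ℝ) else 0) = 1 := by simp [hj]
    rw [h3] at h2
    have h4 : (#{r ∈ range n | col (x r) = j} : ℝ) ≤ ((1 + if j = d then 1 else 0 : ℕ) : ℝ) := by
      refine h2.trans ?_
      by_cases hd : d = j
      · rw [if_pos hd, if_pos hd.symm]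
        push_cast
        split_ifs <;> norm_num
      · rw [if_neg hd, if_neg (Ne.symm hd)]
        push_cast
        split_ifs <;> norm_num
    exact_mod_cast h4

/-- What a right guess tells about the edges of the assignment that was guessed. -/
structure Guessed (n E : ℕ) (row : ℕ → ℕ) (cost : ℕ → ℝ) (π ed ro : ℕ → ℕ) (cm : ℝ) : Prop where
  eq_of_mark : ∀ e < E, row e < n → 1 ≤ ed e → 1 ≤ ro (row e) ∧ e = π (row e)
  mark : ∀ r < n, 1 ≤ ro r → 1 ≤ ed (π r)
  small : ∀ r < n, ro r = 0 → cost (π r) ≤ cm ∧ ed (π r) = 0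

theorem IsTop.guessed (hnN : n ≤ N) (hM : Marks E N g row cost τ ed ro cm) (hg : g = n ∨ 0 < g)
    (hπ : IsAssignment n E row col weight B π) (ht : IsTop n g cost π τ) :
    Guessed n E row cost π ed ro cm ∧ (g = n → ∀ r < n, 1 ≤ ro r) := by
  obtain ⟨σ, hσ, hσi, htop⟩ := ht
  have hguess : ∀ r < n, 1 ≤ ro r ↔ ∃ i < g, σ i = r := fun r hr => by
    rw [hM.row r (hr.trans_le hnN)]
    refine ⟨fun ⟨i, hi, h1⟩ => ⟨i, hi, ?_⟩, fun ⟨i, hi, h1⟩ => ⟨i, hi, ?_⟩⟩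
    · rw [(hσ i hi).2, hπ.row_eq _ (hσ i hi).1] at h1; exact h1
    · rw [(hσ i hi).2, hπ.row_eq _ (hσ i hi).1, h1]
  have hed : ∀ e < E, row e < n → 1 ≤ ed e → 1 ≤ ro (row e) ∧ e = π (row e) := fun e he hr h1 => by
    obtain ⟨i, hi, h2⟩ := (hM.edge _ he).1 h1
    have h3 : σ i = row e := by
      rw [← hπ.row_eq _ (hσ i hi).1, ← (hσ i hi).2, h2]
    exact ⟨(hguess _ hr).2 ⟨i, hi, h3⟩, by rw [← h3, ← (hσ i hi).2, h2]⟩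
  refine ⟨⟨hed, fun r hr h1 => ?_, fun r hr h1 => ⟨?_, ?_⟩⟩, ?_⟩
  · obtain ⟨i, hi, h2⟩ := (hguess r hr).1 h1
    exact (hM.edge _ (hπ.lt r hr)).2 ⟨i, hi, by rw [(hσ i hi).2, h2]⟩
  · rcases htop r hr with ⟨i, hi, h2⟩ | h2
    · have := (hguess r hr).2 ⟨i, hi, h2⟩
      omega
    · obtain ⟨i, hi, h3⟩ := hM.eq (by omega)
      rw [h3]; exact h2 i hi
  · by_contra h2
    have := (hed (π r) (hπ.lt r hr) (by rwa [hπ.row_eq r hr]) (by omega)).1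
    rw [hπ.row_eq r hr] at this
    omega
  · rintro rfl r hr
    rw [hguess r hr]
    -- If all `n` edges are guessed, the injective `σ` is onto, so every row is marked.
    obtain ⟨i, hi, h1⟩ := Finset.surj_on_of_inj_on_of_card_le (s := range g) (t := range g)
      (fun i _ => σ i) (fun i hi => mem_range.2 (hσ i (mem_range.1 hi)).1)
      (fun i j hi hj h2 => hσi i (mem_range.1 hi) j (mem_range.1 hj) h2) le_rfl r (mem_range.2 hr)
    exact ⟨i, mem_range.1 hi, h1.symm⟩

/-- A right guess permits the assignment that was guessed. -/
theorem Guessed.total_le (hG : Guessed n E row cost π ed ro cm) (hn : Network n E N m row col)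
    (hπ : IsAssignment n E row col weight B π) {M : ℕ → ℕ} (hMm : IsMatching N m row col M)
    (hMπ : ∀ r < n, M r = π r) (hME : ∀ r < N, n ≤ r → E ≤ M r) :
    total N (guessWeight n E row cost weight B ed ro cm) M ≤ B := by
  refine le_of_eq_of_le ?_ hπ.weight_le
  rw [total, ← sum_range_add_sum_Ico _ hn.n_le, sum_eq_zero (s := Ico n N) ?_, add_zero]
  · refine sum_congr rfl fun r hr => ?_
    have hr' := mem_range.1 hr
    rw [hMπ r hr', guessWeight, if_neg (not_le.2 (hπ.lt r hr')), hπ.row_eq r hr']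
    by_cases h1 : 1 ≤ ro r
    · rw [if_pos (hG.mark r hr' h1)]
    · have h2 := hG.small r hr' (by omega)
      rw [if_neg (by omega), if_pos ⟨by omega, h2.1⟩]
  · intro r hr
    rw [mem_Ico] at hr
    rw [guessWeight, if_pos (hME r hr.2 hr.1), hMm.row_eq r hr.2, if_pos hr.1]

/-- If the guess is right, the solution is nearly optimal. -/
theorem cost_le_of_isTop (hn : Network n E N m row col) (hE : E ≤ m) (hB : 0 ≤ B)
    (hw : ∀ e, 0 ≤ weight e) (hc : ∀ e, 0 ≤ cost e) (hM : Marks E N g row cost τ ed ro cm)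
    (hg : g ≤ n) (hε : 0 ≤ ε) (hq : g = n ∨ (0 < n ∧ 0 < g ∧ 1 + 1 / (n : ℝ) ≤ ε * g))
    (hx : IsSolution N m row col (fun e => (⌊guessCost E row cost ed ro cm (cm / (n * n)) e⌋₊ : ℝ))
      (guessWeight n E row cost weight B ed ro cm) B (n * n : ℕ) x)
    (hπ : IsAssignment n E row col weight B π) (ht : IsTop n g cost π τ) :
    ∑ r ∈ range n, cost (x r) ≤ (1 + ε) * ∑ r ∈ range n, cost (π r) := by
  obtain ⟨hG, hall⟩ := ht.guessed hn.n_le hM (hq.imp id fun h => h.2.1) hπ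
  obtain ⟨σ, hσ, hσi, -⟩ := ht
  obtain ⟨M, hMm, hMπ, hME⟩ := hπ.exists_extension hn hE
  obtain ⟨⟨h, d, hnear⟩, hxB, hopt⟩ := hx
  set δ := cm / (n * n) with hδ
  have hδ0 : 0 ≤ δ := div_nonneg hM.nonneg (by positivity)
  have key := fun r (hr : r < n) => genuine_of_total_le hn hB hw hnear.row_eq hxB hr
  have hrow : ∀ r < n, row (x r) = r := fun r hr => hnear.row_eq r (hr.trans_le hn.n_le)
  have hmark : ∀ r < n, 1 ≤ ed (x r) → 1 ≤ ro r ∧ x r = π r := fun r hr h1 => by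
    have := hG.eq_of_mark _ (key r hr).1 (by rwa [hrow r hr]) h1
    rwa [hrow r hr] at this
  -- In a guessed row every genuine edge but the guessed one is too heavy.
  have hfix : ∀ r < n, 1 ≤ ro r → x r = π r := fun r hr h1 => by
    rcases (key r hr).2.2 with h2 | ⟨h2, _⟩
    · exact (hmark r hr h2).2
    · omega
  rcases hq with rfl | ⟨hn0, hg0, hq⟩
  · rw [sum_congr rfl fun r hr => by rw [hfix r (mem_range.1 hr) (hall rfl r (mem_range.1 hr))]]
    have : 0 ≤ ∑ r ∈ range g, cost (π r) := sum_nonneg fun r _ => hc _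
    nlinarith
  have hMB := hG.total_le hn hπ hMm hMπ hME
  have hopt' := hopt M hMm hMB
  set C : ℕ → ℝ := fun e => (⌊guessCost E row cost ed ro cm δ e⌋₊ : ℝ) with hC
  have hMC : total N C M = ∑ r ∈ range n, C (π r) := by
    rw [total, ← sum_range_add_sum_Ico _ hn.n_le, sum_eq_zero (s := Ico n N) ?_, add_zero]
    · exact sum_congr rfl fun r hr => by rw [hMπ r (mem_range.1 hr)]
    · intro r hr
      rw [mem_Ico] at hr
      simp [hC, guessCost, hME r hr.2 hr.1]
  have hxC : ∑ r ∈ range n, C (x r) ≤ total N C x :=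
    sum_le_sum_of_subset_of_nonneg (range_mono hn.n_le) fun q _ _ => by positivity
  -- Rounding down loses at most one unit `δ` at `x r` and only helps at `π r`.
  have hpt : ∀ r ∈ range n, cost (x r) ≤ cost (π r) + δ * C (x r) - δ * C (π r) + δ := by
    intro r hr
    have hr' := mem_range.1 hr
    by_cases h1 : 1 ≤ ro r
    · rw [hfix r hr' h1]; linarith
    have h0 : ro r = 0 := by omega
    obtain ⟨k1, k2, k3⟩ := key r hr'
    have hxrow := hrow r hr'
    obtain ⟨k4, k5⟩ : cost (x r) ≤ cm ∧ ed (x r) = 0 := by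
      rcases k3 with k3 | ⟨_, k3⟩
      · exact absurd (hmark r hr' k3).1 h1
      · exact k3
    obtain ⟨k6, k7⟩ := hG.small r hr' h0
    have e1 : C (x r) = (⌊cost (x r) / δ⌋₊ : ℝ) := by
      simp only [hC, guessCost, if_neg (not_le.2 k1), k5, hxrow, h0, k4, true_and, if_true]
      norm_num
    have e2 : C (π r) = (⌊cost (π r) / δ⌋₊ : ℝ) := by
      simp only [hC, guessCost, if_neg (not_le.2 (hπ.lt r hr')), k7, hπ.row_eq r hr', h0, k6, true_and,
        if_true]
      norm_num
    have e3 : cost (x r) ≤ δ * C (x r) + δ := by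
      -- For `δ = 0` the rounded costs carry no information, but then `cm = 0` and the edge is free.
      rcases hδ0.eq_or_lt with h3 | h3
      · have hcm : cm = 0 := by
          have hn' : (0 : ℝ) < n * n := by positivity
          rcases div_eq_zero_iff.1 (hδ.symm.trans h3.symm) with h4 | h4
          · exact h4
          · exact absurd h4 hn'.ne'
        rw [← h3]; linarith
      · rw [e1]
        have := (Nat.lt_floor_add_one (cost (x r) / δ)).le
        rw [div_le_iff₀ h3] at this
        linarith
    have e4 : δ * C (π r) ≤ cost (π r) := by
      rcases hδ0.eq_or_lt with h3 | h3
      · rw [← h3, zero_mul]; exact hc _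
      · rw [e2]
        have := Nat.floor_le (div_nonneg (hc (π r)) h3.le)
        rw [le_div_iff₀ h3] at this
        linarith
    linarith
  have hsum := sum_le_sum hpt
  rw [sum_add_distrib, sum_sub_distrib, sum_add_distrib, ← mul_sum, ← mul_sum, sum_const, card_range,
    nsmul_eq_mul] at hsum
  have hn' : (0 : ℝ) < n := by exact_mod_cast hn0
  have e5 : δ * (n * n) = cm := by rw [hδ]; field_simp
  have e6 : (n : ℝ) * δ = cm * (1 / n) := by rw [hδ]; field_simp
  -- The additive error `n²` of the solver amounts to `n² δ = cm` in true cost (`e5`), the rounding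
  -- to `n δ = cm / n` (`e6`).
  have e7 : δ * ∑ r ∈ range n, C (x r) ≤ δ * (∑ r ∈ range n, C (π r) + n * n) := by
    refine mul_le_mul_of_nonneg_left ?_ hδ0
    push_cast at hopt'
    linarith
  -- The guessed edges are `g` distinct edges of the assignment, each of cost at least `cm`.
  have e8 : g * cm ≤ ∑ r ∈ range n, cost (π r) := by
    have h1 : ∑ i ∈ range g, cost (π (σ i)) = ∑ r ∈ (range g).image σ, cost (π r) :=
      (sum_image (s := range g) (f := fun r => cost (π r)) fun i hi j hj h2 =>
        hσi i (by simpa using hi) j (by simpa using hj) h2).symm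
    have h2 : ∑ r ∈ (range g).image σ, cost (π r) ≤ ∑ r ∈ range n, cost (π r) :=
      sum_le_sum_of_subset_of_nonneg (fun r hr => by
        obtain ⟨i, hi, rfl⟩ := mem_image.1 hr
        exact mem_range.2 (hσ i (mem_range.1 hi)).1) fun q _ _ => hc _
    have h3 : ∑ i ∈ range g, cm ≤ ∑ i ∈ range g, cost (π (σ i)) := sum_le_sum fun i hi => by
      have := hM.le i (mem_range.1 hi)
      rwa [(hσ i (mem_range.1 hi)).2] at this
    simp only [sum_const, card_range, nsmul_eq_mul] at h3
    linarith
  have e9 : cm * (1 + 1 / n) ≤ ε * ∑ r ∈ range n, cost (π r) :=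
    (mul_le_mul_of_nonneg_left hq hM.nonneg).trans
      (by nlinarith [mul_le_mul_of_nonneg_left e8 hε])
  nlinarith

end

/-! ### The program around the solver: network, guesses, rounding and bookkeeping -/

section

def numUAVs : NExp := .get aIn (.const 0)

def numEdges : NExp := .get aIn (.const 3)

variable {n E N m g Z : ℕ} {row col : ℕ → ℕ} {cost weight : ℕ → ℝ} {B ε : ℝ} {s s' : State}

/-- What the memory holds throughout the enumeration of the guesses. -/
structure Env (n E N m g : ℕ) (row col : ℕ → ℕ) (cost weight : ℕ → ℝ) (B : ℝ) (s : State) : Prop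
    extends Holds N m row col s where
  uavs : s.nat aIn 0 = n
  genuine : s.nat aIn 3 = E
  guesses : s.nat aG 0 = g
  bound : s.real rIn 1 = B
  cost : s.real rCost = cost
  weight : s.real rWeight = weight
  uavs_real : s.real rN 0 = n

theorem Env.frame {p : Prog} (h : Env n E N m g row col cost weight B s) (hf : Frame p s s')
    (hc : [aN, aM, aOff, aRow, aCol].all (fun a => !p.writesNat a) = true := by rfl)
    (hc' : [aIn, aG].all (fun a => !p.writesNat a) = true := by rfl)
    (hr : [rIn, rCost, rWeight, rN].all (fun a => !p.writesReal a) = true := by rfl) :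
    Env n E N m g row col cost weight B s' := by
  simp only [List.all_cons, List.all_nil, Bool.and_eq_true, Bool.not_eq_true'] at hc' hr
  obtain ⟨h1, h2, _⟩ := hc'
  obtain ⟨g1, g2, g3, g4, _⟩ := hr
  exact ⟨h.toHolds.frame hf hc, by rw [hf.nat _ h1, h.uavs], by rw [hf.nat _ h1, h.genuine],
    by rw [hf.nat _ h2, h.guesses], by rw [hf.real _ g1, h.bound], by rw [hf.real _ g2, h.cost],
    by rw [hf.real _ g3, h.weight], by rw [hf.real _ g4, h.uavs_real]⟩

/-! #### Setting up the network -/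

/-- Build the network: the genuine edges, followed by one edge for every row and column. -/
def buildNetwork : Prog :=
  .seq (.seq (.letN aN (.add numUAVs (.get aIn (.const 2)))) (.letN aPtr (.const 0)))
    (.seq (.forTo cI numEdges (.seq (.setNat aRow (nv cI) (.get aOwner (.get aSrc (nv cI))))
        (.setNat aCol (nv cI) (.get aDst (nv cI)))))
      (.seq (.forTo cK (nv aN) (.seq (.setNat aOff (nv cK) (nv aPtr))
        (.forTo cI (nv aN) (.seq (.setNat aRow (.add numEdges (nv aPtr)) (nv cK))
          (.seq (.setNat aCol (.add numEdges (nv aPtr)) (nv cI))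
            (.letN aPtr (.add (nv aPtr) (.const 1))))))))
        (.letN aM (.add numEdges (nv aPtr)))))

def buildTime (Z : ℕ) : ℕ := 2 + (Z * 4 + 2 + (Z * (1 + (Z * 5 + 2) + 2) + 2 + 1))

/-- Natural numbers cannot be multiplied by the machine, so the offsets `r * N` are read off the
running counter `aPtr` and kept in `aOff`. -/
theorem buildNetwork_spec (hN : s.nat aIn 0 + s.nat aIn 2 = N) (hE : s.nat aIn 3 = E)
    (hNZ : N ≤ Z) (hEZ : E ≤ Z) :
    Ensures buildNetwork s (buildTime Z) (fun s' =>
      Holds N (E + N * N) (s'.nat aRow) (s'.nat aCol) s' ∧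
      (∀ e < E, s'.nat aRow e = s.nat aOwner (s.nat aSrc e) ∧ s'.nat aCol e = s.nat aDst e) ∧
      ∀ p < N * N, s'.nat aRow (E + p) = p / N ∧ s'.nat aCol (E + p) = p % N) := by
  have h1 : Ensures (.seq (.letN aN (.add numUAVs (.get aIn (.const 2)))) (.letN aPtr (.const 0))) s 2
      (fun s' => s'.nat aN 0 = N ∧ s'.nat aPtr 0 = 0) :=
    Ensures.straight rfl (by simp [numUAVs, hN])
  refine h1.seq fun s₁ f₁ ⟨i1, i2⟩ => ?_
  have a0 : s₁.nat aIn = s.nat aIn := f₁.nat _ rfl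
  have h2 : Ensures (.forTo cI numEdges (.seq (.setNat aRow (nv cI) (.get aOwner (.get aSrc (nv cI))))
      (.setNat aCol (nv cI) (.get aDst (nv cI))))) s₁ (Z * 4 + 2) (fun s' =>
      ∀ e < E, s'.nat aRow e = s.nat aOwner (s.nat aSrc e) ∧ s'.nat aCol e = s.nat aDst e) := by
    refine Ensures.forTo (n := E) (T := 2) (fun k s' =>
      ∀ e < k, s'.nat aRow e = s.nat aOwner (s.nat aSrc e) ∧ s'.nat aCol e = s.nat aDst e) rfl
      (fun s' hf => ?_) hEZ (by simp) ?_
    · simp [numEdges, hf.nat aIn rfl, a0, hE]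
    · intro k hk s' hf hik hI
      have e1 : s'.nat aOwner = s.nat aOwner := by rw [hf.nat _ rfl, f₁.nat _ rfl]
      have e2 : s'.nat aSrc = s.nat aSrc := by rw [hf.nat _ rfl, f₁.nat _ rfl]
      have e3 : s'.nat aDst = s.nat aDst := by rw [hf.nat _ rfl, f₁.nat _ rfl]
      refine Ensures.straight rfl fun e he => ?_
      by_cases hek : e = k
      · simp [hik, hek, e1, e2, e3]
      · simpa [hik, hek] using hI e (by omega)
  refine h2.seq fun s₂ f₂ i3 => ?_
  have a1 : s₂.nat aIn = s.nat aIn := by rw [f₂.nat _ rfl, a0]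
  have a2 : s₂.nat aN 0 = N := by rw [f₂.nat _ rfl, i1]
  have a3 : s₂.nat aPtr 0 = 0 := by rw [f₂.nat _ rfl, i2]
  have h3 : Ensures (.forTo cK (nv aN) (.seq (.setNat aOff (nv cK) (nv aPtr))
        (.forTo cI (nv aN) (.seq (.setNat aRow (.add numEdges (nv aPtr)) (nv cK))
          (.seq (.setNat aCol (.add numEdges (nv aPtr)) (nv cI))
            (.letN aPtr (.add (nv aPtr) (.const 1)))))))) s₂ (Z * (1 + (Z * 5 + 2) + 2) + 2) (fun s' =>
      s'.nat aPtr 0 = N * N ∧ (∀ r < N, s'.nat aOff r = r * N) ∧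
      (∀ e < E, s'.nat aRow e = s.nat aOwner (s.nat aSrc e) ∧ s'.nat aCol e = s.nat aDst e) ∧
      ∀ p < N * N, s'.nat aRow (E + p) = p / N ∧ s'.nat aCol (E + p) = p % N) := by
    refine Ensures.forTo (n := N) (fun k s' =>
      s'.nat aPtr 0 = k * N ∧ (∀ r < k, s'.nat aOff r = r * N) ∧
      (∀ e < E, s'.nat aRow e = s.nat aOwner (s.nat aSrc e) ∧ s'.nat aCol e = s.nat aDst e) ∧
      ∀ p < k * N, s'.nat aRow (E + p) = p / N ∧ s'.nat aCol (E + p) = p % N) rfl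
      (fun s' hf => ?_) hNZ (by simpa [a3] using i3) ?_
    · simp [hf.nat aN rfl, a2]
    · intro k hk s₃ f₃ hik ⟨j1, j2, j3, j4⟩
      have b1 : s₃.nat aIn = s.nat aIn := by rw [f₃.nat _ rfl, a1]
      have b2 : s₃.nat aN 0 = N := by rw [f₃.nat _ rfl, a2]
      have h4 : Ensures (.setNat aOff (nv cK) (nv aPtr)) s₃ 1 (fun s' =>
          ∀ r < k + 1, s'.nat aOff r = r * N) := by
        refine Ensures.straight rfl fun r hr => ?_
        by_cases hrk : r = k
        · simp [hik, hrk, j1]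
        · simpa [hik, hrk] using j2 r (by omega)
      refine h4.seq fun s₄ f₄ j2' => ?_
      have c1 : s₄.nat aIn = s.nat aIn := by rw [f₄.nat _ rfl, b1]
      have c2 : s₄.nat aN 0 = N := by rw [f₄.nat _ rfl, b2]
      have c3 : s₄.nat cK 0 = k := by rw [f₄.nat _ rfl, hik]
      refine (Ensures.forTo (n := N) (T := 3) (fun i s' => s'.nat aPtr 0 = k * N + i ∧
        (∀ e < E, s'.nat aRow e = s.nat aOwner (s.nat aSrc e) ∧ s'.nat aCol e = s.nat aDst e) ∧
        ∀ p < k * N + i, s'.nat aRow (E + p) = p / N ∧ s'.nat aCol (E + p) = p % N) rfl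
        (fun s' hf => ?_) hNZ ?_ ?_).post ?_
      · simp [hf.nat aN rfl, c2]
      · simpa [f₄.nat aPtr rfl, f₄.nat aRow rfl, f₄.nat aCol rfl, j1] using ⟨j3, j4⟩
      · intro i hi s₅ f₅ hii ⟨l1, l2, l3⟩
        have d1 : s₅.nat aIn 3 = E := by rw [f₅.nat _ rfl, c1, hE]
        have d2 : s₅.nat cK 0 = k := by rw [f₅.nat _ rfl, c3]
        have d3 : (k * N + i) / N = k := by
          rw [mul_comm, Nat.mul_add_div (by omega), Nat.div_eq_of_lt hi, add_zero]
        have d4 : (k * N + i) % N = i := by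
          rw [mul_comm, Nat.mul_add_mod, Nat.mod_eq_of_lt hi]
        refine Ensures.straight rfl ⟨?_, fun e he => ?_, fun p hp => ?_⟩
        · simp [l1, add_assoc]
        · have : e ≠ E + (k * N + i) := by omega
          simpa [numEdges, d1, d2, l1, this] using l2 e he
        · by_cases hpk : p = k * N + i
          · subst hpk
            simp [numEdges, d1, d2, l1, d3, d4, hii]
          · simpa [numEdges, d1, d2, l1, hpk] using l3 p (by omega)
      · intro s₅ f₅ ⟨l1, l2, l3⟩
        have : (k + 1) * N = k * N + N := by ring
        rw [this]
        have e1 : s₅.nat aOff = s₄.nat aOff := f₅.nat _ rfl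
        exact ⟨by simpa using l1, by simpa [e1] using fun r hr => j2' r (by omega), by simpa using l2,
          by simpa using l3⟩
  refine h3.seq fun s₃ f₃ ⟨i1, i4, i5, i6⟩ => ?_
  have a1 : s₃.nat aIn 3 = E := by rw [f₃.nat _ rfl, a1, hE]
  have a2 : s₃.nat aN 0 = N := by rw [f₃.nat _ rfl, a2]
  refine Ensures.straight rfl ⟨⟨?_, ?_, ?_, ?_, ?_⟩, ?_, ?_⟩
  · simpa using a2
  · simp [numEdges, a1, i1]
  · simpa using i4
  · rfl
  · rfl
  · simpa using i5
  · simpa using i6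

/-- Determine the number of edges to be guessed. -/
def countGuesses : Prog :=
  .seq (.seq (.letN aCnt (.const 0)) (.seq (.letR rAcc (.const 0)) (.letR rN (.const 0))))
    (.seq (.forTo cI numUAVs (.seq
      (.cond (.realLT (rv rAcc) (.const 1))
        (.seq (.letN aCnt (.add (nv aCnt) (.const 1)))
          (.letR rAcc (.add (rv rAcc) (.get rIn (.const 0))))) .skip)
      (.letR rN (.add (rv rN) (.const 1)))))
      (.cond (.natLE (.add (nv aCnt) (.const 1)) numUAVs) (.letN aG (.add (nv aCnt) (.const 1)))
        (.letN aG numUAVs)))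

/-- Rounding up `1 / ε` is not an operation of the machine; instead `ε` is added up until the sum
reaches `1`, at most `n` times. The same loop produces `n` as a real number. -/
theorem countGuesses_spec (hn : s.nat aIn 0 = n) (hε : s.real rIn 0 = ε) (hε0 : 0 < ε) (hnZ : n ≤ Z) :
    Ensures countGuesses s (3 + (Z * 7 + 2 + 3)) (fun s' => s'.real rN 0 = n ∧ s'.nat aG 0 ≤ n ∧
      s'.nat aG 0 ≤ ⌈1 / ε⌉₊ + 1 ∧
      (s'.nat aG 0 = n ∨ (0 < n ∧ 0 < s'.nat aG 0 ∧ 1 + 1 / (n : ℝ) ≤ ε * s'.nat aG 0))) := by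
  have h1 : Ensures (.seq (.letN aCnt (.const 0)) (.seq (.letR rAcc (.const 0)) (.letR rN (.const 0))))
      s 3 (fun s' => s'.nat aCnt 0 = 0 ∧ s'.real rAcc 0 = 0 ∧ s'.real rN 0 = 0) :=
    Ensures.straight rfl (by simp)
  refine h1.seq fun s₁ f₁ ⟨i1, i2, i3⟩ => ?_
  have a1 : s₁.nat aIn 0 = n := by rw [f₁.nat _ rfl, hn]
  have a2 : s₁.real rIn 0 = ε := by rw [f₁.real _ rfl, hε]
  have h2 : Ensures (.forTo cI numUAVs (.seq
      (.cond (.realLT (rv rAcc) (.const 1))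
        (.seq (.letN aCnt (.add (nv aCnt) (.const 1)))
          (.letR rAcc (.add (rv rAcc) (.get rIn (.const 0))))) .skip)
      (.letR rN (.add (rv rN) (.const 1))))) s₁ (Z * 7 + 2) (fun s' => s'.real rN 0 = n ∧
      s'.real rAcc 0 = s'.nat aCnt 0 * ε ∧ s'.nat aCnt 0 ≤ n ∧
      (s'.real rAcc 0 < 1 → s'.nat aCnt 0 = n) ∧
      (s'.nat aCnt 0 = 0 ∨ ((s'.nat aCnt 0 : ℝ) - 1) * ε < 1)) := by
    refine Ensures.forTo (n := n) (T := 5) (fun k s' => s'.real rN 0 = k ∧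
      s'.real rAcc 0 = s'.nat aCnt 0 * ε ∧ s'.nat aCnt 0 ≤ k ∧
      (s'.real rAcc 0 < 1 → s'.nat aCnt 0 = k) ∧
      (s'.nat aCnt 0 = 0 ∨ ((s'.nat aCnt 0 : ℝ) - 1) * ε < 1)) rfl (fun s' hf => ?_) hnZ ?_ ?_
    · simp [numUAVs, hf.nat aIn rfl, a1]
    · simp [i1, i2, i3]
    · intro k hk s' hf hik ⟨j1, j2, j3, j4, j5⟩
      have e1 : s'.real rIn 0 = ε := by rw [hf.real _ rfl, a2]
      refine Ensures.straight rfl ?_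
      by_cases hlt : s'.real rAcc 0 < 1
      · have hlt' := hlt
        rw [j2] at hlt'
        have j6 := j4 hlt
        rw [j6] at hlt'
        simp [j1, j2, j6, e1, hlt']
        ring
      · simp [hlt, j1]
        exact ⟨j2, by omega, j5⟩
  refine h2.seq fun s₂ f₂ ⟨j1, j2, j3, j4, j5⟩ => ?_
  have b1 : s₂.nat aIn 0 = n := by rw [f₂.nat _ rfl, a1]
  have b2 : s₂.nat aCnt 0 ≤ ⌈1 / ε⌉₊ := by
    rcases j5 with h | h
    · omega
    · rw [← lt_div_iff₀ hε0] at h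
      have h4 := h.trans_le (Nat.le_ceil (1 / ε))
      have h5 : (s₂.nat aCnt 0 : ℝ) < (⌈1 / ε⌉₊ + 1 : ℕ) := by push_cast; linarith
      exact Nat.lt_succ_iff.1 (by exact_mod_cast h5)
  refine Ensures.straight rfl ?_
  by_cases hc : s₂.nat aCnt 0 + 1 ≤ n
  · have h6 : (1 : ℝ) ≤ s₂.nat aCnt 0 * ε := by
      by_contra h7
      have := j4 (by rw [j2]; linarith)
      omega
    have hn0 : (0 : ℝ) < n := by
      have : 0 < n := by omega
      exact_mod_cast this
    have h8 : ((s₂.nat aCnt 0 : ℕ) : ℝ) ≤ n := by exact_mod_cast j3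
    -- The count times `ε` is at least `1` and the count is at most `n`. One more guessed edge thus
    -- pays for the summand `1 / n`.
    have h9 : 1 / (n : ℝ) ≤ ε := by
      rw [div_le_iff₀ hn0]
      nlinarith
    simp only [Prog.exec, BExp.Holds, NExp.eval, numUAVs, b1, if_pos hc, State.updNat_nat,
      State.updNat_real, if_true, Function.update_self, j1, true_and]
    refine ⟨hc, by omega, Or.inr ⟨by omega, by omega, ?_⟩⟩
    push_cast
    linarith
  · simp only [Prog.exec, BExp.Holds, NExp.eval, numUAVs, b1, if_neg hc, State.updNat_nat,
      State.updNat_real, if_true, Function.update_self, j1, true_and, true_or, and_true, le_refl]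
    omega

/-! #### Processing a guess -/

def clearMarks : Prog :=
  .seq (.forTo cI (nv aN) (.setNat aRo (nv cI) (.const 0)))
    (.forTo cI numEdges (.setNat aEd (nv cI) (.const 0)))

/-- Mark the guessed edges and their rows, and find the least cost of a guessed edge. -/
def setMarks : Prog :=
  .seq (.letR rCm (.get rCost (.get aTup (.const 0)))) (.forTo cI (nv aG)
    (.seq (.setNat aEd (.get aTup (nv cI)) (.const 1))
      (.seq (.setNat aRo (.get aRow (.get aTup (nv cI))) (.const 1))
        (.cond (.realLT (.get rCost (.get aTup (nv cI))) (rv rCm))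
          (.letR rCm (.get rCost (.get aTup (nv cI)))) .skip))))

def markGuess : Prog := .seq clearMarks setMarks

/-- The minimum starts with the cost of the edge in cell `0`, before that cell is scanned; hence the
separate case in the invariant, which disappears once `g > 0`. -/
theorem markGuess_spec (h : Env n E N m g row col cost weight B s) (hN : N ≤ Z) (hE : E ≤ Z)
    (hg : g ≤ Z) (hc : ∀ e, 0 ≤ cost e) :
    Ensures markGuess s (Z * 3 + 2 + (Z * 3 + 2) + (1 + (Z * 7 + 2))) (fun s' =>
      Marks E N g row cost (s.nat aTup) (s'.nat aEd) (s'.nat aRo) (s'.real rCm 0)) := by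
  have h1 : Ensures clearMarks s (Z * 3 + 2 + (Z * 3 + 2)) (fun s' => (∀ r < N, s'.nat aRo r = 0) ∧
      ∀ e < E, s'.nat aEd e = 0) := by
    refine (Ensures.fillNat (n := N) (fun _ => 0) (by decide) (fun s' hf => ?_) hN
      (fun _ _ _ _ _ _ => rfl)).seq fun s₁ f₁ i1 => ?_
    · simp [hf.nat aN rfl, h.rows]
    refine (Ensures.fillNat (n := E) (fun _ => 0) (by decide) (fun s' hf => ?_) hE
      (fun _ _ _ _ _ _ => rfl)).post fun s₂ f₂ i2 => ?_
    · simp [numEdges, hf.nat aIn rfl, f₁.nat aIn rfl, h.genuine]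
    refine ⟨fun r hr => ?_, fun e he => ?_⟩
    · rw [f₂.nat aRo rfl, i1]; simp [hr]
    · rw [i2]; simp [he]
  refine h1.seq fun s₁ f₁ ⟨i1, i2⟩ => ?_
  have hh := h.frame f₁
  have h2 : Ensures (.letR rCm (.get rCost (.get aTup (.const 0)))) s₁ 1 (fun s' =>
      s'.real rCm 0 = cost (s.nat aTup 0)) :=
    Ensures.straight rfl (by simp [hh.cost, f₁.nat aTup rfl])
  refine h2.seq fun s₂ f₂ i3 => ?_
  have hh2 := hh.frame f₂
  refine (Ensures.forTo (n := g) (T := 5) (fun k s' =>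
    (∀ e < E, 1 ≤ s'.nat aEd e ↔ ∃ i < k, s.nat aTup i = e) ∧
    (∀ r < N, 1 ≤ s'.nat aRo r ↔ ∃ i < k, row (s.nat aTup i) = r) ∧
    (∀ i < k, s'.real rCm 0 ≤ cost (s.nat aTup i)) ∧
    (s'.real rCm 0 = cost (s.nat aTup 0) ∨ ∃ i < k, s'.real rCm 0 = cost (s.nat aTup i))) rfl
    (fun s' hf => ?_) hg ⟨fun e he => ?_, fun r hr => ?_, by simp, Or.inl (by simpa using i3)⟩
    ?_).post ?_
  · simp [hf.nat aG rfl, hh2.guesses]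
  · simp [f₂.nat aEd rfl, i2 e he]
  · simp [f₂.nat aRo rfl, i1 r hr]
  · intro k hk s' hf hik ⟨j1, j2, j3, j4⟩
    have e1 : s'.nat aTup = s.nat aTup := by rw [hf.nat _ rfl, f₂.nat _ rfl, f₁.nat _ rfl]
    have e2 : s'.nat aRow = row := by rw [hf.nat _ rfl, hh2.row]
    have e3 : s'.real rCost = cost := by rw [hf.real _ rfl, hh2.cost]
    refine Ensures.straight rfl ⟨fun e he => ?_, fun r hr => ?_, ?_⟩
    · have : (∃ i < k + 1, s.nat aTup i = e) ↔ (e = s.nat aTup k ∨ ∃ i < k, s.nat aTup i = e) := by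
        constructor
        · rintro ⟨i, hi, h3⟩
          rcases Nat.lt_succ_iff_lt_or_eq.1 hi with hi' | rfl
          · exact Or.inr ⟨i, hi', h3⟩
          · exact Or.inl h3.symm
        · rintro (h3 | ⟨i, hi, h3⟩)
          · exact ⟨k, by omega, h3.symm⟩
          · exact ⟨i, by omega, h3⟩
      rw [this, ← j1 e he]
      by_cases hek : e = s.nat aTup k <;> by_cases hlt : cost (s.nat aTup k) < s'.real rCm 0 <;>
        simp [hik, e1, e2, e3, hek, hlt]
    · have : (∃ i < k + 1, row (s.nat aTup i) = r) ↔
          (r = row (s.nat aTup k) ∨ ∃ i < k, row (s.nat aTup i) = r) := by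
        constructor
        · rintro ⟨i, hi, h3⟩
          rcases Nat.lt_succ_iff_lt_or_eq.1 hi with hi' | rfl
          · exact Or.inr ⟨i, hi', h3⟩
          · exact Or.inl h3.symm
        · rintro (h3 | ⟨i, hi, h3⟩)
          · exact ⟨k, by omega, h3.symm⟩
          · exact ⟨i, by omega, h3⟩
      rw [this, ← j2 r hr]
      by_cases hek : r = row (s.nat aTup k) <;> by_cases hlt : cost (s.nat aTup k) < s'.real rCm 0 <;>
        simp [hik, e1, e2, e3, hek, hlt]
    · by_cases hlt : cost (s.nat aTup k) < s'.real rCm 0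
      · simp [hik, e1, e2, e3, hlt]
        refine ⟨fun i hi => ?_, Or.inr ⟨k, by omega, rfl⟩⟩
        rcases Nat.lt_or_eq_of_le hi with hi' | rfl
        · exact hlt.le.trans (j3 i hi')
        · exact le_rfl
      · simp [hik, e1, e2, e3, hlt]
        refine ⟨fun i hi => ?_, ?_⟩
        · rcases Nat.lt_or_eq_of_le hi with hi' | rfl
          · exact j3 i hi'
          · exact not_lt.1 hlt
        · rcases j4 with h3 | ⟨i, hi, h3⟩
          · exact Or.inl h3
          · exact Or.inr ⟨i, by omega, h3⟩
  · intro s₃ f₃ ⟨j1, j2, j3, j4⟩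
    refine ⟨j1, j2, j3, fun hg0 => ?_, ?_⟩
    · rcases j4 with h3 | h3
      · exact ⟨0, hg0, h3⟩
      · exact h3
    · rcases j4 with h3 | ⟨i, _, h3⟩ <;> rw [h3] <;> exact hc _

/-- Set the weight of the edge `i`, and its cost before rounding. -/
def weighEdge : Prog :=
  .seq (.seq (.letR rT (.const 0)) (.letR rQ (.const 0)))
    (.seq (.setReal rW (nv cI) (.add (.get rIn (.const 1)) (.const 1)))
      (.cond (.natLE numEdges (nv cI))
        (.cond (.natLE numUAVs (.get aRow (nv cI))) (.setReal rW (nv cI) (.const 0)) .skip)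
        (.cond (.natLE (.const 1) (.get aEd (nv cI)))
          (.setReal rW (nv cI) (.get rWeight (nv cI)))
          (.cond (.and (.natLE (.get aRo (.get aRow (nv cI))) (.const 0))
              (.realLE (.get rCost (nv cI)) (rv rCm)))
            (.seq (.setReal rW (nv cI) (.get rWeight (nv cI)))
              (.letR rT (.div (.get rCost (nv cI)) (rv rDel)))) .skip))))

/-- Set the weight and the rounded cost of every edge. -/
def weighEdges : Prog :=
  .seq (.letR rDel (.div (rv rCm) (.mul (rv rN) (rv rN))))
    (.forTo cI (nv aM) (.seq weighEdge (.seq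
      (.loop (.realLE (.add (rv rQ) (.const 1)) (rv rT)) (.letR rQ (.add (rv rQ) (.const 1))))
      (.setReal rC (nv cI) (rv rQ)))))

/-- Rounding down by counting. -/
theorem floor_spec {x : ℝ} (hx0 : 0 ≤ x) (hx : s.real rT 0 = x) (hq : s.real rQ 0 = 0) (hxZ : x ≤ Z) :
    Ensures (.loop (.realLE (.add (rv rQ) (.const 1)) (rv rT)) (.letR rQ (.add (rv rQ) (.const 1)))) s
      (Z * (1 + 1) + 1) (fun s' => s'.real rQ 0 = ⌊x⌋₊) := by
  refine (Ensures.loop (T := 1) (fun K s' => ∃ q : ℕ, s'.real rQ 0 = q ∧ (q : ℝ) ≤ x ∧ q + K = Z) Z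
    ⟨0, by simpa using hq, by simpa using hx0, by simp⟩ ?_).post ?_
  · rintro K s' hf ⟨q, h1, h2, h3⟩ hb
    have e1 : s'.real rT 0 = x := by rw [hf.real _ rfl, hx]
    simp [e1, h1] at hb
    have : q + 1 ≤ Z := by
      have h4 : ((q + 1 : ℕ) : ℝ) ≤ Z := by push_cast; linarith
      exact_mod_cast h4
    exact Ensures.straight rfl ⟨K - 1, by omega, q + 1, by simp [h1], by push_cast; linarith, by omega⟩
  · rintro s' hf ⟨⟨K, q, h1, h2, -⟩, hb⟩
    have e1 : s'.real rT 0 = x := by rw [hf.real _ rfl, hx]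
    simp [e1, h1] at hb
    rw [h1, eq_comm]
    congr 1
    rw [Nat.floor_eq_iff hx0]
    exact ⟨h2, hb⟩

theorem weighEdge_spec {k : ℕ} {w₀ : ℕ → ℝ} {cm δ : ℝ} {ed ro : ℕ → ℕ}
    (h : Env n E N m g row col cost weight B s)
    (hk : s.nat cI 0 = k) (hed : s.nat aEd = ed) (hro : s.nat aRo = ro)
    (hcm : s.real rCm 0 = cm) (hδ : s.real rDel 0 = δ) (hw : s.real rW = w₀) :
    Ensures weighEdge s 13 (fun s' => s'.real rQ 0 = 0 ∧
      s'.real rT 0 = guessCost E row cost ed ro cm δ k ∧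
      s'.real rW = Function.update w₀ k (guessWeight n E row cost weight B ed ro cm k)) := by
  refine Ensures.straight rfl ?_
  have e1 := h.row
  have e2 := h.uavs
  have e3 := h.genuine
  have e4 := h.bound
  have e5 := h.cost
  have e6 := h.weight
  unfold guessCost guessWeight
  by_cases g1 : E ≤ k
  · by_cases g2 : n ≤ row k <;>
      simp [weighEdge, numEdges, numUAVs, e1, e2, e3, e4, hk, g1, g2, hw]
  · by_cases g2 : 1 ≤ ed k
    · simp [weighEdge, numEdges, numUAVs, e3, e4, e6, hk, g1, g2, hw, hed]
    · by_cases g3 : ro (row k) = 0 ∧ cost k ≤ cm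
      · simp [weighEdge, numEdges, numUAVs, e1, e3, e4, e5, e6, hk, g1, g2, g3.1, g3.2, hw, hed, hro,
          hcm, hδ]
      · have g3' : ro (row k) = 0 → ¬ cost k ≤ cm := fun a b => g3 ⟨a, b⟩
        by_cases g4 : ro (row k) = 0
        · have g5 := g3' g4
          simp [weighEdge, numEdges, numUAVs, e1, e3, e4, e5, hk, g1, g2, g4, g5, hw, hed, hro, hcm]
        · simp [weighEdge, numEdges, numUAVs, e1, e3, e4, hk, g1, g2, g4, hw, hed, hro]

theorem weighEdges_spec {cm : ℝ} {ed ro : ℕ → ℕ}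
    (h : Env n E N m g row col cost weight B s) (hm : m ≤ Z) (hnZ : n * n ≤ Z)
    (hed : s.nat aEd = ed) (hro : s.nat aRo = ro) (hcm : s.real rCm 0 = cm) (hcm0 : 0 ≤ cm)
    (hc : ∀ e, 0 ≤ cost e) :
    Ensures weighEdges s (1 + (Z * (13 + (Z * 2 + 1 + 1) + 2) + 2)) (fun s' => ∀ e < m,
      s'.real rW e = guessWeight n E row cost weight B ed ro cm e ∧
      s'.real rC e = (⌊guessCost E row cost ed ro cm (cm / (n * n)) e⌋₊ : ℝ)) := by
  have h1 : Ensures (.letR rDel (.div (rv rCm) (.mul (rv rN) (rv rN)))) s 1 (fun s' =>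
      s'.real rDel 0 = cm / (n * n)) :=
    Ensures.straight rfl (by simp [hcm, h.uavs_real])
  refine h1.seq fun s₁ f₁ i1 => ?_
  have hh := h.frame f₁
  refine Ensures.forTo (n := m) (fun k s' => ∀ e < k,
      s'.real rW e = guessWeight n E row cost weight B ed ro cm e ∧
      s'.real rC e = (⌊guessCost E row cost ed ro cm (cm / (n * n)) e⌋₊ : ℝ)) rfl
    (fun s' hf => ?_) hm (by simp) ?_
  · simp [hf.nat aM rfl, hh.edges]
  · intro k hk s₂ f₂ hik hI
    have hh2 := hh.frame f₂
    refine (weighEdge_spec (ed := ed) (ro := ro) (cm := cm) (δ := cm / (n * n)) hh2 hik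
      (by rw [f₂.nat _ rfl, f₁.nat _ rfl, hed])
      (by rw [f₂.nat _ rfl, f₁.nat _ rfl, hro]) (by rw [f₂.real _ rfl, f₁.real _ rfl, hcm])
      (by rw [f₂.real _ rfl, i1]) rfl).seq fun s₃ f₃ ⟨j1, j2, j3⟩ => ?_
    have hle : guessCost E row cost ed ro cm (cm / (n * n)) k ≤ Z :=
      (guessCost_le hcm0 k).trans (by exact_mod_cast hnZ)
    have hge : 0 ≤ guessCost E row cost ed ro cm (cm / (n * n)) k := by
      have := hc k
      unfold guessCost
      split_ifs <;> positivity
    refine (floor_spec hge j2 j1 hle).seq fun s₄ f₄ l1 => ?_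
    have e1 : s₄.nat cI 0 = k := by rw [f₄.nat _ rfl, f₃.nat _ rfl, hik]
    have e2 : s₄.real rW = s₃.real rW := f₄.real _ rfl
    have e3 : s₄.real rC = s₂.real rC := by rw [f₄.real _ rfl, f₃.real _ rfl]
    refine Ensures.straight rfl fun e he => ?_
    by_cases hek : e = k
    · simp [e1, e2, j3, hek, l1]
    · simpa [e1, e2, e3, j3, hek] using hI e (by omega)

/-- Keep the solution if it is the first one or the best one so far. -/
def record : Prog :=
  .cond (.natLE (.const 1) (nv aOk))
    (.seq (.seq (.letR rCur (.const 0)) (.forTo cI numUAVs (.letR rCur (.add (rv rCur)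
        (.get rCost (.get aY (nv cI)))))))
      (.cond (.or (.natLE (nv aHave) (.const 0)) (.realLT (rv rCur) (rv rBest)))
        (.seq (.forTo cI numEdges (.setNat aOut (nv cI) (.const 0)))
          (.seq (.forTo cI numUAVs (.setNat aOut (.get aY (nv cI)) (.const 1)))
            (.seq (.letN aHave (.const 1)) (.letR rBest (rv rCur)))))
        .skip))
    .skip

open Classical in
/-- The output array describes the choice `x`, whose cost is stored as the best one. -/
structure Recorded (n E : ℕ) (cost : ℕ → ℝ) (x : ℕ → ℕ) (s : State) : Prop where
  have_pos : 1 ≤ s.nat aHave 0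
  out : ∀ e < E, s.nat aOut e = if ∃ r < n, x r = e then 1 else 0
  best : s.real rBest 0 = ∑ r ∈ range n, cost (x r)

theorem record_spec (h : Env n E N m g row col cost weight B s) (hE : E ≤ Z) (hnZ : n ≤ Z) :
    Ensures record s (Z * 3 + 3 + (Z * 3 + 2 + (Z * 3 + 2 + 2) + 1) + 1) (fun s' =>
      (1 ≤ s.nat aOk 0 ∧ Recorded n E cost (s.nat aY) s' ∧
        (1 ≤ s.nat aHave 0 → s'.real rBest 0 ≤ s.real rBest 0)) ∨
      (s'.nat aHave = s.nat aHave ∧ s'.nat aOut = s.nat aOut ∧ s'.real rBest = s.real rBest ∧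
        (1 ≤ s.nat aOk 0 → 1 ≤ s.nat aHave 0 ∧
          s.real rBest 0 ≤ ∑ r ∈ range n, cost (s.nat aY r)))) := by
  refine Ensures.cond (fun hok => ?_) (fun hok => ?_)
  swap
  · simp at hok
    exact (Ensures.straight (c := .skip) rfl (Or.inr ⟨rfl, rfl, rfl, fun h => by omega⟩)).mono
      (show 1 ≤ _ by omega) (fun _ _ h => h)
  have hok' : 1 ≤ s.nat aOk 0 := by simpa using hok
  refine (Ensures.sumReal (n := n) (fun r => cost (s.nat aY r)) (fun s' hf => ?_) hnZ
    (fun k hk s' hf hik => ?_)).seq fun s₁ f₁ i1 => ?_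
  · simp [numUAVs, hf.nat aIn rfl, h.uavs]
  · simp [hf.real rCost rfl, h.cost, hf.nat aY rfl, hik]
  have hh := h.frame f₁
  have e1 : s₁.nat aHave = s.nat aHave := f₁.nat _ rfl
  have e2 : s₁.real rBest = s.real rBest := f₁.real _ rfl
  have e3 : s₁.nat aY = s.nat aY := f₁.nat _ rfl
  refine Ensures.cond (fun hc => ?_) (fun hc => ?_)
  swap
  · simp [e1, e2, i1] at hc
    refine (Ensures.straight (c := .skip) rfl ?_).mono (show 1 ≤ _ by omega) (fun _ _ h => h)
    exact Or.inr ⟨e1, f₁.nat _ rfl, e2, fun _ => ⟨by omega, hc.2⟩⟩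
  have hc' : 1 ≤ s.nat aHave 0 → ∑ r ∈ range n, cost (s.nat aY r) ≤ s.real rBest 0 := by
    intro h1
    simp [e1, e2, i1] at hc
    exact (hc (by omega)).le
  refine (Ensures.fillNat (n := E) (fun _ => 0) (by decide) (fun s' hf => ?_) hE
    (fun _ _ _ _ _ _ => rfl)).seq fun s₂ f₂ i2 => ?_
  · simp [numEdges, hf.nat aIn rfl, hh.genuine]
  have hh2 := hh.frame f₂
  have g3 : s₂.nat aY = s.nat aY := by rw [f₂.nat _ rfl, e3]
  classical
  have h3 : Ensures (.forTo cI numUAVs (.setNat aOut (.get aY (nv cI)) (.const 1))) s₂ (Z * 3 + 2)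
      (fun s' => ∀ e < E, s'.nat aOut e = if ∃ r < n, s.nat aY r = e then 1 else 0) := by
    refine Ensures.forTo (n := n) (T := 1) (fun k s' =>
      ∀ e < E, s'.nat aOut e = if ∃ r < k, s.nat aY r = e then 1 else 0) rfl (fun s' hf => ?_) hnZ ?_ ?_
    · simp [numUAVs, hf.nat aIn rfl, hh2.uavs]
    · intro e he
      simp [i2, he]
    · intro k hk s' hf hik hI
      have l1 : s'.nat aY = s.nat aY := by rw [hf.nat _ rfl, g3]
      refine Ensures.straight rfl fun e he => ?_
      have : (∃ r < k + 1, s.nat aY r = e) ↔ (e = s.nat aY k ∨ ∃ r < k, s.nat aY r = e) := by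
        constructor
        · rintro ⟨i, hi, h3⟩
          rcases Nat.lt_succ_iff_lt_or_eq.1 hi with hi' | rfl
          · exact Or.inr ⟨i, hi', h3⟩
          · exact Or.inl h3.symm
        · rintro (h3 | ⟨i, hi, h3⟩)
          · exact ⟨k, by omega, h3.symm⟩
          · exact ⟨i, by omega, h3⟩
      simp only [this]
      by_cases hek : e = s.nat aY k
      · simp [hik, l1, hek]
      · have := hI e he
        simp [hik, l1, hek, this]
  refine h3.seq fun s₃ f₃ i3 => ?_
  have l1 : s₃.real rCur 0 = ∑ r ∈ range n, cost (s.nat aY r) := by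
    rw [f₃.real _ rfl, f₂.real _ rfl, i1]
  refine Ensures.straight rfl (Or.inl ⟨hok', ⟨by simp, by simpa using i3, by simpa using l1⟩, ?_⟩)
  intro h1
  simpa [l1] using hc' h1

/-! #### The enumeration of the guesses -/

/-- The number with digits `τ 0, …, τ (g - 1)` in base `b`. -/
def value (b g : ℕ) (τ : ℕ → ℕ) : ℕ := ∑ i ∈ range g, τ i * b ^ i

theorem value_lt {b : ℕ} {τ : ℕ → ℕ} (g : ℕ) (h : ∀ i < g, τ i < b) : value b g τ < b ^ g := by
  induction g with
  | zero => simp [value]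
  | succ g ih =>
    have h1 := ih fun i hi => h i (by omega)
    rw [value, sum_range_succ, ← value, pow_succ']
    have := Nat.mul_le_mul_right (b ^ g) (Nat.succ_le_of_lt (h g (by omega)))
    rw [Nat.succ_mul] at this
    omega

theorem value_inj {b : ℕ} {τ τ' : ℕ → ℕ} (g : ℕ) (h : ∀ i < g, τ i < b) (h' : ∀ i < g, τ' i < b)
    (he : value b g τ = value b g τ') : ∀ i < g, τ i = τ' i := by
  induction g with
  | zero => intro i hi; omega
  | succ g ih =>
    have h1 := value_lt g fun i hi => h i (by omega)
    have h2 := value_lt g fun i hi => h' i (by omega)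
    have e : ∀ t, value b (g + 1) t = t g * b ^ g + value b g t := fun t => by
      rw [value, sum_range_succ, add_comm]; rfl
    rw [e, e] at he
    obtain ⟨e1, e2⟩ := offset_inj h1 h2 he
    intro i hi
    rcases Nat.lt_succ_iff_lt_or_eq.1 hi with hi' | rfl
    · exact ih (fun i hi => h i (by omega)) (fun i hi => h' i (by omega)) e2 i hi'
    · exact e1

/-- Stated additively to avoid truncated subtraction. -/
theorem value_update {b g : ℕ} (τ : ℕ → ℕ) {j : ℕ} (hj : j < g) (v : ℕ) :
    value b g (Function.update τ j v) + τ j * b ^ j = value b g τ + v * b ^ j := by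
  rw [value, value, ← add_sum_erase _ _ (mem_range.2 hj), ← add_sum_erase _ _ (mem_range.2 hj),
    Function.update_self]
  have : ∑ i ∈ (range g).erase j, Function.update τ j v i * b ^ i =
      ∑ i ∈ (range g).erase j, τ i * b ^ i :=
    sum_congr rfl fun i hi => by rw [Function.update_of_ne (ne_of_mem_erase hi)]
  rw [this]
  ring

/-- Go to the next guess. -/
def advance : Prog :=
  .seq (.letN aJ (.const 0)) (.seq
    (.loop (.and (.natLT (nv aJ) (nv aG)) (.natLE numEdges (.get aTup (nv aJ))))
      (.seq (.setNat aTup (nv aJ) (.const 0)) (.letN aJ (.add (nv aJ) (.const 1)))))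
    (.cond (.natLT (nv aJ) (nv aG)) (.setNat aTup (nv aJ) (.add (.get aTup (nv aJ)) (.const 1)))
      (.letN aStop (.const 1))))

/-- Adding one with carry: once the cells below `aJ` have been reset from `E` to `0`, a carry `(E +
1) ^ aJ` is pending. If it runs past the last digit, the old value was the largest one. -/
theorem advance_spec (h : Env n E N m g row col cost weight B s) (hg : g ≤ Z)
    (hd : ∀ i < g, s.nat aTup i ≤ E) (hgo : s.nat aStop 0 = 0) :
    Ensures advance s (1 + (Z * (2 + 1) + 1 + 3)) (fun s' =>
      (s'.nat aStop 0 = 0 ∧ (∀ i < g, s'.nat aTup i ≤ E) ∧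
        value (E + 1) g (s'.nat aTup) = value (E + 1) g (s.nat aTup) + 1) ∨
      (s'.nat aStop 0 = 1 ∧ value (E + 1) g (s.nat aTup) + 1 = (E + 1) ^ g)) := by
  have h1 : Ensures (.letN aJ (.const 0)) s 1 (fun s' => s'.nat aJ 0 = 0) :=
    Ensures.straight rfl (by simp)
  refine h1.seq fun s₁ f₁ i1 => ?_
  have hh := h.frame f₁
  have a1 : s₁.nat aTup = s.nat aTup := f₁.nat _ rfl
  have h2 : Ensures (.loop (.and (.natLT (nv aJ) (nv aG)) (.natLE numEdges (.get aTup (nv aJ))))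
      (.seq (.setNat aTup (nv aJ) (.const 0)) (.letN aJ (.add (nv aJ) (.const 1))))) s₁
      (Z * (2 + 1) + 1) (fun s' => s'.nat aJ 0 ≤ g ∧ (∀ i < g, s'.nat aTup i ≤ E) ∧
        (∀ i < s'.nat aJ 0, s'.nat aTup i = 0) ∧
        value (E + 1) g (s'.nat aTup) + (E + 1) ^ (s'.nat aJ 0) = value (E + 1) g (s.nat aTup) + 1 ∧
        (s'.nat aJ 0 < g → s'.nat aTup (s'.nat aJ 0) < E)) := by
    refine (Ensures.loop (T := 2) (fun K s' => s'.nat aJ 0 ≤ g ∧ (∀ i < g, s'.nat aTup i ≤ E) ∧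
        (∀ i < s'.nat aJ 0, s'.nat aTup i = 0) ∧
        value (E + 1) g (s'.nat aTup) + (E + 1) ^ (s'.nat aJ 0) = value (E + 1) g (s.nat aTup) + 1 ∧
        g - s'.nat aJ 0 ≤ K) Z
        ⟨by omega, by rwa [a1], by simp [i1], by rw [i1, a1, pow_zero], by omega⟩ ?_).post ?_
    · rintro K s' hf ⟨j1, j2, j3, j4, j5⟩ hb
      have e1 : s'.nat aG 0 = g := by rw [hf.nat _ rfl, hh.guesses]
      have e2 : s'.nat aIn 3 = E := by rw [hf.nat _ rfl, hh.genuine]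
      simp [numEdges, e1, e2] at hb
      obtain ⟨b1, b2⟩ := hb
      have b3 : s'.nat aTup (s'.nat aJ 0) = E := le_antisymm (j2 _ b1) b2
      refine Ensures.straight rfl ⟨K - 1, by omega, ?_⟩
      simp
      refine ⟨b1, fun i hi => ?_, fun i hi => ?_, ?_, by omega⟩
      · by_cases hij : i = s'.nat aJ 0
        · simp [hij]
        · simpa [hij] using j2 i hi
      · by_cases hij : i = s'.nat aJ 0
        · simp [hij]
        · simpa [hij] using j3 i (by omega)
      · have := value_update (b := E + 1) (s'.nat aTup) b1 0
        rw [b3, zero_mul, add_zero] at this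
        rw [pow_succ', Nat.succ_mul]
        omega
    · rintro s' hf ⟨⟨K, j1, j2, j3, j4, -⟩, hb⟩
      have e1 : s'.nat aG 0 = g := by rw [hf.nat _ rfl, hh.guesses]
      have e2 : s'.nat aIn 3 = E := by rw [hf.nat _ rfl, hh.genuine]
      refine ⟨j1, j2, j3, j4, fun hlt => ?_⟩
      simp [numEdges, e1, e2] at hb
      exact hb hlt
  refine h2.seq fun s₂ f₂ ⟨j1, j2, j3, j4, j5⟩ => ?_
  have e1 : s₂.nat aG 0 = g := by rw [f₂.nat _ rfl, hh.guesses]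
  have e2 : s₂.nat aStop 0 = 0 := by rw [f₂.nat _ rfl, f₁.nat _ rfl, hgo]
  refine Ensures.straight rfl ?_
  by_cases hlt : s₂.nat aJ 0 < g
  · left
    have h5 := j5 hlt
    simp only [Prog.exec, BExp.Holds, NExp.eval, e1, not_le, if_pos hlt, State.updNat_nat,
      if_neg (show ¬ (42 = 39) by decide), if_true]
    refine ⟨e2, fun i hi => ?_, ?_⟩
    · by_cases hij : i = s₂.nat aJ 0
      · simp [hij]; omega
      · simpa [hij] using j2 i hi
    · have := value_update (b := E + 1) (s₂.nat aTup) hlt (s₂.nat aTup (s₂.nat aJ 0) + 1)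
      rw [Nat.succ_mul] at this
      omega
  · right
    have hjg : s₂.nat aJ 0 = g := by omega
    simp only [Prog.exec, BExp.Holds, NExp.eval, e1, not_le, if_neg hlt, State.updNat_nat, if_true,
      Function.update_self, true_and]
    have h0 : value (E + 1) g (s₂.nat aTup) = 0 := sum_eq_zero fun i hi => by
      rw [j3 i (by rw [hjg]; exact mem_range.1 hi), zero_mul]
    rw [h0, hjg] at j4
    omega

end

variable {n E N m g Z : ℕ} {row col τ π : ℕ → ℕ} {cost weight : ℕ → ℝ} {B ε : ℝ} {s s' : State}

/-! #### The search -/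

/-- Needed because the arrays in memory agree with `guessCost` and `guessWeight` on the edges below
`m` only. -/
theorem IsSolution.congr {c w c' w' : ℕ → ℝ} {t : ℝ} {x : ℕ → ℕ}
    (h : IsSolution N m row col c w B t x) (hc : ∀ e < m, c e = c' e) (hw : ∀ e < m, w e = w' e) :
    IsSolution N m row col c' w' B t x := by
  have key : ∀ (f f' : ℕ → ℝ) (M : ℕ → ℕ), (∀ e < m, f e = f' e) → (∀ r < N, M r < m) →
      total N f M = total N f' M := fun f f' M hf hM =>
    sum_congr rfl fun r hr => hf _ (hM r (mem_range.1 hr))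
  obtain ⟨⟨i, d, hx⟩, h1, h2⟩ := h
  refine ⟨⟨i, d, hx⟩, by rwa [← key w w' x hw hx.lt], fun M hM hMB => ?_⟩
  rw [← key c c' x hc hx.lt, ← key c c' M hc hM.lt]
  exact h2 M hM (by rwa [key w w' M hw hM.lt])

theorem Recorded.congr {x : ℕ → ℕ} (h : Recorded n E cost x s) (h₁ : s'.nat aHave = s.nat aHave)
    (h₂ : s'.nat aOut = s.nat aOut) (h₃ : s'.real rBest = s.real rBest) :
    Recorded n E cost x s' :=
  ⟨by rw [h₁]; exact h.have_pos, by rw [h₂]; exact h.out, by rw [h₃]; exact h.best⟩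

/-- What has been recorded is a relaxed assignment. -/
def Sound (n E N : ℕ) (row col : ℕ → ℕ) (cost weight : ℕ → ℝ) (B : ℝ) (s : State) : Prop :=
  s.nat aHave 0 = 0 ∨ ∃ x, IsRelaxed n E N row col weight B x ∧ Recorded n E cost x s

/-- What has been recorded is nearly as cheap as any assignment with the top edges `τ`. -/
def Done (n E g : ℕ) (row col : ℕ → ℕ) (cost weight : ℕ → ℝ) (B ε : ℝ) (τ : ℕ → ℕ) (s : State) : Prop :=
  ∀ π, IsAssignment n E row col weight B π → IsTop n g cost π τ →
    1 ≤ s.nat aHave 0 ∧ s.real rBest 0 ≤ (1 + ε) * ∑ r ∈ range n, cost (π r)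

/-- Process the present guess and go to the next one. -/
def round : Prog := .seq markGuess (.seq weighEdges (.seq solver (.seq record advance)))

def roundTime (Z : ℕ) : ℕ :=
  Z * 3 + 2 + (Z * 3 + 2) + (1 + (Z * 7 + 2)) + (1 + (Z * (13 + (Z * 2 + 1 + 1) + 2) + 2) +
    (solverTime Z + (Z * 3 + 3 + (Z * 3 + 2 + (Z * 3 + 2 + 2) + 1) + 1 + (1 + (Z * (2 + 1) + 1 + 3)))))

/-- Soundness of the record does not depend on the guess, near optimality does. As the recorded cost
never increases, what earlier guesses have achieved is preserved. -/
theorem round_spec (hn : Network n E N m row col) (hEm : E ≤ m) (hB : 0 ≤ B)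
    (hw : ∀ e, 0 ≤ weight e) (hc : ∀ e, 0 ≤ cost e) (hg : g ≤ n) (hε : 0 ≤ ε)
    (hq : g = n ∨ (0 < n ∧ 0 < g ∧ 1 + 1 / (n : ℝ) ≤ ε * g))
    (hN : N ≤ Z) (hm : m ≤ Z) (hnn : n * n ≤ Z) (hNn : N * (n * n) ≤ Z)
    (h : Env n E N m g row col cost weight B s) (hd : ∀ i < g, s.nat aTup i ≤ E)
    (hgo : s.nat aStop 0 = 0) (hs : Sound n E N row col cost weight B s) :
    Ensures round s (roundTime Z) (fun s' => Sound n E N row col cost weight B s' ∧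
      Done n E g row col cost weight B ε (s.nat aTup) s' ∧
      (∀ τ, Done n E g row col cost weight B ε τ s → Done n E g row col cost weight B ε τ s') ∧
      ((s'.nat aStop 0 = 0 ∧ (∀ i < g, s'.nat aTup i ≤ E) ∧
        value (E + 1) g (s'.nat aTup) = value (E + 1) g (s.nat aTup) + 1) ∨
      (s'.nat aStop 0 = 1 ∧ value (E + 1) g (s.nat aTup) + 1 = (E + 1) ^ g))) := by
  have hnZ : n ≤ Z := hn.n_le.trans hN
  have hE : E ≤ Z := hEm.trans hm
  refine (markGuess_spec h hN hE (hg.trans hnZ) hc).seq fun s₁ f₁ hM => ?_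
  have h1 := h.frame f₁
  refine (weighEdges_spec h1 hm hnn rfl rfl rfl hM.nonneg hc).seq fun s₂ f₂ hW => ?_
  have h2 := h1.frame f₂
  refine (solver_spec (N := N) (m := m) (row := row) (col := col) (c := s₂.real rC)
    (w := s₂.real rW) (B := B) (t := n * n) hn.toNet ⟨h2.toHolds, rfl, rfl, h2.bound⟩ hm
    (fun e he => (hW e he).2) (fun e _ => Nat.floor_le_of_le (guessCost_le hM.nonneg e)) hN hNn
    fun e he => by rw [(hW e he).1]; exact guessWeight_nonneg hB hw e).seq fun s₃ f₃ hS => ?_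
  have h3 := h2.frame f₃
  refine (record_spec h3 hE hnZ).seq fun s₄ f₄ hR => ?_
  have h4 := h3.frame f₄
  have tup4 : s₄.nat aTup = s.nat aTup := by
    rw [f₄.nat _ rfl, f₃.nat _ rfl, f₂.nat _ rfl, f₁.nat _ rfl]
  have stop4 : s₄.nat aStop = s.nat aStop := by
    rw [f₄.nat _ rfl, f₃.nat _ rfl, f₂.nat _ rfl, f₁.nat _ rfl]
  have have3 : s₃.nat aHave = s.nat aHave := by rw [f₃.nat _ rfl, f₂.nat _ rfl, f₁.nat _ rfl]
  have out3 : s₃.nat aOut = s.nat aOut := by rw [f₃.nat _ rfl, f₂.nat _ rfl, f₁.nat _ rfl]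
  have best3 : s₃.real rBest = s.real rBest := by rw [f₃.real _ rfl, f₂.real _ rfl, f₁.real _ rfl]
  rw [have3, out3, best3] at hR
  have hS' : (1 ≤ s₃.nat aOk 0 → IsRelaxed n E N row col weight B (s₃.nat aY)) ∧
      ∀ π, IsAssignment n E row col weight B π → IsTop n g cost π (s.nat aTup) →
        1 ≤ s₃.nat aOk 0 ∧
        ∑ r ∈ range n, cost (s₃.nat aY r) ≤ (1 + ε) * ∑ r ∈ range n, cost (π r) := by
    rcases hS with ⟨hok, hS⟩ | ⟨hok, hS⟩
    · have hS₁ := hS.congr (fun e he => (hW e he).2) (fun e he => (hW e he).1)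
      exact ⟨fun _ => isRelaxed_of_isSolution hn hB hw hS₁, fun π hπ ht =>
        ⟨hok.ge, cost_le_of_isTop hn hEm hB hw hc hM hg hε hq hS₁ hπ ht⟩⟩
    -- A right guess cannot be reported infeasible: the extension of `π` is a matching within the
    -- bound.
    · refine ⟨fun hok' => by omega, fun π hπ ht => ?_⟩
      obtain ⟨M, hMm, hMπ, hME⟩ := hπ.exists_extension hn hEm
      have hG := (ht.guessed hn.n_le hM (hq.imp id fun h => h.2.1) hπ).1
      have h5 := hG.total_le hn hπ hMm hMπ hME
      have h6 := hS M hMm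
      have h7 : total N (s₂.real rW) M = total N (guessWeight n E row cost weight B (s₁.nat 40)
          (s₁.nat 41) (s₁.real 17 0)) M :=
        sum_congr rfl fun r hr => (hW _ (hMm.lt r (mem_range.1 hr))).1
      linarith
  have main : Sound n E N row col cost weight B s₄ ∧
      Done n E g row col cost weight B ε (s.nat aTup) s₄ ∧
      ∀ τ, Done n E g row col cost weight B ε τ s → Done n E g row col cost weight B ε τ s₄ := by
    rcases hR with ⟨hok, hrec, hle⟩ | ⟨r1, r2, r3, r4⟩
    · refine ⟨Or.inr ⟨_, hS'.1 hok, hrec⟩, fun π hπ ht => ⟨hrec.have_pos, ?_⟩,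
        fun τ hτ π hπ ht => ⟨hrec.have_pos, ?_⟩⟩
      · rw [hrec.best]; exact (hS'.2 π hπ ht).2
      · have := hτ π hπ ht
        exact (hle this.1).trans this.2
    · refine ⟨?_, fun π hπ ht => ?_, fun τ hτ π hπ ht => ?_⟩
      · rcases hs with hs | ⟨x, hx, hrec⟩
        · exact Or.inl (by rw [r1, hs])
        · exact Or.inr ⟨x, hx, hrec.congr r1 r2 r3⟩
      · have h5 := hS'.2 π hπ ht
        have h6 := r4 h5.1
        rw [r1, r3]
        exact ⟨h6.1, h6.2.trans h5.2⟩
      · rw [r1, r3]; exact hτ π hπ ht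
  refine (advance_spec h4 (hg.trans hnZ) (by rwa [tup4]) (by rwa [stop4])).post fun s₅ f₅ hA => ?_
  rw [tup4] at hA
  have have5 : s₅.nat aHave = s₄.nat aHave := f₅.nat _ rfl
  have best5 : s₅.real rBest = s₄.real rBest := f₅.real _ rfl
  have done5 : ∀ τ, Done n E g row col cost weight B ε τ s₄ →
      Done n E g row col cost weight B ε τ s₅ := fun τ hτ => by
    unfold Done; rw [have5, best5]; exact hτ
  refine ⟨?_, done5 _ main.2.1, fun τ hτ => done5 τ (main.2.2 τ hτ), hA⟩
  rcases main.1 with h5 | ⟨x, hx, hrec⟩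
  · exact Or.inl (by rw [have5, h5])
  · exact Or.inr ⟨x, hx, hrec.congr have5 (f₅.nat _ rfl) best5⟩

/-- Try all guesses. -/
def search : Prog := .loop (.natLE (nv aStop) (.const 0)) round

theorem IsTop.congr {τ' : ℕ → ℕ} (h : IsTop n g cost π τ) (he : ∀ i < g, τ i = τ' i) :
    IsTop n g cost π τ' := by
  obtain ⟨σ, h1, h2, h3⟩ := h
  refine ⟨σ, fun i hi => ⟨(h1 i hi).1, by rw [← he i hi]; exact (h1 i hi).2⟩, h2, fun r hr => ?_⟩
  exact (h3 r hr).imp id fun h4 i hi => by rw [← he i hi]; exact h4 i hi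

/-- The rows are sorted by decreasing cost, hence the sign in `f`. -/
theorem exists_isTop (π : ℕ → ℕ) (cost : ℕ → ℝ) (hg : g ≤ n) : ∃ τ, IsTop n g cost π τ := by
  set f : Fin n → ℝ := fun r => -cost (π r)
  have hmono := Tuple.monotone_sort f
  set σ : ℕ → ℕ := fun i => if h : i < n then (Tuple.sort f ⟨i, h⟩ : ℕ) else 0
  have hσ : ∀ i (h : i < n), σ i = (Tuple.sort f ⟨i, h⟩ : ℕ) := fun i h => dif_pos h
  refine ⟨fun i => π (σ i), σ, fun i hi => ⟨?_, rfl⟩, fun i hi j hj he => ?_, fun r hr => ?_⟩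
  · rw [hσ i (by omega)]; exact Fin.is_lt _
  · rw [hσ i (by omega), hσ j (by omega)] at he
    exact congrArg Fin.val ((Tuple.sort f).injective (Fin.ext he))
  · obtain ⟨⟨j, hj⟩, hjr⟩ := (Tuple.sort f).surjective ⟨r, hr⟩
    have hjr' : σ j = r := by rw [hσ j hj, hjr]
    by_cases hjg : j < g
    · exact Or.inl ⟨j, hjg, hjr'⟩
    · refine Or.inr fun i hi => ?_
      have hi' : i < n := by omega
      have h1 := hmono (show (⟨i, hi'⟩ : Fin n) ≤ ⟨j, hj⟩ from by rw [Fin.mk_le_mk]; omega)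
      simp only [Function.comp, f, ← hσ i hi', ← hσ j hj, hjr'] at h1
      simpa using h1

/-- Guesses are numbers in base `E + 1`, and all guesses of smaller value have been dealt with. The
digit `E` names no genuine edge; wrong guesses are harmless, and the base stays positive for `E =
0`. -/
theorem search_spec (hn : Network n E N m row col) (hEm : E ≤ m) (hB : 0 ≤ B)
    (hw : ∀ e, 0 ≤ weight e) (hc : ∀ e, 0 ≤ cost e) (hg : g ≤ n) (hε : 0 ≤ ε)
    (hq : g = n ∨ (0 < n ∧ 0 < g ∧ 1 + 1 / (n : ℝ) ≤ ε * g))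
    (hN : N ≤ Z) (hm : m ≤ Z) (hnn : n * n ≤ Z) (hNn : N * (n * n) ≤ Z)
    (h : Env n E N m g row col cost weight B s) (htup : ∀ i, s.nat aTup i = 0)
    (hgo : s.nat aStop 0 = 0) (hhave : s.nat aHave 0 = 0) :
    Ensures search s ((E + 1) ^ g * (roundTime Z + 1) + 1) (fun s' =>
      (∃ π, IsAssignment n E row col weight B π) → ∃ x, IsRelaxed n E N row col weight B x ∧
        Recorded n E cost x s' ∧ ∀ π, IsAssignment n E row col weight B π →
          ∑ r ∈ range n, cost (x r) ≤ (1 + ε) * ∑ r ∈ range n, cost (π r)) := by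
  refine (Ensures.loop (T := roundTime Z) (fun K s' => Sound n E N row col cost weight B s' ∧
    ((s'.nat aStop 0 = 0 ∧ (∀ i < g, s'.nat aTup i ≤ E) ∧ (∀ τ, (∀ i < g, τ i ≤ E) →
        value (E + 1) g τ < value (E + 1) g (s'.nat aTup) →
        Done n E g row col cost weight B ε τ s') ∧
      K + value (E + 1) g (s'.nat aTup) = (E + 1) ^ g) ∨
    (s'.nat aStop 0 = 1 ∧ ∀ τ, (∀ i < g, τ i ≤ E) → Done n E g row col cost weight B ε τ s')))
    ((E + 1) ^ g) ⟨Or.inl hhave, Or.inl ⟨hgo, fun i _ => by simp [htup], ?_, ?_⟩⟩ ?_).post ?_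
  · simp [value, htup]
  · simp [value, htup]
  · rintro K s' hf ⟨hs, hI⟩ hb
    simp only [BExp.Holds, NExp.eval, Nat.le_zero] at hb
    obtain ⟨-, hd, hdone, hK⟩ := hI.resolve_right fun h => by omega
    have hlt := value_lt (b := E + 1) g fun i hi => Nat.lt_succ_of_le (hd i hi)
    refine (round_spec hn hEm hB hw hc hg hε hq hN hm hnn hNn (h.frame hf) hd hb hs).post
      fun s₁ _ ⟨hs₁, hdone₁, hmono, hA⟩ => ⟨K - 1, by omega, hs₁, ?_⟩
    have hall : ∀ τ, (∀ i < g, τ i ≤ E) →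
        value (E + 1) g τ < value (E + 1) g (s'.nat aTup) + 1 →
        Done n E g row col cost weight B ε τ s₁ := by
      intro τ hτ hv
      rcases Nat.lt_succ_iff_lt_or_eq.1 hv with hv | hv
      · exact hmono τ (hdone τ hτ hv)
      · have he := value_inj g (fun i hi => Nat.lt_succ_of_le (hτ i hi))
          (fun i hi => Nat.lt_succ_of_le (hd i hi)) hv
        exact fun π hπ ht => hdone₁ π hπ (ht.congr he)
    rcases hA with ⟨a1, a2, a3⟩ | ⟨a1, a2⟩
    · exact Or.inl ⟨a1, a2, by rwa [a3], by omega⟩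
    · exact Or.inr ⟨a1, fun τ hτ => hall τ hτ (by
        rw [a2]; exact value_lt g fun i hi => Nat.lt_succ_of_le (hτ i hi))⟩
  · rintro s' - ⟨⟨K, hs, hI⟩, hb⟩ ⟨π₀, hπ₀⟩
    simp only [BExp.Holds, NExp.eval, Nat.le_zero] at hb
    obtain ⟨-, hdone⟩ := hI.resolve_left fun h => hb h.1
    have key : ∀ π, IsAssignment n E row col weight B π →
        1 ≤ s'.nat aHave 0 ∧ s'.real rBest 0 ≤ (1 + ε) * ∑ r ∈ range n, cost (π r) := by
      intro π hπ
      obtain ⟨τ, hτ⟩ := exists_isTop π cost hg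
      refine hdone τ (fun i hi => ?_) π hπ hτ
      obtain ⟨σ, h1, -⟩ := hτ
      rw [(h1 i hi).2]
      exact (hπ.lt _ (h1 i hi).1).le
    rcases hs with hs | ⟨x, hx, hrec⟩
    · have := (key π₀ hπ₀).1
      omega
    · exact ⟨x, hx, hrec, fun π hπ => by rw [← hrec.best]; exact (key π hπ).2⟩

/-! #### Instances -/

theorem network_of_edges (hn : n ≤ N) (hrow : ∀ e < E, row e < n) (hcol : ∀ e < E, col e < N)
    (hx : ∀ p < N * N, row (E + p) = p / N ∧ col (E + p) = p % N) :
    Network n E N (E + N * N) row col := by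
  have hextra : ∀ r < N, ∀ j < N, ∃ e < E + N * N, E ≤ e ∧ row e = r ∧ col e = j := by
    intro r hr j hj
    have h1 : r * N + j < N * N := by
      have := Nat.mul_le_mul_right N (Nat.succ_le_of_lt hr)
      rw [Nat.succ_mul] at this
      omega
    refine ⟨E + (r * N + j), by omega, by omega, ?_, ?_⟩
    · rw [(hx _ h1).1, mul_comm, Nat.mul_add_div (by omega), Nat.div_eq_of_lt hj, add_zero]
    · rw [(hx _ h1).2, mul_comm, Nat.mul_add_mod, Nat.mod_eq_of_lt hj]
  have hcase : ∀ e < E + N * N, e < E ∨ ∃ p < N * N, e = E + p := fun e he => by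
    rcases Nat.lt_or_ge e E with h | h
    · exact Or.inl h
    · exact Or.inr ⟨e - E, by omega, by omega⟩
  refine ⟨⟨fun e he => ?_, fun e he => ?_, fun r hr j hj => ?_⟩, hn, hextra⟩
  · rcases hcase e he with h | ⟨p, hp, rfl⟩
    · exact (hrow e h).trans_le hn
    · rw [(hx p hp).1]; exact Nat.div_lt_of_lt_mul hp
  · rcases hcase e he with h | ⟨p, hp, rfl⟩
    · exact hcol e h
    · rw [(hx p hp).2]
      exact Nat.mod_lt _ (Nat.pos_of_ne_zero fun h0 => by simp [h0] at hp)
  · obtain ⟨e, he, -, h⟩ := hextra r hr j hj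
    exact ⟨e, he, h⟩

end Solver

/-! ### Translation between points of the integer program and assignments -/

@[simp] theorem pad_val {α : Type} [Zero α] {n : ℕ} (f : Fin n → α) (i : Fin n) : pad f i = f i := by
  simp [pad]

theorem pad_nonneg {n : ℕ} {f : Fin n → ℝ} (hf : ∀ i, 0 ≤ f i) (i : ℕ) : 0 ≤ pad f i := by
  unfold pad
  split_ifs
  · exact hf _
  · exact le_rfl

variable (I : RRRP)

open Classical in
/-- `y` selects the edges `p r`, one for every UAV `r`. -/
structure Selects (p : Fin I.numUAV → Fin I.numE) (y : Fin I.numE → ℕ) : Prop where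
  owner_eq : ∀ r, I.owner (I.src (p r)) = r
  eq_ite : ∀ e, y e = if ∃ r, p r = e then 1 else 0

variable {I} {p : Fin I.numUAV → Fin I.numE} {y : Fin I.numE → ℕ}

theorem Selects.injective (h : I.Selects p y) : Function.Injective p := fun r q he => by
  rw [← h.owner_eq r, he, h.owner_eq]

/-- Cost, weight, usage and load are all of this form, so the one identity translates them all. -/
theorem Selects.sum_eq (h : I.Selects p y) {R : Type} [CommSemiring R] (F : Fin I.numE → R) :
    ∑ e, F e * (y e : R) = ∑ r, F (p r) := by
  classical
  have h1 : ∀ e, F e * (y e : R) = if e ∈ univ.image p then F e else 0 := fun e => by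
    rw [h.eq_ite e]
    by_cases he : ∃ r, p r = e
    · rw [if_pos he, if_pos (by simpa using he)]; simp
    · rw [if_neg he, if_neg (by simpa using he)]; simp
  rw [sum_congr rfl fun e _ => h1 e, ← sum_filter, filter_mem_eq_inter, univ_inter,
    sum_image fun r _ q _ he => h.injective he]

theorem Selects.usage_eq (h : I.Selects p y) (r : Fin I.numUAV) : I.usage y r = 1 := by
  have h1 := h.sum_eq (fun e => if I.owner (I.src e) = r then (1 : ℕ) else 0)
  simp only [h.owner_eq, sum_ite_eq', mem_univ, if_true, Nat.cast_id] at h1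
  rw [← h1]
  exact sum_congr rfl fun e _ => by split_ifs <;> simp

theorem Selects.load_eq (h : I.Selects p y) (j : Fin I.numG) :
    I.load y j = #{r | I.dst (p r) = j} := by
  have h1 := h.sum_eq (fun e => if I.dst e = j then (1 : ℕ) else 0)
  rw [card_filter, ← h1]
  exact sum_congr rfl fun e _ => by split_ifs <;> simp

/-- For a 0/1 vector, usage one means exactly one selected edge per UAV; since every edge belongs to
some UAV, no other edges are selected. -/
theorem Feasible.exists_selects (hy : I.Feasible y) : ∃ p, I.Selects p y := by
  have h1 : ∀ r, ∃ e, ({e | I.owner (I.src e) = r ∧ y e = 1} : Finset (Fin I.numE)) = {e} := by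
    intro r
    rw [← card_eq_one, card_filter]
    refine Eq.trans ?_ (hy.assigned r)
    refine sum_congr rfl fun e _ => ?_
    by_cases h : I.owner (I.src e) = r <;> rcases hy.integral e with h0 | h0 <;> simp [h, h0]
  choose p hp using h1
  have h2 : ∀ r e, (I.owner (I.src e) = r ∧ y e = 1) ↔ e = p r := fun r e => by
    have := congrArg (e ∈ ·) (hp r)
    simpa using this
  refine ⟨p, fun r => ((h2 r _).2 rfl).1, fun e => ?_⟩
  split_ifs with he
  · obtain ⟨r, rfl⟩ := he
    exact ((h2 r _).2 rfl).2
  · exact (hy.integral e).resolve_right fun h3 => he ⟨_, ((h2 _ e).1 ⟨rfl, h3⟩).symm⟩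

open Solver in
theorem Feasible.exists_isAssignment {row col : ℕ → ℕ}
    (hrow : ∀ e : Fin I.numE, row e = I.owner (I.src e)) (hcol : ∀ e : Fin I.numE, col e = I.dst e)
    (hy : I.Feasible y) :
    ∃ π, IsAssignment I.numUAV I.numE row col (pad I.weight) I.bound π ∧
      ∑ r ∈ range I.numUAV, pad I.cost (π r) = I.totalCost y := by
  obtain ⟨p, hp⟩ := hy.exists_selects
  set π : ℕ → ℕ := fun r => if h : r < I.numUAV then (p ⟨r, h⟩ : ℕ) else 0
  have hπ : ∀ r (h : r < I.numUAV), π r = (p ⟨r, h⟩ : ℕ) := fun r h => dif_pos h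
  have hπ' : ∀ r : Fin I.numUAV, π r = (p r : ℕ) := fun r => hπ r r.2
  refine ⟨π, ⟨fun r hr => ?_, fun r hr => ?_, fun r hr q hq he => ?_, ?_⟩, ?_⟩
  · rw [hπ r hr]; exact Fin.is_lt _
  · rw [hπ r hr, hrow, hp.owner_eq]
  · rw [hπ r hr, hπ q hq, hcol, hcol] at he
    have h1 := hy.capacity (I.dst (p ⟨r, hr⟩))
    rw [hp.load_eq, card_le_one] at h1
    have := h1 ⟨r, hr⟩ (by simp) ⟨q, hq⟩ (by simpa using (Fin.ext he).symm)
    exact congrArg Fin.val this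
  · rw [← Fin.sum_univ_eq_sum_range (fun r => pad I.weight (π r))]
    simp only [hπ', pad_val]
    rw [← hp.sum_eq I.weight]
    exact hy.knapsack
  · rw [← Fin.sum_univ_eq_sum_range (fun r => pad I.cost (π r))]
    simp only [hπ', pad_val]
    rw [← hp.sum_eq I.cost]
    rfl

open Solver in
theorem satisfies_of_isRelaxed {N : ℕ} {row col x : ℕ → ℕ} {cost : ℕ → ℝ} {s : RealRAM.State}
    (hrow : ∀ e : Fin I.numE, row e = I.owner (I.src e)) (hcol : ∀ e : Fin I.numE, col e = I.dst e)
    (hN : I.numG ≤ N) (hx : IsRelaxed I.numUAV I.numE N row col (pad I.weight) I.bound x)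
    (hrec : Recorded I.numUAV I.numE cost x s) :
    I.totalCost (I.output s) = ∑ r ∈ range I.numUAV, pad I.cost (x r) ∧
    I.Satisfies 2 (I.output s) ∧ ∀ j j', 1 < I.load (I.output s) j → 1 < I.load (I.output s) j' →
      j = j' := by
  classical
  set p : Fin I.numUAV → Fin I.numE := fun r => ⟨x r, hx.lt r r.2⟩
  have hpx : ∀ r : Fin I.numUAV, x r = (p r : ℕ) := fun r => rfl
  have hp : I.Selects p (I.output s) := by
    refine ⟨fun r => Fin.ext ?_, fun e => ?_⟩
    · rw [← hrow, ← hpx, hx.row_eq r r.2]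
    · rw [output, hrec.out e e.2]
      refine if_congr ⟨fun ⟨r, hr, h⟩ => ⟨⟨r, hr⟩, Fin.ext h⟩, fun ⟨r, h⟩ => ⟨r, r.2, ?_⟩⟩ rfl rfl
      rw [hpx, h]
  obtain ⟨d, hd⟩ := hx.load
  -- Both the capacity `2` and the uniqueness of the overloaded vertex follow from this bound.
  have hload : ∀ j : Fin I.numG, I.load (I.output s) j ≤ 1 + if (j : ℕ) = d then 1 else 0 := by
    intro j
    refine le_trans (le_of_eq ?_) (hd j (j.2.trans_le hN))
    rw [hp.load_eq, card_filter, card_filter,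
      ← Fin.sum_univ_eq_sum_range (fun r => if col (x r) = j then 1 else 0)]
    refine sum_congr rfl fun r _ => if_congr ?_ rfl rfl
    rw [hpx, hcol, Fin.ext_iff]
  refine ⟨?_, ⟨fun e => ?_, ?_, hp.usage_eq, fun j => (hload j).trans (by split_ifs <;> omega)⟩, ?_⟩
  · rw [← Fin.sum_univ_eq_sum_range (fun r => pad I.cost (x r))]
    simp only [hpx, pad_val]
    exact hp.sum_eq I.cost
  · rw [hp.eq_ite e]
    split_ifs <;> simp
  · refine (hp.sum_eq I.weight).trans_le (le_of_eq_of_le ?_ hx.weight_le)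
    rw [← Fin.sum_univ_eq_sum_range (fun r => pad I.weight (x r))]
    simp only [hpx, pad_val]
  · have h1 : ∀ j : Fin I.numG, 1 < I.load (I.output s) j → (j : ℕ) = d := fun j hj => by
      by_contra hne
      have := hload j
      rw [if_neg hne] at this
      omega
    exact fun j j' hj hj' => Fin.ext ((h1 j hj).trans (h1 j' hj').symm)

/-! ### The running time -/

/-- `f` is bounded by a monomial on the positive numbers. -/
def PolyBounded (f : ℕ → ℕ) : Prop := ∃ C k, ∀ z, 1 ≤ z → f z ≤ C * z ^ k

namespace PolyBounded
variable {f g : ℕ → ℕ}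

theorem const (c : ℕ) : PolyBounded fun _ => c := ⟨c, 0, fun z _ => by simp⟩

theorem id : PolyBounded fun z => z := ⟨1, 1, fun z _ => by simp⟩

theorem add (hf : PolyBounded f) (hg : PolyBounded g) : PolyBounded fun z => f z + g z := by
  obtain ⟨C, k, h⟩ := hf
  obtain ⟨D, l, h'⟩ := hg
  refine ⟨C + D, k + l, fun z hz => ?_⟩
  have h1 := Nat.pow_le_pow_right hz (Nat.le_add_right k l)
  have h2 := Nat.pow_le_pow_right hz (Nat.le_add_left l k)
  calc f z + g z ≤ C * z ^ k + D * z ^ l := add_le_add (h z hz) (h' z hz)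
    _ ≤ C * z ^ (k + l) + D * z ^ (k + l) := by gcongr
    _ = (C + D) * z ^ (k + l) := by ring

theorem mul (hf : PolyBounded f) (hg : PolyBounded g) : PolyBounded fun z => f z * g z := by
  obtain ⟨C, k, h⟩ := hf
  obtain ⟨D, l, h'⟩ := hg
  refine ⟨C * D, k + l, fun z hz => ?_⟩
  calc f z * g z ≤ (C * z ^ k) * (D * z ^ l) := Nat.mul_le_mul (h z hz) (h' z hz)
    _ = C * D * z ^ (k + l) := by ring

end PolyBounded

open Solver in
theorem polyBounded_roundTime {f : ℕ → ℕ} (hf : PolyBounded f) :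
    PolyBounded fun z => roundTime (f z) := by
  have h1 : PolyBounded fun z => hungarianTime (f z) := by
    unfold hungarianTime
    repeat' first | exact hf | exact .const _ | refine .add ?_ ?_ | refine .mul ?_ ?_
  have h2 : PolyBounded fun z => solveTime (f z) := by
    unfold solveTime
    repeat' first | exact hf | exact h1 | exact .const _ | refine .add ?_ ?_
  have h3 : PolyBounded fun z => newtonTime (f z) := by
    unfold newtonTime
    repeat' first | exact hf | exact h2 | exact .const _ | refine .add ?_ ?_ | refine .mul ?_ ?_
  have h4 : PolyBounded fun z => solverTime (f z) := by
    unfold solverTime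
    repeat' first | exact hf | exact h2 | exact h3 | exact .const _ | refine .add ?_ ?_ |
      refine .mul ?_ ?_
  unfold roundTime
  repeat' first | exact hf | exact h4 | exact .const _ | refine .add ?_ ?_ | refine .mul ?_ ?_

open Solver in
theorem polyBounded_buildTime {f : ℕ → ℕ} (hf : PolyBounded f) :
    PolyBounded fun z => buildTime (f z) := by
  unfold buildTime
  repeat' first | exact hf | exact .const _ | refine .add ?_ ?_ | refine .mul ?_ ?_

/-! ### The algorithm -/

namespace Solver

/-- The approximation algorithm. -/
def algorithm : Prog := .seq buildNetwork (.seq countGuesses search)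

/-- The running time without the number of guesses. -/
def baseTime (z : ℕ) : ℕ :=
  buildTime (2 * z ^ 3) + (3 + (2 * z ^ 3 * 7 + 2 + 3) + (z * (roundTime (2 * z ^ 3) + 1) + 1))

theorem polyBounded_baseTime : PolyBounded baseTime := by
  have h1 : PolyBounded fun z => 2 * z ^ 3 := ⟨2, 3, fun _ _ => le_rfl⟩
  have h2 := polyBounded_roundTime h1
  have h3 := polyBounded_buildTime h1
  unfold baseTime
  exact h3.add (((PolyBounded.const 3).add (((h1.mul (.const 7)).add (.const 2)).add (.const 3))).add
    ((PolyBounded.id.mul (h2.add (.const 1))).add (.const 1)))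

/-- The number of guessed edges may be `⌈1/ε⌉ + 1`, one more than the exponent allowed; the surplus
factor `E + 1 ≤ S` is absorbed into the polynomial part. -/
theorem time_le_baseTime {E S : ℕ} (c : ℕ) (hE : E + 1 ≤ S) :
    buildTime (2 * S ^ 3) + (3 + (2 * S ^ 3 * 7 + 2 + 3) +
      ((E + 1) ^ (c + 1) * (roundTime (2 * S ^ 3) + 1) + 1)) ≤ (E + 1) ^ c * baseTime S := by
  have h1 : 1 ≤ (E + 1) ^ c := Nat.one_le_pow _ _ (Nat.succ_pos E)
  have h3 : ∀ a : ℕ, a ≤ (E + 1) ^ c * a := fun a => Nat.le_mul_of_pos_left a h1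
  have h2 : (E + 1) ^ (c + 1) * (roundTime (2 * S ^ 3) + 1) ≤
      (E + 1) ^ c * (S * (roundTime (2 * S ^ 3) + 1)) := by
    rw [pow_succ, mul_assoc]
    exact Nat.mul_le_mul_left _ (Nat.mul_le_mul_right _ hE)
  have h6 := h3 1
  rw [mul_one] at h6
  rw [baseTime, mul_add ((E + 1) ^ c) (buildTime _), mul_add ((E + 1) ^ c) (3 + _),
    mul_add ((E + 1) ^ c) (S * _), mul_one]
  exact add_le_add (h3 _) (add_le_add (h3 _) (add_le_add h2 h6))

theorem input_nat_eq_zero (I : RRRP) (ε : ℝ) {a : ℕ} (ha : 3 < a) (i : ℕ) : (I.input ε).nat a i = 0 :=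
  match a, ha with
  | _ + 4, _ => rfl

/-- The sizes of the network that belongs to an instance of size `S`. -/
theorem network_size_le {n N E S : ℕ} (hn : n ≤ S) (hN : N ≤ S) (hE : E ≤ S) :
    E + N * N ≤ 2 * S ^ 3 ∧ n * n ≤ 2 * S ^ 3 ∧ N * (n * n) ≤ 2 * S ^ 3 ∧ S ≤ 2 * S ^ 3 := by
  have h1 : S ≤ S ^ 3 := Nat.le_self_pow (by norm_num) S
  have h2 : S ^ 2 ≤ S ^ 3 := by
    rcases Nat.eq_zero_or_pos S with rfl | h
    · norm_num
    · exact Nat.pow_le_pow_right h (by norm_num)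
  have h3 : N * N ≤ S ^ 2 := by rw [sq]; exact Nat.mul_le_mul hN hN
  have h4 : n * n ≤ S ^ 2 := by rw [sq]; exact Nat.mul_le_mul hn hn
  have h5 : N * (n * n) ≤ S ^ 3 := by rw [pow_succ']; exact Nat.mul_le_mul hN h4
  omega

theorem algorithm_spec (I : RRRP) {ε : ℝ} (hε : 0 < ε) :
    Ensures algorithm (I.input ε) ((I.numE + 1) ^ ⌈1 / ε⌉₊ * baseTime I.size) (fun s =>
      (∃ y, I.Feasible y) → I.totalCost (I.output s) ≤ (1 + ε) * I.opt ∧ I.Satisfies 2 (I.output s) ∧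
        ∀ j j', 1 < I.load (I.output s) j → 1 < I.load (I.output s) j' → j = j') := by
  have hnS : I.numUAV ≤ I.size := by rw [RRRP.size]; omega
  have hNS : I.numUAV + I.numG ≤ I.size := by rw [RRRP.size]; omega
  have hES : I.numE + 1 ≤ I.size := by rw [RRRP.size]; omega
  -- The single parameter `Z = 2 S³` dominates the number of edges of the network, the rounded costs
  -- `n²` and the cost gap `N n²`.
  obtain ⟨z1, z2, z3, z4⟩ := network_size_le hnS hNS (Nat.le_of_succ_le hES)
  have hw0 : ∀ e, 0 ≤ I.weight e := fun e =>
    Real.log_nonneg (by rw [le_div_iff₀ (I.prob_pos e)]; linarith [I.prob_le_one e])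
  have hB0 : 0 ≤ I.bound :=
    Real.log_nonneg (by rw [le_div_iff₀ I.rho_pos]; linarith [I.rho_lt_one])
  have i0 : (I.input ε).nat aIn 0 = I.numUAV := pad_val ![I.numUAV, I.numA, I.numG, I.numE] 0
  have i2 : (I.input ε).nat aIn 2 = I.numG := pad_val ![I.numUAV, I.numA, I.numG, I.numE] 2
  have i3 : (I.input ε).nat aIn 3 = I.numE := pad_val ![I.numUAV, I.numA, I.numG, I.numE] 3
  have r0 : (I.input ε).real rIn 0 = ε := pad_val ![ε, I.bound] 0
  have r1 : (I.input ε).real rIn 1 = I.bound := pad_val ![ε, I.bound] 1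
  refine ((buildNetwork_spec (Z := 2 * I.size ^ 3) (by rw [i0, i2]) i3 (hNS.trans z4)
    (Nat.le_of_succ_le (hES.trans z4))).seq fun s₁ f₁ ⟨hh, hgen, hext⟩ => ?_).mono
    (time_le_baseTime _ hES) fun _ _ h => h
  have hrow : ∀ e : Fin I.numE, s₁.nat aRow e = I.owner (I.src e) := fun e => by
    rw [(hgen e e.2).1]
    show pad (fun v => (I.owner v : ℕ)) (pad (fun e => (I.src e : ℕ)) (e : ℕ)) = _
    rw [pad_val, pad_val]
  have hcol : ∀ e : Fin I.numE, s₁.nat aCol e = I.dst e := fun e => by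
    rw [(hgen e e.2).2]
    exact pad_val (fun e => (I.dst e : ℕ)) e
  -- The square network must have at least as many rows as UAVs and as many columns as UGV vertices;
  -- the sum of both numbers serves without taking a maximum.
  have hnet : Network I.numUAV I.numE (I.numUAV + I.numG)
      (I.numE + (I.numUAV + I.numG) * (I.numUAV + I.numG)) (s₁.nat aRow) (s₁.nat aCol) := by
    refine network_of_edges (Nat.le_add_right _ _) (fun e he => ?_) (fun e he => ?_) hext
    · exact (hrow ⟨e, he⟩).trans_lt (Fin.is_lt _)
    · exact (hcol ⟨e, he⟩).trans_lt ((Fin.is_lt _).trans_le (Nat.le_add_left _ _))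
  refine (countGuesses_spec (n := I.numUAV) (by rw [f₁.nat _ rfl, i0]) (by rw [f₁.real _ rfl, r0]) hε
    (hnS.trans z4)).seq fun s₂ f₂ ⟨hreal, hgn, hgε, hq⟩ => ?_
  have henv : Env I.numUAV I.numE (I.numUAV + I.numG)
      (I.numE + (I.numUAV + I.numG) * (I.numUAV + I.numG)) (s₂.nat aG 0) (s₁.nat aRow) (s₁.nat aCol)
      (pad I.cost) (pad I.weight) I.bound s₂ := by
    refine ⟨hh.frame f₂, ?_, ?_, rfl, ?_, ?_, ?_, hreal⟩
    · rw [f₂.nat _ rfl, f₁.nat _ rfl, i0]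
    · rw [f₂.nat _ rfl, f₁.nat _ rfl, i3]
    · rw [f₂.real _ rfl, f₁.real _ rfl, r1]
    · rw [f₂.real _ rfl, f₁.real _ rfl]; rfl
    · rw [f₂.real _ rfl, f₁.real _ rfl]; rfl
  refine (search_spec hnet (Nat.le_add_right _ _) hB0 (pad_nonneg hw0) (pad_nonneg I.cost_nonneg) hgn
    hε.le hq (hNS.trans z4) z1 z2 z3 henv (fun i => ?_) ?_ ?_).mono ?_ fun s₃ _ hres ⟨y, hy⟩ => ?_
  · rw [f₂.nat aTup rfl, f₁.nat aTup rfl, input_nat_eq_zero _ _ (by norm_num)]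
  · rw [f₂.nat aStop rfl, f₁.nat aStop rfl, input_nat_eq_zero _ _ (by norm_num)]
  · rw [f₂.nat aHave rfl, f₁.nat aHave rfl, input_nat_eq_zero _ _ (by norm_num)]
  · exact Nat.add_le_add_right (Nat.mul_le_mul_right _ (Nat.pow_le_pow_right (Nat.succ_pos _) hgε)) 1
  · obtain ⟨y', hy', hopt⟩ := (I.isLeast_opt ⟨y, hy⟩).1
    obtain ⟨π, hπ, hπc⟩ := Feasible.exists_isAssignment hrow hcol hy'
    obtain ⟨x, hx, hrec, hle⟩ := hres ⟨π, hπ⟩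
    obtain ⟨k1, k2, k3⟩ := satisfies_of_isRelaxed hrow hcol (Nat.le_add_left _ _) hx hrec
    refine ⟨?_, k2, k3⟩
    rw [k1, ← hopt, ← hπc]
    exact hle π hπ

end Solver

end RRRP

theorem theorem1 :
    ∃ (P : RealRAM.Prog) (C k : ℕ), ∀ (I : RRRP) (ε : ℝ), 0 < ε → ε ≤ 1 →
      ∃ (t : ℕ) (s : RealRAM.State),
        RealRAM.Runs P (I.input ε) t s ∧
        t ≤ C * (I.numE + 1) ^ ⌈1 / ε⌉₊ * I.size ^ k ∧
        ((∃ y, I.Feasible y) →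
          I.totalCost (I.output s) ≤ (1 + ε) * I.opt ∧
          I.Satisfies 2 (I.output s) ∧
          ∀ j j' : Fin I.numG,
            1 < I.load (I.output s) j → 1 < I.load (I.output s) j' → j = j') := by
  obtain ⟨C, k, hCk⟩ := RRRP.Solver.polyBounded_baseTime
  refine ⟨RRRP.Solver.algorithm, C, k, fun I ε hε _ => ?_⟩
  obtain ⟨t, s, hrun, ht, hpost⟩ := RRRP.Solver.algorithm_spec I hε
  refine ⟨t, s, hrun, ht.trans ?_, hpost⟩
  calc (I.numE + 1) ^ ⌈1 / ε⌉₊ * RRRP.Solver.baseTime I.size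
      ≤ (I.numE + 1) ^ ⌈1 / ε⌉₊ * (C * I.size ^ k) :=
        Nat.mul_le_mul_left _ (hCk _ (Nat.le_add_left 1 _))
    _ = C * (I.numE + 1) ^ ⌈1 / ε⌉₊ * I.size ^ k := by ring
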